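/- Let $M$ be a smooth (Hausdorff) 4-dimensional Riemannian spin manifold, with orientation and spin structure fixed, and let $S_\pm$ be its two complex rank-two spinor bundles, so that $TM\otimes\mathbb C\cong S_+\otimes S_-$ and $S_+^2\cong\Lambda^+\otimes\mathbb C$. Write $S_\pm^k$ for the $k$-th symmetric power, use unprimed indices $A$ for $S_+$ and primed indices $A'$ for $S_-$, lower indices with the spinor metrics $\epsilon$, and let $\nabla^{AA'}$ be the Levi-Civita (spin) covariant derivative in spinor notation. On smooth sections define $$d:S_+^k\otimes S_-^n\to S_+^{k+1}\otimes S_-^{n+1},\qquad (d\psi)^{A_1\ldots A_{k+1}A_1'\ldots A_{n+1}'}=(k+1)(n+1)\,\nabla^{(A_{k+1}(A_{n+1}'}\psi^{A_1\ldots A_k)A_1'\ldots A_n')},$$ $$\delta:S_+^k\otimes S_-^n\to S_+^{k+1}\otimes S_-^{n-1}\ (n\ge1),\qquad (\delta\psi)^{A_1\ldots A_{k+1}A_1'\ldots A_{n-1}'}=(k+1)\,\nabla^{(A_{k+1}}{}_{A'}\psi^{A_1\ldots A_k)A_1'\ldots A_{n-1}'A'},$$ where the round brackets denote symmetrisation separately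 in the unprimed and in the primed indices, and put $\delta=0$ on $S_+^k$. Let $W^+$ be the self-dual part of the Weyl curvature, and call the metric Einstein if the Ricci tensor is at every point a multiple of the metric. Then: 1. $d\delta-\delta d=0$ on the sections of $S_+^k\otimes S_-^n$ for all $k,n\ge0$ if and only if $W^+=0$ and the metric is Einstein. Moreover, for each single pair $k,n\ge1$, $d\delta-\delta d=0$ on the sections of $S_+^k\otimes S_-^n$ if and only if $W^+=0$ and the metric is Einstein. 2. For each $k\ge1$, on $S_+^k$ the term $d\delta$ is absent, and $\delta d=0$ on the sections of $S_+^k$ if and only if $W^+=0$. 3. For each $n\ge1$, $d\delta-\delta d=0$ on the sections of $S_-^n$ if and only if the metric is Einstein. -/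

import Mathlib

open scoped Manifold ContDiff Bundle

noncomputable section

namespace SpinFour

/-- The model space `ℝ⁴`. -/
abbrev E4 : Type := EuclideanSpace ℝ (Fin 4)

/-! ### Levi-Civita connection and curvature of a Riemannian metric -/

section LeviCivita

variable {M : Type*} [TopologicalSpace M] [ChartedSpace E4 M] [IsManifold (𝓡 4) ∞ M]
  [Bundle.RiemannianBundle (fun x : M => TangentSpace (𝓡 4) x)]

instance finiteDimensional_tangentSpace (x : M) : FiniteDimensional ℝ (TangentSpace (𝓡 4) x) :=
  inferInstanceAs (FiniteDimensional ℝ E4)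

/-- The right-hand side of the Koszul formula for `⟨∇_X Y, Z⟩` at `x`. -/
def koszul (X Y Z : Π x : M, TangentSpace (𝓡 4) x) (x : M) : ℝ :=
  (1 / 2) *
    (mvfderiv (𝓡 4) (fun y => inner ℝ (Y y) (Z y)) x (X x)
      + mvfderiv (𝓡 4) (fun y => inner ℝ (X y) (Z y)) x (Y x)
      - mvfderiv (𝓡 4) (fun y => inner ℝ (X y) (Y y)) x (Z x)
      + inner ℝ (VectorField.mlieBracket (𝓡 4) X Y x) (Z x)
      - inner ℝ (VectorField.mlieBracket (𝓡 4) X Z x) (Y x)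
      - inner ℝ (VectorField.mlieBracket (𝓡 4) Y Z x) (X x))

/-- The Levi-Civita covariant derivative `∇_X Y` at `x`: the tangent vector whose inner products
with the vectors of an orthonormal basis of the tangent space at `x` are given by the Koszul
formula. The basis vectors are extended to vector fields that are smooth near `x`; the Koszul
expression depends on its last argument only through the value at `x`. -/
def leviCivita (X Y : Π x : M, TangentSpace (𝓡 4) x) (x : M) : TangentSpace (𝓡 4) x :=
  ∑ c, koszul X Y
      (FiberBundle.extend E4 (stdOrthonormalBasis ℝ (TangentSpace (𝓡 4) x) c)) x
    • stdOrthonormalBasis ℝ (TangentSpace (𝓡 4) x) c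

/-- `R(X, Y) Z = ∇_X ∇_Y Z - ∇_Y ∇_X Z - ∇_[X, Y] Z`. -/
def curvature (X Y Z : Π x : M, TangentSpace (𝓡 4) x) (x : M) : TangentSpace (𝓡 4) x :=
  leviCivita X (leviCivita Y Z) x - leviCivita Y (leviCivita X Z) x
    - leviCivita (VectorField.mlieBracket (𝓡 4) X Y) Z x

/-- Components `⟨R(e_a, e_b) e_c, e_d⟩` of the Riemann tensor in a frame `e`. -/
def riemann (e : Fin 4 → Π x : M, TangentSpace (𝓡 4) x) (x : M) (a b c d : Fin 4) : ℝ :=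
  inner ℝ (curvature (e a) (e b) (e c) x) (e d x)

/-- Components of the Ricci tensor, the trace of `X ↦ R(X, e_b) e_c`, in an orthonormal frame. -/
def ricci (e : Fin 4 → Π x : M, TangentSpace (𝓡 4) x) (x : M) (b c : Fin 4) : ℝ :=
  ∑ a, riemann e x a b c a

/-- The scalar curvature, computed in an orthonormal frame. -/
def scalar (e : Fin 4 → Π x : M, TangentSpace (𝓡 4) x) (x : M) : ℝ :=
  ∑ a, ricci e x a a

/-- Kronecker delta: the components of the metric in an orthonormal frame. -/
def kdelta (a b : Fin 4) : ℝ := if a = b then 1 else 0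

/-- Components of the Weyl tensor in an orthonormal frame (dimension four). -/
def weyl (e : Fin 4 → Π x : M, TangentSpace (𝓡 4) x) (x : M) (a b c d : Fin 4) : ℝ :=
  riemann e x a b c d
    - (1 / 2) * (ricci e x a d * kdelta b c + ricci e x b c * kdelta a d
        - ricci e x a c * kdelta b d - ricci e x b d * kdelta a c)
    + (scalar e x / 6) * (kdelta a d * kdelta b c - kdelta a c * kdelta b d)

/-- The totally antisymmetric symbol with `volSymbol 0 1 2 3 = 1`: the components of the volume
form in a positively oriented orthonormal frame. -/
def volSymbol (a b c d : Fin 4) : ℝ :=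
  ((Matrix.of fun i j : Fin 4 => if ![a, b, c, d] i = j then (1 : ℤ) else 0).det : ℤ)

/-- Components of the self-dual part `W⁺ = (W + ⋆W) / 2` of the Weyl tensor in a positively
oriented orthonormal frame. -/
def weylPlus (e : Fin 4 → Π x : M, TangentSpace (𝓡 4) x) (x : M) (a b c d : Fin 4) : ℝ :=
  (1 / 2) * (weyl e x a b c d
    + (1 / 2) * ∑ p, ∑ r, volSymbol a b p r * weyl e x p r c d)

end LeviCivita

/-! ### Spin structures

`Spin(4) = SU(2) × SU(2)`, and `ℝ⁴` is identified with the quaternions, realised as `2 × 2`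
complex matrices, so that `(a, b)` acts on `ℝ⁴` by `q ↦ a q b⁻¹`. The first factor acts on `S₊`
and the second one on `S₋`. With the orientation `1, i, j, k`, left multiplications by imaginary
quaternions correspond to self-dual two-forms, so `S₊²` is the bundle of self-dual two-forms. -/

/-- The unit quaternions `1, i, j, k` as complex matrices. -/
def quat : Fin 4 → Matrix (Fin 2) (Fin 2) ℂ :=
  ![1,
    !![Complex.I, 0; 0, -Complex.I],
    !![0, 1; -1, 0],
    !![0, Complex.I; Complex.I, 0]]

/-- The spinor metric `ε`. -/
def eps : Matrix (Fin 2) (Fin 2) ℂ := !![0, 1; -1, 0]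

/-- The isomorphism of `ℝ⁴ ⊗ ℂ` with `S₊ ⊗ S₋` on basis vectors: `σ_c` has components
`σ_c^{AA'} = (q_c ε)^{AA'}`. It intertwines `v ↦ a v b⁻¹` with `V ↦ a V bᵀ`. -/
def soldering (c : Fin 4) : Matrix (Fin 2) (Fin 2) ℂ := quat c * eps

/-- The double cover `Spin(4) → SO(4)`: the matrix of `q ↦ a q b⁻¹` in the basis `1, i, j, k`. -/
def spinCover (a b : Matrix.specialUnitaryGroup (Fin 2) ℂ) : Matrix (Fin 4) (Fin 4) ℝ :=
  Matrix.of fun c d =>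
    (1 / 2) * (Matrix.trace ((quat c).conjTranspose * (a : Matrix (Fin 2) (Fin 2) ℂ) * quat d
      * (b : Matrix (Fin 2) (Fin 2) ℂ).conjTranspose)).re

/-- A spin structure (with the underlying orientation) on a Riemannian four-manifold, given by
local trivialisations: an open cover with smooth orthonormal frames, declared to be positively
oriented, and a smooth `Spin(4)`-valued cocycle lifting the transition functions of the frames. -/
structure SpinStructure (M : Type*) [TopologicalSpace M] [ChartedSpace E4 M]
    [IsManifold (𝓡 4) ∞ M] [Bundle.RiemannianBundle (fun x : M => TangentSpace (𝓡 4) x)] where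
  /-- index set of the cover -/
  ι : Type*
  /-- the open cover -/
  U : ι → Set M
  isOpen_U : ∀ i, IsOpen (U i)
  cover : ∀ x, ∃ i, x ∈ U i
  /-- the local frames -/
  e : ι → Fin 4 → Π x : M, TangentSpace (𝓡 4) x
  smooth_e : ∀ i a, ContMDiffOn (𝓡 4) (𝓡 4).tangent ∞
    (fun x => (⟨x, e i a x⟩ : TangentBundle (𝓡 4) M)) (U i)
  orthonormal_e : ∀ i, ∀ x ∈ U i, ∀ a b, inner ℝ (e i a x) (e i b x) = kdelta a b
  /-- transition functions of `S₊` -/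
  tp : ι → ι → M → Matrix.specialUnitaryGroup (Fin 2) ℂ
  /-- transition functions of `S₋` -/
  tm : ι → ι → M → Matrix.specialUnitaryGroup (Fin 2) ℂ
  smooth_tp : ∀ i j A B, ContMDiffOn (𝓡 4) 𝓘(ℝ, ℂ) ∞
    (fun x => (tp i j x : Matrix (Fin 2) (Fin 2) ℂ) A B) (U i ∩ U j)
  smooth_tm : ∀ i j A B, ContMDiffOn (𝓡 4) 𝓘(ℝ, ℂ) ∞
    (fun x => (tm i j x : Matrix (Fin 2) (Fin 2) ℂ) A B) (U i ∩ U j)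
  cocycle_tp : ∀ i j l, ∀ x ∈ U i ∩ U j ∩ U l, tp i j x * tp j l x = tp i l x
  cocycle_tm : ∀ i j l, ∀ x ∈ U i ∩ U j ∩ U l, tm i j x * tm j l x = tm i l x
  frame_change : ∀ i j, ∀ x ∈ U i ∩ U j, ∀ d,
    e j d x = ∑ c, spinCover (tp i j x) (tm i j x) c d • e i c x

/-- Components `ψ^{A₁…A_k A'₁…A'_n}` with `k` unprimed and `n` primed indices. -/
abbrev SpinTensor (k n : ℕ) : Type := (Fin k → Fin 2) → (Fin n → Fin 2) → ℂ

section Spinors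

variable {M : Type*} [TopologicalSpace M] [ChartedSpace E4 M] [IsManifold (𝓡 4) ∞ M]
  [Bundle.RiemannianBundle (fun x : M => TangentSpace (𝓡 4) x)]

/-- A smooth section of `S₊^k ⊗ S₋^n` (symmetric powers): smooth component functions in each
local trivialisation, symmetric in the unprimed and in the primed indices, which transform with
the transition functions. -/
structure SpinorField (S : SpinStructure M) (k n : ℕ) where
  /-- the components in each trivialisation -/
  comp : S.ι → M → SpinTensor k n
  smooth : ∀ i A A', ContMDiffOn (𝓡 4) 𝓘(ℝ, ℂ) ∞ (fun x => comp i x A A') (S.U i)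
  symm : ∀ i, ∀ x ∈ S.U i, ∀ (s : Equiv.Perm (Fin k)) (t : Equiv.Perm (Fin n)) A A',
    comp i x (A ∘ s) (A' ∘ t) = comp i x A A'
  transition : ∀ i j, ∀ x ∈ S.U i ∩ S.U j, ∀ A A',
    comp i x A A' = ∑ B : Fin k → Fin 2, ∑ B' : Fin n → Fin 2,
      (∏ m, (S.tp i j x : Matrix (Fin 2) (Fin 2) ℂ) (A m) (B m))
        * (∏ m, (S.tm i j x : Matrix (Fin 2) (Fin 2) ℂ) (A' m) (B' m)) * comp j x B B'

namespace SpinStructure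

variable (S : SpinStructure M)

/-- The `𝔰𝔬(4)`-valued connection form of the Levi-Civita connection in the frame `e i`:
`connForm i c x a b = ⟨∇_{e_c} e_b, e_a⟩`. -/
def connForm (i : S.ι) (c : Fin 4) (x : M) (a b : Fin 4) : ℝ :=
  inner ℝ (leviCivita (S.e i c) (S.e i b) x) (S.e i a x)

/-- The component in the first factor of `𝔰𝔲(2) ⊕ 𝔰𝔲(2) = 𝔰𝔬(4)` of the connection form along
`e_c`. The matrix `Ω` in `𝔰𝔬(4)` corresponds to the pair `(α, β)` such that
`Ω` acts on quaternions as `q ↦ α q - q β`. -/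
def connPlus (i : S.ι) (c : Fin 4) (x : M) : Matrix (Fin 2) (Fin 2) ℂ :=
  (1 / 4 : ℂ) • ∑ a, ∑ b, (S.connForm i c x a b : ℂ) • (quat a * (quat b).conjTranspose)

/-- The component in the second factor of `𝔰𝔲(2) ⊕ 𝔰𝔲(2) = 𝔰𝔬(4)` of the connection form
along `e_c`. -/
def connMinus (i : S.ι) (c : Fin 4) (x : M) : Matrix (Fin 2) (Fin 2) ℂ :=
  (1 / 4 : ℂ) • ∑ a, ∑ b, (S.connForm i c x a b : ℂ) • ((quat a).conjTranspose * quat b)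

variable {S}
variable {k n : ℕ}

/-- The covariant derivative `∇_{e_c} φ` of a spinor field with components `φ` in the
trivialisation `i`, for the spin connection (the lift of the Levi-Civita connection). -/
def covDeriv (i : S.ι) (c : Fin 4) (φ : M → SpinTensor k n) (x : M) : SpinTensor k n :=
  fun A A' =>
    mvfderiv (𝓡 4) (fun y => φ y A A') x (S.e i c x)
      + ∑ m, ∑ B, S.connPlus i c x (A m) B * φ x (Function.update A m B) A'
      + ∑ m, ∑ B', S.connMinus i c x (A' m) B' * φ x A (Function.update A' m B')

/-- The operator `∇^{BB'} = ∑ σ_c^{BB'} ∇_{e_c}`. -/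
def nabla (i : S.ι) (B B' : Fin 2) (φ : M → SpinTensor k n) (x : M) : SpinTensor k n :=
  fun A A' => ∑ c, soldering c B B' * covDeriv i c φ x A A'

/-- The operator `d : S₊^k ⊗ S₋^n → S₊^(k+1) ⊗ S₋^(n+1)`,
`ψ ↦ (k+1)(n+1) ∇^{(A(A'} ψ^{…)…)}`, in the trivialisation `i`. As `ψ` is symmetric, `(k+1)(n+1)`
times the symmetrisation is the sum over the positions of the two indices of `∇`. -/
def dOp (i : S.ι) (φ : M → SpinTensor k n) (x : M) : SpinTensor (k + 1) (n + 1) :=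
  fun A A' => ∑ p : Fin (k + 1), ∑ r : Fin (n + 1),
    nabla i (A p) (A' r) φ x (fun m => A (p.succAbove m)) (fun m => A' (r.succAbove m))

/-- The operator `δ : S₊^k ⊗ S₋^(n+1) → S₊^(k+1) ⊗ S₋^n`,
`ψ ↦ (k+1) ∇^{(A}_{B'} ψ^{…)…B'}`, in the trivialisation `i`, where the primed index is lowered
with `ε`. As `ψ` is symmetric, `k+1` times the symmetrisation is the sum over the positions of
the unprimed index of `∇`. -/
def deltaOp (i : S.ι) (φ : M → SpinTensor k (n + 1)) (x : M) : SpinTensor (k + 1) n :=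
  fun A A' => ∑ p : Fin (k + 1), ∑ B', ∑ C',
    eps B' C' * nabla i (A p) B' φ x (fun m => A (p.succAbove m)) (Fin.snoc A' C')

variable (S)

/-- `dδ - δd` vanishes on sections of `S₊^k ⊗ S₋^n`. On `S₊^k` the operator `δ` is absent and the
condition is `δd = 0`. -/
def CommutesOn (k : ℕ) : ℕ → Prop
  | 0 => ∀ ψ : SpinorField S k 0, ∀ i, ∀ x ∈ S.U i, deltaOp i (dOp i (ψ.comp i)) x = 0
  | n + 1 => ∀ ψ : SpinorField S k (n + 1), ∀ i, ∀ x ∈ S.U i,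
      dOp i (deltaOp i (ψ.comp i)) x - deltaOp i (dOp i (ψ.comp i)) x = 0

/-- The self-dual part of the Weyl curvature vanishes. -/
def WeylPlusVanishes : Prop :=
  ∀ i, ∀ x ∈ S.U i, ∀ a b c d, weylPlus (S.e i) x a b c d = 0

/-- The metric is Einstein: at every point the Ricci tensor is a multiple of the metric. -/
def IsEinstein : Prop :=
  ∀ i, ∀ x ∈ S.U i, ∃ r : ℝ, ∀ a b, ricci (S.e i) x a b = r * kdelta a b

end SpinStructure

end Spinors

end SpinFour

end

open scoped Manifold ContDiff Bundle

noncomputable section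

namespace SpinFour

/-! ### Tensoriality, Leibniz rule and torsion-freeness of the Levi-Civita connection. -/

section LeviCivitaProperties

open VectorField

variable {M : Type*} [TopologicalSpace M] [ChartedSpace E4 M]

/-! Both `dδ` and `δd` are second covariant derivatives, symmetrised over all `k + 2` unprimed
indices and contracted once with `ε` over primed indices. The two differ by where the contraction
sits. The two-dimensional identity `sum_eps_antisymm` turns the difference into terms in which the
two derivatives are contracted with each other. With the unprimed indices symmetrised, such a
contraction is antisymmetric in the derivatives, so the Ricci identity `hess_sub_hess` makes it a
curvature term. On `S₊^k ⊗ S₋^n` one finds `dδ - δd = -(n+1)/2 · curvPair` for `n ≥ 1`, and `δd =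
1/2 · curvPair` for `n = 0`. Commutation is therefore a pointwise algebraic condition
(`commutesOn_iff`).

Only the curvature with form indices in `Λ⁺` enters `curvPair`. Its `Λ⁺`-`Λ⁺` block acts on `S₊`; it
is symmetric, with trace-free part `W⁺` and trace a multiple of the scalar curvature. Its `Λ⁺`-`Λ⁻`
block acts on `S₋` and is the trace-free Ricci tensor (`weylPlus_eq_zero_iff`, `einstein_iff`). The
scalar part acts on a symmetric tensor by factors `ε`, which the symmetrisation kills
(`sum_slotAct_eq_zero`). So `W⁺ = 0` removes the action on unprimed indices, and the Einstein
condition removes the action on primed ones.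

Conversely, bump functions give sections with value `ξ^k η^n` at a given point. Contracting
`curvPair` with `κ^(k+2) κ'^n` and varying the spinors separates the two blocks
(`blocks_of_contractPair`). The first vanishes as a quadratic form on the null cone of `ℂ³`, so it
is a multiple of the identity. The second vanishes on all pairs of null vectors, which span, so it
is zero. All the assertions are instances of `commutesOn_iff_curvature`. -/

lemma mvfderiv_congr {F : Type*} [NormedAddCommGroup F] [NormedSpace ℝ F] {f g : M → F} {x : M}
    (h : f =ᶠ[nhds x] g) : mvfderiv (𝓡 4) f x = mvfderiv (𝓡 4) g x := by
  simp only [mvfderiv]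
  rw [h.mfderiv_eq, h.eq_of_nhds]

variable [IsManifold (𝓡 4) ∞ M]

lemma isManifold_two : IsManifold (𝓡 4) 2 M := .of_le (n := ∞) (by norm_cast)

/-- Differentiability of a vector field at a point. -/
abbrev FieldDiffAt (X : Π x : M, TangentSpace (𝓡 4) x) (x : M) : Prop :=
  MDifferentiableAt (𝓡 4) ((𝓡 4).prod 𝓘(ℝ, E4)) (fun y => Bundle.TotalSpace.mk' E4 y (X y)) x

lemma fieldDiffAt_extend {x : M} (v : TangentSpace (𝓡 4) x) :
    FieldDiffAt (FiberBundle.extend E4 v) x :=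
  FiberBundle.mdifferentiableAt_extend (𝓡 4) E4 v

variable [Bundle.RiemannianBundle (fun x : M => TangentSpace (𝓡 4) x)]

/-- Antisymmetrising the Koszul expression in `X, Y` cancels every derivative term formally, so
torsion-freeness needs no regularity of the fields. -/
lemma leviCivita_sub_leviCivita (X Y : Π x : M, TangentSpace (𝓡 4) x) (x : M) :
    leviCivita X Y x - leviCivita Y X x = mlieBracket (𝓡 4) X Y x := by
  rw [← (stdOrthonormalBasis ℝ (TangentSpace (𝓡 4) x)).sum_repr' (mlieBracket (𝓡 4) X Y x)]
  simp only [leviCivita, ← Finset.sum_sub_distrib, ← sub_smul]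
  refine Finset.sum_congr rfl fun c _ => ?_
  congr 1
  simp only [koszul, mlieBracket_swap_apply (V := Y) (W := X), inner_neg_left,
    FiberBundle.extend_apply_self, real_inner_comm (X _) (Y _)]
  rw [real_inner_comm (mlieBracket (𝓡 4) X Y x)]
  ring

lemma leviCivita_congr {X Y Y' : Π x : M, TangentSpace (𝓡 4) x} {x : M}
    (h : ∀ᶠ y in nhds x, Y y = Y' y) :
    leviCivita X Y x = leviCivita X Y' x := by
  simp only [leviCivita]
  refine Finset.sum_congr rfl fun c _ => ?_
  congr 1
  have hx : Y x = Y' x := h.self_of_nhds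
  have h' : Y =ᶠ[nhds x] Y' := h
  simp only [koszul]
  set Z := FiberBundle.extend E4 (stdOrthonormalBasis ℝ (TangentSpace (𝓡 4) x) c)
  rw [Filter.EventuallyEq.mlieBracket_vectorField_eq (Filter.EventuallyEq.refl _ X) h',
    Filter.EventuallyEq.mlieBracket_vectorField_eq h' (Filter.EventuallyEq.refl _ Z), hx,
    mvfderiv_congr (f := fun y => inner ℝ (Y y) (Z y)) (g := fun y => inner ℝ (Y' y) (Z y))
      (h.mono fun y hy => by simp only [hy]),
    mvfderiv_congr (f := fun y => inner ℝ (X y) (Y y)) (g := fun y => inner ℝ (X y) (Y' y))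
      (h.mono fun y hy => by simp only [hy])]

variable [IsContMDiffRiemannianBundle (𝓡 4) ∞ E4 (fun x : M => TangentSpace (𝓡 4) x)]

variable {X Y Z : Π x : M, TangentSpace (𝓡 4) x} {x : M}

lemma mdifferentiableAt_inner (hX : FieldDiffAt X x) (hY : FieldDiffAt Y x) :
    MDifferentiableAt (𝓡 4) 𝓘(ℝ, ℝ) (fun y => inner ℝ (X y) (Y y)) x := by
  have : IsContMDiffRiemannianBundle (𝓡 4) 1 E4 (fun x : M => TangentSpace (𝓡 4) x) :=
    .of_le (n := ∞) (by norm_cast)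
  exact MDifferentiableAt.inner_bundle (F := E4) (IB := 𝓡 4)
    (E := fun x : M => TangentSpace (𝓡 4) x) hX hY

lemma mvfderiv_inner_smul_left {f : M → ℝ} (hf : MDifferentiableAt (𝓡 4) 𝓘(ℝ, ℝ) f x)
    (hX : FieldDiffAt X x) (hY : FieldDiffAt Y x) (v : TangentSpace (𝓡 4) x) :
    mvfderiv (𝓡 4) (fun y => inner ℝ ((f • X) y) (Y y)) x v =
      f x * mvfderiv (𝓡 4) (fun y => inner ℝ (X y) (Y y)) x v
        + inner ℝ (X x) (Y x) * mvfderiv (𝓡 4) f x v := by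
  have : (fun y => inner ℝ ((f • X) y) (Y y)) = f * fun y => inner ℝ (X y) (Y y) := by
    ext y; simp [real_inner_smul_left]
  rw [this, mvfderiv_mul hf (mdifferentiableAt_inner hX hY)]
  simp

lemma mvfderiv_inner_smul_right {f : M → ℝ} (hf : MDifferentiableAt (𝓡 4) 𝓘(ℝ, ℝ) f x)
    (hX : FieldDiffAt X x) (hY : FieldDiffAt Y x) (v : TangentSpace (𝓡 4) x) :
    mvfderiv (𝓡 4) (fun y => inner ℝ (X y) ((f • Y) y)) x v =
      f x * mvfderiv (𝓡 4) (fun y => inner ℝ (X y) (Y y)) x v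
        + inner ℝ (X x) (Y x) * mvfderiv (𝓡 4) f x v := by
  simp only [real_inner_comm _ (X _)]
  exact mvfderiv_inner_smul_left hf hY hX v

lemma mvfderiv_inner_add_left {X' : Π x : M, TangentSpace (𝓡 4) x}
    (hX : FieldDiffAt X x) (hX' : FieldDiffAt X' x) (hY : FieldDiffAt Y x)
    (v : TangentSpace (𝓡 4) x) :
    mvfderiv (𝓡 4) (fun y => inner ℝ ((X + X') y) (Y y)) x v =
      mvfderiv (𝓡 4) (fun y => inner ℝ (X y) (Y y)) x v
        + mvfderiv (𝓡 4) (fun y => inner ℝ (X' y) (Y y)) x v := by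
  have : (fun y => inner ℝ ((X + X') y) (Y y)) =
      (fun y => inner ℝ (X y) (Y y)) + fun y => inner ℝ (X' y) (Y y) := by
    ext y; simp [inner_add_left]
  rw [this, mvfderiv_add (mdifferentiableAt_inner hX hY) (mdifferentiableAt_inner hX' hY)]
  simp

lemma mvfderiv_inner_add_right {Y' : Π x : M, TangentSpace (𝓡 4) x}
    (hX : FieldDiffAt X x) (hY : FieldDiffAt Y x) (hY' : FieldDiffAt Y' x)
    (v : TangentSpace (𝓡 4) x) :
    mvfderiv (𝓡 4) (fun y => inner ℝ (X y) ((Y + Y') y)) x v =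
      mvfderiv (𝓡 4) (fun y => inner ℝ (X y) (Y y)) x v
        + mvfderiv (𝓡 4) (fun y => inner ℝ (X y) (Y' y)) x v := by
  simp only [real_inner_comm _ (X _)]
  exact mvfderiv_inner_add_left hY hY' hX v

/-- The derivatives of `f` produced by the inner products cancel against those produced by the
brackets. This makes the extension chosen in `leviCivita` immaterial. -/
lemma tensorialAt_koszul_last (hX : FieldDiffAt X x) (hY : FieldDiffAt Y x) :
    TensorialAt (𝓡 4) E4 (fun Z => koszul X Y Z x) x := by
  have := isManifold_two (M := M)
  constructor
  · intro f Z hf hZ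
    simp only [koszul, mvfderiv_inner_smul_right hf hX hZ, mvfderiv_inner_smul_right hf hY hZ,
      mlieBracket_smul_right hf hZ]
    simp only [Pi.smul_apply', map_smul, real_inner_smul_left, real_inner_smul_right,
      inner_add_left, real_inner_comm (X x) (Z x), real_inner_comm (Y x) (Z x), smul_eq_mul]
    ring
  · intro Z Z' hZ hZ'
    simp only [koszul, mvfderiv_inner_add_right hX hZ hZ', mvfderiv_inner_add_right hY hZ hZ',
      mlieBracket_add_right hZ hZ']
    simp only [Pi.add_apply, map_add, inner_add_left, inner_add_right]
    ring

lemma tensorialAt_koszul_first (hY : FieldDiffAt Y x) (hZ : FieldDiffAt Z x) :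
    TensorialAt (𝓡 4) E4 (fun X => koszul X Y Z x) x := by
  have := isManifold_two (M := M)
  constructor
  · intro f X hf hX
    simp only [koszul, mvfderiv_inner_smul_left hf hX hZ, mvfderiv_inner_smul_left hf hX hY,
      mlieBracket_smul_left hf hX]
    simp only [Pi.smul_apply', map_smul, real_inner_smul_left, real_inner_smul_right,
      inner_add_left, smul_eq_mul]
    rw [real_inner_comm (Y x) (X x)]
    ring
  · intro X X' hX hX'
    simp only [koszul, mvfderiv_inner_add_left hX hX' hZ, mvfderiv_inner_add_left hX hX' hY,
      mlieBracket_add_left hX hX']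
    simp only [Pi.add_apply, map_add, inner_add_left, inner_add_right]
    ring

lemma koszul_smul_middle {f : M → ℝ} (hf : MDifferentiableAt (𝓡 4) 𝓘(ℝ, ℝ) f x) (hX : FieldDiffAt X x)
    (hY : FieldDiffAt Y x) (hZ : FieldDiffAt Z x) :
    koszul X (f • Y) Z x =
      f x * koszul X Y Z x + mvfderiv (𝓡 4) f x (X x) * inner ℝ (Y x) (Z x) := by
  have := isManifold_two (M := M)
  simp only [koszul, mvfderiv_inner_smul_left hf hY hZ, mvfderiv_inner_smul_right hf hX hY,
      mlieBracket_smul_left hf hY, mlieBracket_smul_right hf hY]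
  simp only [Pi.smul_apply', map_smul, real_inner_smul_left, real_inner_smul_right,
      inner_add_left, smul_eq_mul]
  rw [real_inner_comm (X x) (Y x)]
  ring

lemma koszul_add_middle {Y' : Π x : M, TangentSpace (𝓡 4) x} (hX : FieldDiffAt X x)
    (hY : FieldDiffAt Y x) (hY' : FieldDiffAt Y' x) (hZ : FieldDiffAt Z x) :
    koszul X (Y + Y') Z x = koszul X Y Z x + koszul X Y' Z x := by
  have := isManifold_two (M := M)
  simp only [koszul, mvfderiv_inner_add_left hY hY' hZ, mvfderiv_inner_add_right hX hY hY',
      mlieBracket_add_left hY hY', mlieBracket_add_right hY hY']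
  simp only [Pi.add_apply, map_add, inner_add_left, inner_add_right]
  ring

/-- The Koszul formula for an arbitrary differentiable `Z`: by tensoriality, `Z` may be replaced by
the combination of extended basis vectors with the same value at `x`. -/
lemma inner_leviCivita (hX : FieldDiffAt X x) (hY : FieldDiffAt Y x) (hZ : FieldDiffAt Z x) :
    inner ℝ (leviCivita X Y x) (Z x) = koszul X Y Z x := by
  have h := tensorialAt_koszul_last hX hY
  rw [← h.mkHom_apply hZ]
  conv_rhs => rw [← (stdOrthonormalBasis ℝ (TangentSpace (𝓡 4) x)).sum_repr' (Z x), map_sum]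
  simp only [leviCivita, sum_inner, map_smul, real_inner_smul_left, smul_eq_mul,
    TensorialAt.mkHom_apply_eq_extend]
  exact Finset.sum_congr rfl fun c _ => mul_comm _ _

lemma leviCivita_smul {f : M → ℝ} (hf : MDifferentiableAt (𝓡 4) 𝓘(ℝ, ℝ) f x) (hX : FieldDiffAt X x)
    (hY : FieldDiffAt Y x) :
    leviCivita X (f • Y) x = f x • leviCivita X Y x + mvfderiv (𝓡 4) f x (X x) • Y x := by
  conv_rhs => rw [← (stdOrthonormalBasis ℝ (TangentSpace (𝓡 4) x)).sum_repr' (Y x)]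
  simp only [leviCivita, Finset.smul_sum, smul_smul, ← Finset.sum_add_distrib, ← add_smul]
  refine Finset.sum_congr rfl fun c _ => ?_
  rw [koszul_smul_middle hf hX hY (fieldDiffAt_extend _),
    FiberBundle.extend_apply_self, real_inner_comm]

lemma leviCivita_add {Y' : Π x : M, TangentSpace (𝓡 4) x} (hX : FieldDiffAt X x)
    (hY : FieldDiffAt Y x) (hY' : FieldDiffAt Y' x) :
    leviCivita X (Y + Y') x = leviCivita X Y x + leviCivita X Y' x := by
  simp only [leviCivita, ← Finset.sum_add_distrib, ← add_smul]
  refine Finset.sum_congr rfl fun c _ => ?_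
  rw [koszul_add_middle hX hY hY' (fieldDiffAt_extend _)]

lemma tensorialAt_leviCivita (hY : FieldDiffAt Y x) :
    TensorialAt (𝓡 4) E4 (fun X => leviCivita X Y x) x := by
  constructor
  · intro f X hf hX
    simp only [leviCivita, Finset.smul_sum, smul_smul]
    refine Finset.sum_congr rfl fun c _ => ?_
    rw [(tensorialAt_koszul_first hY (fieldDiffAt_extend _)).smul hf hX, smul_eq_mul]
  · intro X X' hX hX'
    simp only [leviCivita, ← Finset.sum_add_distrib, ← add_smul]
    refine Finset.sum_congr rfl fun c _ => ?_
    rw [(tensorialAt_koszul_first hY (fieldDiffAt_extend _)).add hX hX']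

lemma leviCivita_sum {ι : Type*} [Fintype ι] (V : ι → Π x : M, TangentSpace (𝓡 4) x)
    (hX : FieldDiffAt X x) (hV : ∀ j, FieldDiffAt (V j) x) :
    leviCivita X (fun y => ∑ j, V j y) x = ∑ j, leviCivita X (V j) x := by
  classical
  have key : ∀ s : Finset ι, leviCivita X (fun y => ∑ j ∈ s, V j y) x
      = ∑ j ∈ s, leviCivita X (V j) x := by
    intro s
    induction s using Finset.induction_on with
    | empty =>
      -- The derivative of the zero field vanishes by additivity applied to `0 + 0`.
      have h0 : FieldDiffAt (0 : Π x : M, TangentSpace (𝓡 4) x) x :=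
        Bundle.mdifferentiable_zeroSection ℝ (fun x : M => TangentSpace (𝓡 4) x) x
      have := leviCivita_add hX h0 h0
      rw [add_zero] at this
      simpa using! left_eq_add.mp this
    | insert a s ha h =>
      simp only [Finset.sum_insert ha, ← h]
      exact leviCivita_add hX (hV a) (.sum_section fun j _ => hV j)
  exact key Finset.univ

end LeviCivitaProperties

/-! ### Orthonormal frames: connection coefficients and the symmetries of the Riemann tensor. -/

section Frames

open VectorField

variable {M : Type*} [TopologicalSpace M] [ChartedSpace E4 M] [IsManifold (𝓡 4) ∞ M]

/-- Smoothness of a vector field at a point. -/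
abbrev FieldSmoothAt (X : Π x : M, TangentSpace (𝓡 4) x) (x : M) : Prop :=
  ContMDiffAt (𝓡 4) ((𝓡 4).prod 𝓘(ℝ, E4)) ∞ (fun y => Bundle.TotalSpace.mk' E4 y (X y)) x

variable {X Y Z : Π x : M, TangentSpace (𝓡 4) x} {x : M}

lemma FieldSmoothAt.fieldDiffAt (h : FieldSmoothAt X x) : FieldDiffAt X x :=
  ContMDiffAt.mdifferentiableAt h (by simp)

lemma FieldSmoothAt.mlieBracket (hX : FieldSmoothAt X x) (hY : FieldSmoothAt Y x) :
    FieldSmoothAt (mlieBracket (𝓡 4) X Y) x := by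
  have : IsManifold (𝓡 4) (((⊤ : ℕ∞) : WithTop ℕ∞) + 1) M := by
    simpa using! (inferInstance : IsManifold (𝓡 4) ∞ M)
  have : IsManifold (𝓡 4) (minSmoothness ℝ 2) M := by simpa using! isManifold_two (M := M)
  exact ContMDiffAt.mlieBracket_vectorField (m := ⊤) (n := ⊤) hX hY (by simp)

lemma FieldSmoothAt.smul {f : M → ℝ} (hf : ContMDiffAt (𝓡 4) 𝓘(ℝ, ℝ) ∞ f x)
    (hX : FieldSmoothAt X x) : FieldSmoothAt (f • X) x :=
  ContMDiffAt.smul_section hf hX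

lemma FieldSmoothAt.sub (hX : FieldSmoothAt X x) (hY : FieldSmoothAt Y x) :
    FieldSmoothAt (X - Y) x :=
  ContMDiffAt.sub_section hX hY

lemma jacobi_mlieBracket (hX : FieldSmoothAt X x) (hY : FieldSmoothAt Y x)
    (hZ : FieldSmoothAt Z x) :
    mlieBracket (𝓡 4) X (mlieBracket (𝓡 4) Y Z) x =
      mlieBracket (𝓡 4) (mlieBracket (𝓡 4) X Y) Z x
        + mlieBracket (𝓡 4) Y (mlieBracket (𝓡 4) X Z) x := by
  have : IsManifold (𝓡 4) (minSmoothness ℝ 3) M := by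
    simpa using! IsManifold.of_le (n := ∞) (m := 3) (by norm_cast)
  have h2 : minSmoothness ℝ 2 ≤ ∞ := by simpa using (by norm_cast : (2 : WithTop ℕ∞) ≤ ∞)
  exact leibniz_identity_mlieBracket_apply (hX.of_le h2) (hY.of_le h2) (hZ.of_le h2)

variable [Bundle.RiemannianBundle (fun x : M => TangentSpace (𝓡 4) x)]

/-- `e` is a smooth orthonormal frame on the open set `U`. -/
structure IsOrthonormalFrame (U : Set M) (e : Fin 4 → Π x : M, TangentSpace (𝓡 4) x) : Prop where
  isOpen : IsOpen U
  smooth : ∀ a, ∀ x ∈ U, FieldSmoothAt (e a) x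
  orthonormal : ∀ x ∈ U, ∀ a b, inner ℝ (e a x) (e b x) = kdelta a b

/-- The connection coefficients `⟨∇_{e_c} e_b, e_a⟩` of a frame. -/
def christoffel (e : Fin 4 → Π x : M, TangentSpace (𝓡 4) x) (c a b : Fin 4) (x : M) : ℝ :=
  inner ℝ (leviCivita (e c) (e b) x) (e a x)

namespace IsOrthonormalFrame

variable {U : Set M} {e : Fin 4 → Π x : M, TangentSpace (𝓡 4) x}

lemma sum_inner_smul (he : IsOrthonormalFrame U e) (hx : x ∈ U) (v : TangentSpace (𝓡 4) x) :
    ∑ a, inner ℝ v (e a x) • e a x = v := by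
  have ho : Orthonormal ℝ (fun a => e a x) := by
    rw [orthonormal_iff_ite]
    intro i j
    exact he.orthonormal x hx i j
  have hc : Fintype.card (Fin 4) = Module.finrank ℝ (TangentSpace (𝓡 4) x) := by
    have : Module.finrank ℝ (TangentSpace (𝓡 4) x) = Module.finrank ℝ E4 := rfl
    rw [this]; simp
  let b := (basisOfOrthonormalOfCardEqFinrank ho hc).toOrthonormalBasis (by simpa using ho)
  have hb : ∀ a, b a = e a x := by intro a; simp [b]
  conv_rhs => rw [← b.sum_repr' v]
  simp only [hb, real_inner_comm]

lemma leviCivita_eq_sum (he : IsOrthonormalFrame U e) (hx : x ∈ U) (b c : Fin 4) :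
    leviCivita (e b) (e c) x = ∑ d, christoffel e b d c x • e d x :=
  (he.sum_inner_smul hx _).symm

lemma inner_mlieBracket (a b c : Fin 4) (x : M) :
    inner ℝ (mlieBracket (𝓡 4) (e a) (e b) x) (e c x) =
      christoffel e a c b x - christoffel e b c a x := by
  rw [← leviCivita_sub_leviCivita, inner_sub_left]; rfl

lemma mlieBracket_eq_sum (he : IsOrthonormalFrame U e) (hx : x ∈ U) (a b : Fin 4) :
    mlieBracket (𝓡 4) (e a) (e b) x =
      ∑ c, (christoffel e a c b x - christoffel e b c a x) • e c x := by
  simp only [← inner_mlieBracket, he.sum_inner_smul hx]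

lemma mvfderiv_inner (he : IsOrthonormalFrame U e) (hx : x ∈ U) (a b : Fin 4) :
    mvfderiv (𝓡 4) (fun y => inner ℝ (e a y) (e b y)) x = 0 := by
  rw [mvfderiv_congr (g := fun _ => kdelta a b), mvfderiv_const]
  filter_upwards [he.isOpen.mem_nhds hx] with y hy using he.orthonormal y hy a b

/-- The Leibniz rule `[X, f e₀] - f [X, e₀] = (X f) e₀` expresses a directional derivative by Lie
brackets. Smoothness of derivatives and their commutation are then inherited from the bracket. -/
lemma mvfderiv_eq_inner (he : IsOrthonormalFrame U e) (hx : x ∈ U) {f : M → ℝ}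
    (hf : ContMDiffAt (𝓡 4) 𝓘(ℝ, ℝ) ∞ f x) :
    mvfderiv (𝓡 4) f x (X x) = inner ℝ ((mlieBracket (𝓡 4) X (f • e 0)
      - f • mlieBracket (𝓡 4) X (e 0)) x) (e 0 x) := by
  have := isManifold_two (M := M)
  rw [Pi.sub_apply, mlieBracket_smul_right (hf.mdifferentiableAt (by simp))
    (he.smooth 0 x hx).fieldDiffAt, Pi.smul_apply', add_sub_cancel_right, real_inner_smul_left,
    he.orthonormal x hx]
  simp [kdelta]

variable [IsContMDiffRiemannianBundle (𝓡 4) ∞ E4 (fun x : M => TangentSpace (𝓡 4) x)]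

lemma _root_.SpinFour.FieldSmoothAt.inner (hX : FieldSmoothAt X x) (hY : FieldSmoothAt Y x) :
    ContMDiffAt (𝓡 4) 𝓘(ℝ, ℝ) ∞ (fun y => inner ℝ (X y) (Y y)) x :=
  ContMDiffAt.inner_bundle (F := E4) (IB := 𝓡 4)
    (E := fun x : M => TangentSpace (𝓡 4) x) hX hY

/-- Inner products of frame vectors are constant, so only the bracket terms of the Koszul formula
survive. Skewness and smoothness of the coefficients can be read off. -/
lemma christoffel_eq (he : IsOrthonormalFrame U e) (hx : x ∈ U) (c a b : Fin 4) :
    christoffel e c a b x = (1 / 2) *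
      (inner ℝ (mlieBracket (𝓡 4) (e c) (e b) x) (e a x)
      - inner ℝ (mlieBracket (𝓡 4) (e c) (e a) x) (e b x)
      - inner ℝ (mlieBracket (𝓡 4) (e b) (e a) x) (e c x)) := by
  rw [christoffel, inner_leviCivita (he.smooth c x hx).fieldDiffAt (he.smooth b x hx).fieldDiffAt
    (he.smooth a x hx).fieldDiffAt]
  simp only [koszul, he.mvfderiv_inner hx]
  simp

lemma christoffel_skew (he : IsOrthonormalFrame U e) (hx : x ∈ U) (c a b : Fin 4) :
    christoffel e c a b x = -christoffel e c b a x := by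
  rw [he.christoffel_eq hx, he.christoffel_eq hx, mlieBracket_swap_apply (V := e b) (W := e a),
    inner_neg_left]
  ring

lemma contMDiffAt_christoffel (he : IsOrthonormalFrame U e) (hx : x ∈ U) (c a b : Fin 4) :
    ContMDiffAt (𝓡 4) 𝓘(ℝ, ℝ) ∞ (christoffel e c a b) x := by
  have h := fun i => he.smooth i x hx
  refine ContMDiffAt.congr_of_eventuallyEq (f := fun y => (1 / 2 : ℝ) *
      (inner ℝ (mlieBracket (𝓡 4) (e c) (e b) y) (e a y)
      - inner ℝ (mlieBracket (𝓡 4) (e c) (e a) y) (e b y)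
      - inner ℝ (mlieBracket (𝓡 4) (e b) (e a) y) (e c y))) ?_ ?_
  · exact contMDiffAt_const.mul (((((h c).mlieBracket (h b)).inner (h a)).sub
      (((h c).mlieBracket (h a)).inner (h b))).sub (((h b).mlieBracket (h a)).inner (h c)))
  · filter_upwards [he.isOpen.mem_nhds hx] with y hy using he.christoffel_eq hy c a b

lemma fieldSmoothAt_leviCivita (he : IsOrthonormalFrame U e) (hx : x ∈ U) (b c : Fin 4) :
    FieldSmoothAt (leviCivita (e b) (e c)) x := by
  have h : FieldSmoothAt (fun y => ∑ d, (christoffel e b d c • e d) y) x :=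
    ContMDiffAt.sum_section fun d _ =>
      FieldSmoothAt.smul (he.contMDiffAt_christoffel hx b d c) (he.smooth d x hx)
  refine ContMDiffAt.congr_of_eventuallyEq h ?_
  filter_upwards [he.isOpen.mem_nhds hx] with y hy
  rw [he.leviCivita_eq_sum hy]; rfl

lemma leviCivita_leviCivita (he : IsOrthonormalFrame U e) (hx : x ∈ U) (a b c : Fin 4) :
    leviCivita (e a) (leviCivita (e b) (e c)) x =
      ∑ d, (christoffel e b d c x • leviCivita (e a) (e d) x
        + mvfderiv (𝓡 4) (christoffel e b d c) x (e a x) • e d x) := by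
  have hs := fun i => (he.smooth i x hx).fieldDiffAt
  have hΓ : ∀ d, MDifferentiableAt (𝓡 4) 𝓘(ℝ, ℝ) (christoffel e b d c) x := fun d =>
    (he.contMDiffAt_christoffel hx b d c).mdifferentiableAt (by simp)
  rw [leviCivita_congr (Y' := fun y => ∑ d, (christoffel e b d c • e d) y),
    leviCivita_sum _ (hs a) fun d => ?_]
  · exact Finset.sum_congr rfl fun d _ => leviCivita_smul (hΓ d) (hs a) (hs d)
  · exact MDifferentiableAt.smul_section (hΓ d) (hs d)
  · filter_upwards [he.isOpen.mem_nhds hx] with y hy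
    rw [he.leviCivita_eq_sum hy]; rfl

lemma leviCivita_mlieBracket (he : IsOrthonormalFrame U e) (hx : x ∈ U) (a b c : Fin 4) :
    leviCivita (mlieBracket (𝓡 4) (e a) (e b)) (e c) x =
      ∑ f, (christoffel e a f b x - christoffel e b f a x) • leviCivita (e f) (e c) x := by
  have hs := fun i => he.smooth i x hx
  have ht := tensorialAt_leviCivita (hs c).fieldDiffAt
  rw [← ht.mkHom_apply ((hs a).mlieBracket (hs b)).fieldDiffAt, he.mlieBracket_eq_sum hx, map_sum]
  simp only [map_smul]
  exact Finset.sum_congr rfl fun f _ => by rw [ht.mkHom_apply (hs f).fieldDiffAt]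

/-- Cartan's second structure equation in components; the last product comes from `∇_[e_a, e_b]` and
torsion-freeness. -/
lemma riemann_eq (he : IsOrthonormalFrame U e) (hx : x ∈ U) (a b c d : Fin 4) :
    riemann e x a b c d =
      mvfderiv (𝓡 4) (christoffel e b d c) x (e a x)
      - mvfderiv (𝓡 4) (christoffel e a d c) x (e b x)
      + ∑ f, (christoffel e a d f x * christoffel e b f c x
        - christoffel e b d f x * christoffel e a f c x
        - (christoffel e a f b x - christoffel e b f a x) * christoffel e f d c x) := by
  rw [riemann, curvature, he.leviCivita_leviCivita hx, he.leviCivita_leviCivita hx,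
    he.leviCivita_mlieBracket hx]
  simp only [inner_sub_left, sum_inner, inner_add_left, real_inner_smul_left, he.orthonormal x hx,
    Finset.sum_sub_distrib, Finset.sum_add_distrib]
  simp only [kdelta, mul_ite, mul_one, mul_zero, Finset.sum_ite_eq', Finset.mem_univ, if_true]
  simp only [christoffel, mul_comm]
  ring

lemma riemann_skew_left (he : IsOrthonormalFrame U e) (hx : x ∈ U) (a b c d : Fin 4) :
    riemann e x a b c d = -riemann e x b a c d := by
  rw [he.riemann_eq hx, he.riemann_eq hx]
  simp only [Finset.sum_sub_distrib, sub_mul]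
  ring

lemma riemann_skew_right (he : IsOrthonormalFrame U e) (hx : x ∈ U) (a b c d : Fin 4) :
    riemann e x a b c d = -riemann e x a b d c := by
  have hD : ∀ a b, mvfderiv (𝓡 4) (christoffel e a c d) x (e b x)
      = -mvfderiv (𝓡 4) (christoffel e a d c) x (e b x) := by
    intro a b
    rw [mvfderiv_congr (g := -christoffel e a d c), mvfderiv_neg]
    · rfl
    · filter_upwards [he.isOpen.mem_nhds hx] with y hy using he.christoffel_skew hy a c d
  rw [he.riemann_eq hx, he.riemann_eq hx, hD, hD]
  simp only [Finset.sum_sub_distrib, sub_mul, he.christoffel_skew hx _ c]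
  have h1 : ∀ a b, ∑ f, -christoffel e a f c x * christoffel e b f d x
      = ∑ f, christoffel e b d f x * christoffel e a f c x := fun a b =>
    Finset.sum_congr rfl fun f _ => by rw [he.christoffel_skew hx b d f]; ring
  simp only [h1, mul_neg, Finset.sum_neg_distrib]
  ring

/-- Torsion-freeness, used twice, regroups the cyclic sum into double brackets (`key`), and the
Jacobi identity makes these cancel. -/
lemma bianchi (he : IsOrthonormalFrame U e) (hx : x ∈ U) (a b c d : Fin 4) :
    riemann e x a b c d + riemann e x b c a d + riemann e x c a b d = 0 := by
  have hs := fun i => he.smooth i x hx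
  have key : ∀ a b c, leviCivita (e a) (leviCivita (e b) (e c)) x
      - leviCivita (e a) (leviCivita (e c) (e b)) x
      - leviCivita (mlieBracket (𝓡 4) (e b) (e c)) (e a) x
      = mlieBracket (𝓡 4) (e a) (mlieBracket (𝓡 4) (e b) (e c)) x := by
    intro a b c
    have h : leviCivita (e b) (e c) = leviCivita (e c) (e b) + mlieBracket (𝓡 4) (e b) (e c) := by
      funext y
      rw [Pi.add_apply, ← leviCivita_sub_leviCivita]; abel
    rw [h, leviCivita_add (hs a).fieldDiffAt (he.fieldSmoothAt_leviCivita hx c b).fieldDiffAt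
      ((hs b).mlieBracket (hs c)).fieldDiffAt, ← leviCivita_sub_leviCivita (e a)]
    abel
  have hj := jacobi_mlieBracket (hs a) (hs b) (hs c)
  have h3 : mlieBracket (𝓡 4) (e b) (mlieBracket (𝓡 4) (e a) (e c)) x
      = - mlieBracket (𝓡 4) (e b) (mlieBracket (𝓡 4) (e c) (e a)) x := by
    rw [mlieBracket_swap (V := e a) (W := e c), ← neg_one_smul ℝ (mlieBracket (𝓡 4) (e c) (e a)),
      mlieBracket_const_smul_right ((hs c).mlieBracket (hs a)).fieldDiffAt, neg_one_smul]
  have : curvature (e a) (e b) (e c) x + curvature (e b) (e c) (e a) x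
      + curvature (e c) (e a) (e b) x = 0 := by
    calc _ = (leviCivita (e a) (leviCivita (e b) (e c)) x
          - leviCivita (e a) (leviCivita (e c) (e b)) x
          - leviCivita (mlieBracket (𝓡 4) (e b) (e c)) (e a) x)
        + (leviCivita (e b) (leviCivita (e c) (e a)) x
          - leviCivita (e b) (leviCivita (e a) (e c)) x
          - leviCivita (mlieBracket (𝓡 4) (e c) (e a)) (e b) x)
        + (leviCivita (e c) (leviCivita (e a) (e b)) x
          - leviCivita (e c) (leviCivita (e b) (e a)) x
          - leviCivita (mlieBracket (𝓡 4) (e a) (e b)) (e c) x) := by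
          simp only [curvature]; abel
      _ = 0 := by
          rw [key, key, key, hj, h3, mlieBracket_swap_apply (V := e c)]; abel
  simp only [riemann, ← inner_add_left, this, inner_zero_left]

lemma contMDiffAt_mvfderiv_real (he : IsOrthonormalFrame U e) (hx : x ∈ U) {f : M → ℝ}
    (hf : ContMDiffOn (𝓡 4) 𝓘(ℝ, ℝ) ∞ f U) (a : Fin 4) :
    ContMDiffAt (𝓡 4) 𝓘(ℝ, ℝ) ∞ (fun y => mvfderiv (𝓡 4) f y (e a y)) x := by
  have hs := fun i => he.smooth i x hx
  have hfx := hf.contMDiffAt (he.isOpen.mem_nhds hx)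
  refine ContMDiffAt.congr_of_eventuallyEq
    ((((hs a).mlieBracket (.smul hfx (hs 0))).sub (.smul hfx ((hs a).mlieBracket (hs 0)))).inner
      (hs 0)) ?_
  filter_upwards [he.isOpen.mem_nhds hx] with y hy
  exact he.mvfderiv_eq_inner hy (hf.contMDiffAt (he.isOpen.mem_nhds hy))

/-- Expand the Jacobi identity for `e_a, e_b, f e₀` and subtract `f` times the one for `e_a, e_b,
e₀`. The mixed terms cancel, and what remains is the asserted difference times the nonzero vector
`e₀`. -/
lemma mvfderiv_comm_real (he : IsOrthonormalFrame U e) (hx : x ∈ U) {f : M → ℝ}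
    (hf : ContMDiffOn (𝓡 4) 𝓘(ℝ, ℝ) ∞ f U) (a b : Fin 4) :
    mvfderiv (𝓡 4) (fun y => mvfderiv (𝓡 4) f y (e b y)) x (e a x)
      - mvfderiv (𝓡 4) (fun y => mvfderiv (𝓡 4) f y (e a y)) x (e b x)
      = mvfderiv (𝓡 4) f x (mlieBracket (𝓡 4) (e a) (e b) x) := by
  have := isManifold_two (M := M)
  have hs := fun i => he.smooth i x hx
  have hfx := hf.contMDiffAt (he.isOpen.mem_nhds hx)
  have hfd := hfx.mdifferentiableAt (by simp)
  have hw := hs 0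
  have exp2 : ∀ a b, mlieBracket (𝓡 4) (e a) (mlieBracket (𝓡 4) (e b) (f • e 0)) x =
      mvfderiv (𝓡 4) (fun y => mvfderiv (𝓡 4) f y (e b y)) x (e a x) • e 0 x
      + mvfderiv (𝓡 4) f x (e b x) • mlieBracket (𝓡 4) (e a) (e 0) x
      + (mvfderiv (𝓡 4) f x (e a x) • mlieBracket (𝓡 4) (e b) (e 0) x
      + f x • mlieBracket (𝓡 4) (e a) (mlieBracket (𝓡 4) (e b) (e 0)) x) := by
    intro a b
    have hD := (he.contMDiffAt_mvfderiv_real hx hf b).mdifferentiableAt (by simp)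
    have hb0 := ((hs b).mlieBracket hw).fieldDiffAt
    have hev : mlieBracket (𝓡 4) (e b) (f • e 0) =ᶠ[nhds x]
        ((fun y => mvfderiv (𝓡 4) f y (e b y)) • e 0) + f • mlieBracket (𝓡 4) (e b) (e 0) := by
      filter_upwards [he.isOpen.mem_nhds hx] with y hy
      exact mlieBracket_smul_right ((hf.contMDiffAt (he.isOpen.mem_nhds hy)).mdifferentiableAt
        (by simp)) (he.smooth 0 y hy).fieldDiffAt
    rw [Filter.EventuallyEq.mlieBracket_vectorField_eq (Filter.EventuallyEq.refl _ (e a)) hev,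
      mlieBracket_add_right (MDifferentiableAt.smul_section hD hw.fieldDiffAt)
        (MDifferentiableAt.smul_section hfd hb0),
      mlieBracket_smul_right hD hw.fieldDiffAt, mlieBracket_smul_right hfd hb0]
  have hj := jacobi_mlieBracket (hs a) (hs b) (.smul hfx hw)
  have hj0 := jacobi_mlieBracket (hs a) (hs b) hw
  rw [exp2, exp2, mlieBracket_smul_right hfd hw.fieldDiffAt, hj0] at hj
  have h : (mvfderiv (𝓡 4) (fun y => mvfderiv (𝓡 4) f y (e b y)) x (e a x)
      - mvfderiv (𝓡 4) (fun y => mvfderiv (𝓡 4) f y (e a y)) x (e b x)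
      - mvfderiv (𝓡 4) f x (mlieBracket (𝓡 4) (e a) (e b) x)) • e 0 x = 0 := by
    rw [← sub_eq_zero.2 hj]
    module
  rcases smul_eq_zero.1 h with h | h
  · linarith
  · have := he.orthonormal x hx 0 0
    simp [h, kdelta] at this

end IsOrthonormalFrame

end Frames

/-! ### Calculus of complex functions along a frame, reduced to real and imaginary parts. -/

section FrameDerivative

open VectorField

variable {M : Type*} [TopologicalSpace M] [ChartedSpace E4 M]

lemma mvfderiv_clm_comp {F F' : Type*} [NormedAddCommGroup F] [NormedSpace ℝ F]
    [NormedAddCommGroup F'] [NormedSpace ℝ F'] (L : F →L[ℝ] F') {f : M → F} {x : M}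
    (hf : MDifferentiableAt (𝓡 4) 𝓘(ℝ, F) f x) (v : TangentSpace (𝓡 4) x) :
    mvfderiv (𝓡 4) (fun y => L (f y)) x v = L (mvfderiv (𝓡 4) f x v) := by
  have h : HasMFDerivAt (𝓡 4) 𝓘(ℝ, F') (fun y => L (f y)) x (L.comp (mfderiv (𝓡 4) 𝓘(ℝ, F) f x)) :=
    HasMFDerivAt.comp x (L.hasMFDerivAt) hf.hasMFDerivAt
  simp only [mvfderiv]
  rw [h.mfderiv]
  rfl

/-- Smoothness of a complex function on a set. -/
abbrev SmoothC (U : Set M) (f : M → ℂ) : Prop := ContMDiffOn (𝓡 4) 𝓘(ℝ, ℂ) ∞ f U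

/-- The derivative of a complex function along the vector `e_a` of a frame. -/
def frameDeriv (e : Fin 4 → Π x : M, TangentSpace (𝓡 4) x) (a : Fin 4) (f : M → ℂ) (x : M) : ℂ :=
  mvfderiv (𝓡 4) f x (e a x)

variable {U : Set M} {e : Fin 4 → Π x : M, TangentSpace (𝓡 4) x} {x : M} {f g : M → ℂ}

namespace SmoothC

lemma const (c : ℂ) : SmoothC U (fun _ => c) := contMDiffOn_const

lemma add (hf : SmoothC U f) (hg : SmoothC U g) : SmoothC U (fun y => f y + g y) :=
  ContMDiffOn.add hf hg

lemma clm_comp {F : Type*} [NormedAddCommGroup F] [NormedSpace ℝ F] (L : ℂ →L[ℝ] F)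
    (hf : SmoothC U f) : ContMDiffOn (𝓡 4) 𝓘(ℝ, F) ∞ (fun y => L (f y)) U :=
  L.contMDiff.comp_contMDiffOn hf

lemma ofReal {f : M → ℝ} (hf : ContMDiffOn (𝓡 4) 𝓘(ℝ, ℝ) ∞ f U) :
    SmoothC U (fun y => (f y : ℂ)) :=
  Complex.ofRealCLM.contMDiff.comp_contMDiffOn hf

lemma mul (hf : SmoothC U f) (hg : SmoothC U g) : SmoothC U (fun y => f y * g y) :=
  (ContinuousLinearMap.mul ℝ ℂ).isBoundedBilinearMap.contDiff.contMDiff.comp_contMDiffOn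
    (hf.prodMk_space hg)

lemma sum {ι : Type*} {s : Finset ι} {F : ι → M → ℂ} (hF : ∀ i ∈ s, SmoothC U (F i)) :
    SmoothC U (fun y => ∑ i ∈ s, F i y) := by
  classical
  induction s using Finset.induction_on with
  | empty => simpa using const 0
  | insert a s ha h =>
    simp only [Finset.sum_insert ha]
    exact (hF a (by simp)).add (h fun i hi => hF i (by simp [hi]))

lemma prod {ι : Type*} {s : Finset ι} {F : ι → M → ℂ} (hF : ∀ i ∈ s, SmoothC U (F i)) :
    SmoothC U (fun y => ∏ i ∈ s, F i y) := by
  classical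
  induction s using Finset.induction_on with
  | empty => simpa using const 1
  | insert a s ha h =>
    simp only [Finset.prod_insert ha]
    exact (hF a (by simp)).mul (h fun i hi => hF i (by simp [hi]))

lemma mdifferentiableAt (hf : SmoothC U f) (hU : IsOpen U) (hx : x ∈ U) :
    MDifferentiableAt (𝓡 4) 𝓘(ℝ, ℂ) f x :=
  (hf.contMDiffAt (hU.mem_nhds hx)).mdifferentiableAt (by simp)

end SmoothC

lemma frameDeriv_const (a : Fin 4) (c : ℂ) : frameDeriv e a (fun _ => c) x = 0 := by
  rw [frameDeriv, mvfderiv_const]; rfl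

lemma frameDeriv_add (hU : IsOpen U) (hx : x ∈ U) (a : Fin 4) (hf : SmoothC U f)
    (hg : SmoothC U g) :
    frameDeriv e a (fun y => f y + g y) x = frameDeriv e a f x + frameDeriv e a g x := by
  have := mvfderiv_add (hf.mdifferentiableAt hU hx) (hg.mdifferentiableAt hU hx)
  exact congr($this (e a x))

lemma frameDeriv_mul (hU : IsOpen U) (hx : x ∈ U) (a : Fin 4) (hf : SmoothC U f)
    (hg : SmoothC U g) :
    frameDeriv e a (fun y => f y * g y) x = frameDeriv e a f x * g x + f x * frameDeriv e a g x := by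
  have h := (hf.mdifferentiableAt hU hx).hasMFDerivAt.mul (hg.mdifferentiableAt hU hx).hasMFDerivAt
  have h2 := congr($(h.mfderiv) (e a x))
  simp only [frameDeriv, mvfderiv]
  refine Eq.trans h2 ?_
  change f x * frameDeriv e a g x + g x * frameDeriv e a f x = _
  rw [add_comm, mul_comm (g x)]
  rfl

lemma frameDeriv_const_mul (hU : IsOpen U) (hx : x ∈ U) (a : Fin 4) (hf : SmoothC U f) (c : ℂ) :
    frameDeriv e a (fun y => c * f y) x = c * frameDeriv e a f x := by
  rw [frameDeriv_mul hU hx a (.const c) hf, frameDeriv_const]; ring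

lemma frameDeriv_sum (hU : IsOpen U) (hx : x ∈ U) (a : Fin 4) {ι : Type*} {s : Finset ι}
    {F : ι → M → ℂ} (hF : ∀ i ∈ s, SmoothC U (F i)) :
    frameDeriv e a (fun y => ∑ i ∈ s, F i y) x = ∑ i ∈ s, frameDeriv e a (F i) x := by
  classical
  induction s using Finset.induction_on with
  | empty => simpa using frameDeriv_const a 0
  | insert b s hb h =>
    simp only [Finset.sum_insert hb]
    rw [frameDeriv_add hU hx a (hF b (by simp)) (.sum fun i hi => hF i (by simp [hi])),
      h fun i hi => hF i (by simp [hi])]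

lemma frameDeriv_ofReal {f : M → ℝ} (hU : IsOpen U) (hx : x ∈ U) (a : Fin 4)
    (hf : ContMDiffOn (𝓡 4) 𝓘(ℝ, ℝ) ∞ f U) :
    frameDeriv e a (fun y => (f y : ℂ)) x = (mvfderiv (𝓡 4) f x (e a x) : ℝ) :=
  mvfderiv_clm_comp Complex.ofRealCLM
    ((hf.contMDiffAt (hU.mem_nhds hx)).mdifferentiableAt (by simp)) _

lemma frameDeriv_re (hU : IsOpen U) (hx : x ∈ U) (a : Fin 4) (hf : SmoothC U f) :
    (frameDeriv e a f x).re = mvfderiv (𝓡 4) (fun y => (f y).re) x (e a x) :=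
  (mvfderiv_clm_comp Complex.reCLM (hf.mdifferentiableAt hU hx) _).symm

lemma frameDeriv_im (hU : IsOpen U) (hx : x ∈ U) (a : Fin 4) (hf : SmoothC U f) :
    (frameDeriv e a f x).im = mvfderiv (𝓡 4) (fun y => (f y).im) x (e a x) :=
  (mvfderiv_clm_comp Complex.imCLM (hf.mdifferentiableAt hU hx) _).symm

variable [IsManifold (𝓡 4) ∞ M] [Bundle.RiemannianBundle (fun x : M => TangentSpace (𝓡 4) x)]
  [IsContMDiffRiemannianBundle (𝓡 4) ∞ E4 (fun x : M => TangentSpace (𝓡 4) x)]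

lemma SmoothC.frameDeriv (he : IsOrthonormalFrame U e) (hf : SmoothC U f) (a : Fin 4) :
    SmoothC U (frameDeriv e a f) := by
  have hre := fun y hy => he.contMDiffAt_mvfderiv_real (x := y) hy (hf.clm_comp Complex.reCLM) a
  have him := fun y hy => he.contMDiffAt_mvfderiv_real (x := y) hy (hf.clm_comp Complex.imCLM) a
  have h := (ofReal fun y hy => (hre y hy).contMDiffWithinAt).add
    ((ofReal (U := U) fun y hy => (him y hy).contMDiffWithinAt).mul (.const Complex.I))
  refine ContMDiffOn.congr h fun y hy => ?_
  rw [← Complex.re_add_im (SpinFour.frameDeriv e a f y), frameDeriv_re he.isOpen hy a hf,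
    frameDeriv_im he.isOpen hy a hf]
  rfl

lemma frameDeriv_comm (he : IsOrthonormalFrame U e) (hx : x ∈ U) (hf : SmoothC U f) (a b : Fin 4) :
    frameDeriv e a (frameDeriv e b f) x - frameDeriv e b (frameDeriv e a f) x =
      ∑ c, ((christoffel e a c b x : ℂ) - christoffel e b c a x) * frameDeriv e c f x := by
  have key : ∀ L : ℂ →L[ℝ] ℝ, L (frameDeriv e a (frameDeriv e b f) x)
      - L (frameDeriv e b (frameDeriv e a f) x) =
      ∑ c, (christoffel e a c b x - christoffel e b c a x) * L (frameDeriv e c f x) := by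
    intro L
    have h1 : ∀ y ∈ U, ∀ c, L (frameDeriv e c f y) = mvfderiv (𝓡 4) (fun y => L (f y)) y (e c y) :=
      fun y hy c => (mvfderiv_clm_comp L (hf.mdifferentiableAt he.isOpen hy) _).symm
    have h2 : ∀ a b, L (frameDeriv e a (frameDeriv e b f) x) =
        mvfderiv (𝓡 4) (fun y => mvfderiv (𝓡 4) (fun y => L (f y)) y (e b y)) x (e a x) := by
      intro a b
      rw [frameDeriv, ← mvfderiv_clm_comp L ((hf.frameDeriv he b).mdifferentiableAt he.isOpen hx)]
      rw [mvfderiv_congr]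
      filter_upwards [he.isOpen.mem_nhds hx] with y hy using h1 y hy b
    rw [h2, h2, he.mvfderiv_comm_real hx (hf.clm_comp L), he.mlieBracket_eq_sum hx, map_sum]
    simp only [map_smul, smul_eq_mul, h1 x hx]
  apply Complex.ext
  · simpa using key Complex.reCLM
  · simpa using key Complex.imCLM

lemma IsOrthonormalFrame.smoothC_christoffel (he : IsOrthonormalFrame U e) (c a b : Fin 4) :
    SmoothC U (fun y => (christoffel e c a b y : ℂ)) :=
  .ofReal fun _ hy => (he.contMDiffAt_christoffel hy c a b).contMDiffWithinAt

end FrameDerivative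

/-! ### The splitting of `𝔰𝔬(4)` into two copies of `𝔰𝔲(2)`, and the soldering form. -/

section SpinRepresentation

/-- The image in the first factor of `𝔰𝔲(2) ⊕ 𝔰𝔲(2) = 𝔰𝔬(4)`. -/
def spinPlus (Ω : Fin 4 → Fin 4 → ℝ) : Matrix (Fin 2) (Fin 2) ℂ :=
  (1 / 4 : ℂ) • ∑ a, ∑ b, (Ω a b : ℂ) • (quat a * (quat b).conjTranspose)

/-- The image in the second factor of `𝔰𝔲(2) ⊕ 𝔰𝔲(2) = 𝔰𝔬(4)`. -/
def spinMinus (Ω : Fin 4 → Fin 4 → ℝ) : Matrix (Fin 2) (Fin 2) ℂ :=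
  (1 / 4 : ℂ) • ∑ a, ∑ b, (Ω a b : ℂ) • ((quat a).conjTranspose * quat b)

/-- The coordinates of a skew matrix in the first factor of `𝔰𝔬(4)`. -/
def sdPart (Ω : Fin 4 → Fin 4 → ℝ) : Fin 3 → ℝ :=
  ![Ω 1 0 + Ω 3 2, Ω 2 0 + Ω 1 3, Ω 3 0 + Ω 2 1]

/-- The coordinates of a skew matrix in the second factor of `𝔰𝔬(4)`. -/
def asdPart (Ω : Fin 4 → Fin 4 → ℝ) : Fin 3 → ℝ :=
  ![-Ω 1 0 + Ω 3 2, -Ω 2 0 + Ω 1 3, -Ω 3 0 + Ω 2 1]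

/-- The imaginary quaternion with the given coordinates. -/
def imQuat (u : Fin 3 → ℝ) : Matrix (Fin 2) (Fin 2) ℂ :=
  !![u 0 * Complex.I, u 1 + u 2 * Complex.I; -u 1 + u 2 * Complex.I, -(u 0 * Complex.I)]

/-- A skew-symmetric `4 × 4` matrix. -/
def IsSkew (Ω : Fin 4 → Fin 4 → ℝ) : Prop := ∀ a b, Ω a b = -Ω b a

variable {Ω Ω' : Fin 4 → Fin 4 → ℝ}

lemma IsSkew.eq_rules (h : IsSkew Ω) :
    (Ω 0 0 = 0 ∧ Ω 1 1 = 0 ∧ Ω 2 2 = 0 ∧ Ω 3 3 = 0) ∧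
    (Ω 1 0 = -Ω 0 1 ∧ Ω 2 0 = -Ω 0 2 ∧ Ω 3 0 = -Ω 0 3) ∧
    (Ω 2 1 = -Ω 1 2 ∧ Ω 3 1 = -Ω 1 3 ∧ Ω 3 2 = -Ω 2 3) :=
  ⟨⟨by linarith [h 0 0], by linarith [h 1 1], by linarith [h 2 2], by linarith [h 3 3]⟩,
    ⟨h _ _, h _ _, h _ _⟩, ⟨h _ _, h _ _, h _ _⟩⟩

lemma spinPlus_apply (A B : Fin 2) : spinPlus Ω A B =
    ∑ a, ∑ b, ((1 / 4 : ℂ) * (quat a * (quat b).conjTranspose) A B) * (Ω a b : ℂ) := by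
  simp only [spinPlus, Matrix.smul_apply, Matrix.sum_apply, smul_eq_mul, Finset.mul_sum]
  exact Finset.sum_congr rfl fun a _ => Finset.sum_congr rfl fun b _ => by ring

lemma spinMinus_apply (A B : Fin 2) : spinMinus Ω A B =
    ∑ a, ∑ b, ((1 / 4 : ℂ) * ((quat a).conjTranspose * quat b) A B) * (Ω a b : ℂ) := by
  simp only [spinMinus, Matrix.smul_apply, Matrix.sum_apply, smul_eq_mul, Finset.mul_sum]
  exact Finset.sum_congr rfl fun a _ => Finset.sum_congr rfl fun b _ => by ring

lemma spinPlus_eq (h : IsSkew Ω) : spinPlus Ω = (1 / 2 : ℂ) • imQuat (sdPart Ω) := by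
  obtain ⟨⟨h0, h1, h2, h3⟩, ⟨h10, h20, h30⟩, ⟨h21, h31, h32⟩⟩ := h.eq_rules
  ext A B
  rw [spinPlus_apply]
  simp only [Fin.sum_univ_four, Matrix.mul_apply, Matrix.conjTranspose_apply, Fin.sum_univ_two,
    h0, h1, h2, h3, h10, h20, h30, h21, h31, h32, Matrix.smul_apply]
  fin_cases A <;> fin_cases B <;>
    simp [imQuat, sdPart, quat, h10, h20, h30, h21, h32] <;> ring

lemma spinMinus_eq (h : IsSkew Ω) : spinMinus Ω = (1 / 2 : ℂ) • imQuat (asdPart Ω) := by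
  obtain ⟨⟨h0, h1, h2, h3⟩, ⟨h10, h20, h30⟩, ⟨h21, h31, h32⟩⟩ := h.eq_rules
  ext A B
  rw [spinMinus_apply]
  simp only [Fin.sum_univ_four, Matrix.mul_apply, Matrix.conjTranspose_apply, Fin.sum_univ_two,
    h0, h1, h2, h3, h10, h20, h30, h21, h31, h32, Matrix.smul_apply]
  fin_cases A <;> fin_cases B <;>
    simp [imQuat, asdPart, quat, h10, h20, h30, h21, h32] <;> ring

/-- The commutator of two matrices. -/
def lieMul (Ω Ω' : Fin 4 → Fin 4 → ℝ) (a b : Fin 4) : ℝ :=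
  ∑ f, (Ω a f * Ω' f b - Ω' a f * Ω f b)

lemma IsSkew.lieMul (h : IsSkew Ω) (h' : IsSkew Ω') : IsSkew (lieMul Ω Ω') := by
  intro a b
  simp only [SpinFour.lieMul, ← Finset.sum_neg_distrib]
  refine Finset.sum_congr rfl fun f _ => ?_
  rw [h a f, h' f b, h' a f, h f b]; ring

/-- A Lie algebra homomorphism: this carries the quadratic part of the Riemann tensor to the
quadratic part of the spin curvature. -/
lemma spinPlus_lieMul (h : IsSkew Ω) (h' : IsSkew Ω') :
    spinPlus (lieMul Ω Ω') = spinPlus Ω * spinPlus Ω' - spinPlus Ω' * spinPlus Ω := by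
  rw [spinPlus_eq h, spinPlus_eq h', spinPlus_eq (h.lieMul h')]
  obtain ⟨⟨h0, h1, h2, h3⟩, ⟨h10, h20, h30⟩, ⟨h21, h31, h32⟩⟩ := h.eq_rules
  obtain ⟨⟨k0, k1, k2, k3⟩, ⟨k10, k20, k30⟩, ⟨k21, k31, k32⟩⟩ := h'.eq_rules
  ext A B
  simp only [Matrix.sub_apply, Matrix.mul_apply, Matrix.smul_apply, Fin.sum_univ_two]
  fin_cases A <;> fin_cases B <;>
    simp [imQuat, sdPart, lieMul, Fin.sum_univ_four, h0, h1, h2, h3,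
      h10, h20, h30, h21, h31, h32, k0, k1, k2, k3, k10, k20, k30, k21, k31, k32] <;>
    ring_nf <;> simp only [Complex.I_sq] <;> ring

lemma spinMinus_lieMul (h : IsSkew Ω) (h' : IsSkew Ω') :
    spinMinus (lieMul Ω Ω') = spinMinus Ω * spinMinus Ω' - spinMinus Ω' * spinMinus Ω := by
  rw [spinMinus_eq h, spinMinus_eq h', spinMinus_eq (h.lieMul h')]
  obtain ⟨⟨h0, h1, h2, h3⟩, ⟨h10, h20, h30⟩, ⟨h21, h31, h32⟩⟩ := h.eq_rules
  obtain ⟨⟨k0, k1, k2, k3⟩, ⟨k10, k20, k30⟩, ⟨k21, k31, k32⟩⟩ := h'.eq_rules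
  ext A B
  simp only [Matrix.sub_apply, Matrix.mul_apply, Matrix.smul_apply, Fin.sum_univ_two]
  fin_cases A <;> fin_cases B <;>
    simp [imQuat, asdPart, lieMul, Fin.sum_univ_four, h0, h1, h2, h3,
      h10, h20, h30, h21, h31, h32, k0, k1, k2, k3, k10, k20, k30, k21, k31, k32] <;>
    ring_nf <;> simp only [Complex.I_sq] <;> ring

/-- Invariance of `σ`. The matrix `Ω` acts by `q ↦ α q - q β`, and `-β ε = ε βᵀ` because `β` is
trace-free. It makes `σ` covariantly constant. -/
lemma spin_soldering (h : IsSkew Ω) (b : Fin 4) (B B' : Fin 2) :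
    ∑ X, spinPlus Ω B X * soldering b X B' + ∑ X, spinMinus Ω B' X * soldering b B X =
      ∑ a, (Ω a b : ℂ) * soldering a B B' := by
  rw [spinPlus_eq h, spinMinus_eq h]
  obtain ⟨⟨h0, h1, h2, h3⟩, ⟨h10, h20, h30⟩, ⟨h21, h31, h32⟩⟩ := h.eq_rules
  simp only [Fin.sum_univ_four, Fin.sum_univ_two, soldering, Matrix.mul_apply, Matrix.smul_apply]
  fin_cases b <;> fin_cases B <;> fin_cases B' <;>
    simp [imQuat, sdPart, asdPart, quat, eps,
      h0, h1, h2, h3, h10, h20, h30, h21, h31, h32] <;>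
    ring_nf <;> simp only [Complex.I_sq] <;> ring

lemma trace_spinMinus (h : IsSkew Ω) : spinMinus Ω 0 0 + spinMinus Ω 1 1 = 0 := by
  rw [spinMinus_eq h]
  simp [imQuat]

lemma spinPlus_linear : IsLinearMap ℝ spinPlus where
  map_add Ω Ω' := by
    simp only [spinPlus, Pi.add_apply, Complex.ofReal_add, add_smul, Finset.sum_add_distrib,
      smul_add]
  map_smul c Ω := by
    simp only [spinPlus, Pi.smul_apply, smul_eq_mul, Complex.ofReal_mul, mul_smul,
      Complex.coe_smul, ← Finset.smul_sum]
    rw [smul_comm]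

lemma spinMinus_linear : IsLinearMap ℝ spinMinus where
  map_add Ω Ω' := by
    simp only [spinMinus, Pi.add_apply, Complex.ofReal_add, add_smul, Finset.sum_add_distrib,
      smul_add]
  map_smul c Ω := by
    simp only [spinMinus, Pi.smul_apply, smul_eq_mul, Complex.ofReal_mul, mul_smul,
      Complex.coe_smul, ← Finset.smul_sum]
    rw [smul_comm]

/-- The contraction `σ_c^{P A'} σ_b^{Q B'} ε_{A'B'}` of two soldering forms. -/
def solderPair (c b : Fin 4) (P Q : Fin 2) : ℂ :=
  ∑ B', ∑ C', eps B' C' * (soldering c P B' * soldering b Q C')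

/-- The contraction `σ σ ε` projects a two-form to its self-dual part, viewed in `S₊²`. Hence only
the rows of the curvature in `Λ⁺` will appear. -/
lemma sum_solderPair (h : IsSkew Ω) (P Q : Fin 2) :
    ∑ c, ∑ b, solderPair c b P Q * (Ω c b : ℂ) = 2 * (imQuat (sdPart Ω) * eps) P Q := by
  obtain ⟨⟨h0, h1, h2, h3⟩, ⟨h10, h20, h30⟩, ⟨h21, h31, h32⟩⟩ := h.eq_rules
  simp only [Fin.sum_univ_four, solderPair, Fin.sum_univ_two, soldering, Matrix.mul_apply,
    h0, h1, h2, h3, h10, h20, h30, h21, h31, h32]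
  fin_cases P <;> fin_cases Q <;>
    simp [imQuat, sdPart, quat, eps, h10, h20, h30, h21, h32] <;> ring

end SpinRepresentation

/-! ### Algebraic curvature tensors and their normal forms. -/

section CurvatureTensor

/-- On permutations of `0, 1, 2, 3` the Vandermonde product is the sign times `12`, and it vanishes
when two indices agree. -/
lemma volSymbol_eq (a b c d : Fin 4) : volSymbol a b c d =
    ((((b : ℤ) - a) * (c - a) * (d - a) * (c - b) * (d - b) * (d - c) / 12 : ℤ) : ℝ) := by
  unfold volSymbol
  congr 1
  simp only [Matrix.det_succ_row_zero, Fin.sum_univ_succ]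
  revert a b c d
  decide


/-- The algebraic symmetries of a Riemann tensor. -/
structure IsCurvatureTensor (R : Fin 4 → Fin 4 → Fin 4 → Fin 4 → ℝ) : Prop where
  skew_left : ∀ a b c d, R a b c d = -R b a c d
  skew_right : ∀ a b c d, R a b c d = -R a b d c
  bianchi : ∀ a b c d, R a b c d + R b c a d + R c a b d = 0

/-- The self-dual to self-dual block of a curvature tensor. -/
def blockPlus (R : Fin 4 → Fin 4 → Fin 4 → Fin 4 → ℝ) (i j : Fin 3) : ℝ :=
  sdPart (fun a b => sdPart (R a b) j) i

/-- The self-dual to anti-self-dual block of a curvature tensor. -/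
def blockMixed (R : Fin 4 → Fin 4 → Fin 4 → Fin 4 → ℝ) (i j : Fin 3) : ℝ :=
  sdPart (fun a b => asdPart (R a b) j) i

namespace IsCurvatureTensor

variable {R : Fin 4 → Fin 4 → Fin 4 → Fin 4 → ℝ}

lemma pair_symm (hR : IsCurvatureTensor R) (a b c d : Fin 4) : R a b c d = R c d a b := by
  linarith [hR.bianchi a b c d, hR.bianchi b c d a, hR.bianchi c d a b, hR.bianchi d a b c,
    hR.skew_left a b c d, hR.skew_left b c a d, hR.skew_left c a b d,
    hR.skew_right a b c d, hR.skew_right b c a d, hR.skew_right c a b d,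
    hR.skew_left b c d a, hR.skew_left c d b a, hR.skew_left d b c a,
    hR.skew_right b c d a, hR.skew_right c d b a, hR.skew_right d b c a,
    hR.skew_left c d a b, hR.skew_left d a c b, hR.skew_left a c d b,
    hR.skew_right c d a b, hR.skew_right d a c b, hR.skew_right a c d b,
    hR.skew_left d a b c, hR.skew_left a b d c, hR.skew_left b d a c,
    hR.skew_right d a b c, hR.skew_right a b d c, hR.skew_right b d a c]

lemma left_rules (hR : IsCurvatureTensor R) (c d : Fin 4) :
    (R 0 0 c d = 0 ∧ R 1 1 c d = 0 ∧ R 2 2 c d = 0 ∧ R 3 3 c d = 0) ∧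
    (R 1 0 c d = -R 0 1 c d ∧ R 2 0 c d = -R 0 2 c d ∧ R 3 0 c d = -R 0 3 c d) ∧
    (R 2 1 c d = -R 1 2 c d ∧ R 3 1 c d = -R 1 3 c d ∧ R 3 2 c d = -R 2 3 c d) :=
  IsSkew.eq_rules (Ω := fun a b => R a b c d) fun a b => hR.skew_left a b c d

lemma right_rules (hR : IsCurvatureTensor R) (a b : Fin 4) :
    (R a b 0 0 = 0 ∧ R a b 1 1 = 0 ∧ R a b 2 2 = 0 ∧ R a b 3 3 = 0) ∧
    (R a b 1 0 = -R a b 0 1 ∧ R a b 2 0 = -R a b 0 2 ∧ R a b 3 0 = -R a b 0 3) ∧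
    (R a b 2 1 = -R a b 1 2 ∧ R a b 3 1 = -R a b 1 3 ∧ R a b 3 2 = -R a b 2 3) :=
  IsSkew.eq_rules (Ω := fun c d => R a b c d) fun c d => hR.skew_right a b c d

/-- Together with `left_rules` and `right_rules` these rewrite every component in terms of the 20
independent ones: 21 from the pair symmetry, less one for the Bianchi identity. -/
lemma pair_rules (hR : IsCurvatureTensor R) :
    (R 0 2 0 1 = R 0 1 0 2 ∧ R 0 3 0 1 = R 0 1 0 3 ∧ R 1 2 0 1 = R 0 1 1 2 ∧
      R 1 3 0 1 = R 0 1 1 3 ∧ R 2 3 0 1 = R 0 1 2 3) ∧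
    (R 0 3 0 2 = R 0 2 0 3 ∧ R 1 2 0 2 = R 0 2 1 2 ∧ R 1 3 0 2 = R 0 2 1 3 ∧
      R 2 3 0 2 = R 0 2 2 3) ∧
    (R 1 2 0 3 = R 0 3 1 2 ∧ R 1 3 0 3 = R 0 3 1 3 ∧ R 2 3 0 3 = R 0 3 2 3) ∧
    (R 1 3 1 2 = R 1 2 1 3 ∧ R 2 3 1 2 = R 1 2 2 3 ∧ R 2 3 1 3 = R 1 3 2 3) ∧
    R 0 3 1 2 = R 0 2 1 3 - R 0 1 2 3 := by
  have := hR.pair_symm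
  refine ⟨⟨?_, ?_, ?_, ?_, ?_⟩, ⟨?_, ?_, ?_, ?_⟩, ⟨?_, ?_, ?_⟩, ⟨?_, ?_, ?_⟩, ?_⟩
  iterate 15 exact this _ _ _ _
  linarith [hR.bianchi 1 2 0 3, hR.pair_symm 1 2 0 3, hR.skew_left 2 0 1 3,
    hR.pair_symm 0 1 2 3]

end IsCurvatureTensor

section Weyl

variable {M : Type*} [TopologicalSpace M] [ChartedSpace E4 M] [IsManifold (𝓡 4) ∞ M]
  [Bundle.RiemannianBundle (fun x : M => TangentSpace (𝓡 4) x)]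
  {e : Fin 4 → Π x : M, TangentSpace (𝓡 4) x} {x : M}

lemma volSymbol_swap (a b c d : Fin 4) : volSymbol a b c d = -volSymbol b a c d := by
  rw [volSymbol_eq, volSymbol_eq, ← Int.cast_neg]
  congr 1
  revert a b c d
  decide

lemma weylPlus_skew_left (hR : IsCurvatureTensor (riemann e x)) (a b c d : Fin 4) :
    weylPlus e x a b c d = -weylPlus e x b a c d := by
  have hw : weyl e x a b c d = -weyl e x b a c d := by
    simp only [weyl]; rw [hR.skew_left]; ring
  simp only [weylPlus, volSymbol_swap a b, neg_mul, Finset.sum_neg_distrib]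
  rw [hw]; ring

lemma weylPlus_skew_right (hR : IsCurvatureTensor (riemann e x)) (a b c d : Fin 4) :
    weylPlus e x a b c d = -weylPlus e x a b d c := by
  have hw : ∀ a b, weyl e x a b c d = -weyl e x a b d c := by
    intro a b; simp only [weyl]; rw [hR.skew_right]; ring
  simp only [weylPlus, hw, mul_neg, Finset.sum_neg_distrib]
  ring

lemma IsSkew.eq_zero {Ω : Fin 4 → Fin 4 → ℝ} (h : IsSkew Ω) (h01 : Ω 0 1 = 0) (h02 : Ω 0 2 = 0)
    (h03 : Ω 0 3 = 0) (h12 : Ω 1 2 = 0) (h13 : Ω 1 3 = 0) (h23 : Ω 2 3 = 0) (a b : Fin 4) :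
    Ω a b = 0 := by
  obtain ⟨⟨h0, h1, h2, h3⟩, ⟨h10, h20, h30⟩, ⟨h21, h31, h32⟩⟩ := h.eq_rules
  fin_cases a <;> fin_cases b <;> simp [*]

lemma star_apply (T : Fin 4 → Fin 4 → ℝ) (hT : IsSkew T) :
    (∑ p, ∑ r, volSymbol 0 1 p r * T p r = 2 * T 2 3) ∧
    (∑ p, ∑ r, volSymbol 0 2 p r * T p r = -(2 * T 1 3)) ∧
    (∑ p, ∑ r, volSymbol 0 3 p r * T p r = 2 * T 1 2) ∧
    (∑ p, ∑ r, volSymbol 1 2 p r * T p r = 2 * T 0 3) ∧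
    (∑ p, ∑ r, volSymbol 1 3 p r * T p r = -(2 * T 0 2)) ∧
    (∑ p, ∑ r, volSymbol 2 3 p r * T p r = 2 * T 0 1) := by
  obtain ⟨⟨h0, h1, h2, h3⟩, ⟨h10, h20, h30⟩, ⟨h21, h31, h32⟩⟩ := hT.eq_rules
  refine ⟨?_, ?_, ?_, ?_, ?_, ?_⟩ <;>
    · simp only [volSymbol_eq, Fin.sum_univ_four, h0, h1, h2, h3, h10, h20, h30, h21, h31, h32]
      norm_num
      try ring

lemma weyl_skew_left (hR : IsCurvatureTensor (riemann e x)) (c d : Fin 4) :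
    IsSkew (fun a b => weyl e x a b c d) := by
  intro a b
  simp only [weyl]; rw [hR.skew_left]; ring

end Weyl

end CurvatureTensor

/-! ### The self-dual Weyl tensor and the trace-free Ricci tensor as curvature blocks. -/

section CurvatureTensor
section Weyl

variable {M : Type*} [TopologicalSpace M] [ChartedSpace E4 M] [IsManifold (𝓡 4) ∞ M]
  [Bundle.RiemannianBundle (fun x : M => TangentSpace (𝓡 4) x)]
  {e : Fin 4 → Π x : M, TangentSpace (𝓡 4) x} {x : M}

lemma blockPlus_symm {R : Fin 4 → Fin 4 → Fin 4 → Fin 4 → ℝ} (hR : IsCurvatureTensor R)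
    (i j : Fin 3) : blockPlus R i j = blockPlus R j i := by
  have hl := hR.left_rules
  have hr := hR.right_rules
  have hp := hR.pair_rules
  fin_cases i <;> fin_cases j <;> simp [blockPlus, sdPart, hl, hr, hp] <;> ring

-- `W⁺` is the trace-free part of the symmetric self-dual block, so it vanishes exactly when that
-- block is scalar. Skewness in both pairs leaves finitely many components, each linear in the 20
-- independent ones.
set_option maxHeartbeats 1000000 in
lemma weylPlus_eq_zero_iff (hR : IsCurvatureTensor (riemann e x)) :
    (∀ a b c d, weylPlus e x a b c d = 0) ↔
      (blockPlus (riemann e x) 0 1 = 0 ∧ blockPlus (riemann e x) 0 2 = 0 ∧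
      blockPlus (riemann e x) 1 2 = 0 ∧
      blockPlus (riemann e x) 0 0 = blockPlus (riemann e x) 1 1 ∧
      blockPlus (riemann e x) 1 1 = blockPlus (riemann e x) 2 2) := by
  have hl := hR.left_rules
  have hr := hR.right_rules
  have hp := hR.pair_rules
  have hs := fun c d => star_apply _ (weyl_skew_left hR c d)
  constructor
  · intro h
    have h01 := h 0 1 0 2
    have h02 := h 0 1 0 3
    have h12 := h 0 2 0 3
    have h00 := h 0 1 0 1
    have h11 := h 0 2 0 2
    have h22 := h 0 3 0 3
    simp only [weylPlus, hs] at h01 h02 h12 h00 h11 h22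
    simp [weyl, ricci, scalar, Fin.sum_univ_four, kdelta, hl, hr, hp]
      at h01 h02 h12 h00 h11 h22
    simp [blockPlus, sdPart, hl, hr, hp]
    refine ⟨?_, ?_, ?_, ?_, ?_⟩ <;> linarith
  · intro h
    simp [blockPlus, sdPart, hl, hr, hp] at h
    obtain ⟨h01, h02, h12, h00, h11⟩ := h
    have key : ∀ c d : Fin 4, (c = 0 ∧ d = 1 ∨ c = 0 ∧ d = 2 ∨ c = 0 ∧ d = 3 ∨ c = 1 ∧ d = 2
        ∨ c = 1 ∧ d = 3 ∨ c = 2 ∧ d = 3) → ∀ a b, weylPlus e x a b c d = 0 := by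
      rintro c d (⟨rfl, rfl⟩ | ⟨rfl, rfl⟩ | ⟨rfl, rfl⟩ | ⟨rfl, rfl⟩ | ⟨rfl, rfl⟩ | ⟨rfl, rfl⟩) <;>
      refine IsSkew.eq_zero (fun a b => weylPlus_skew_left hR a b _ _) ?_ ?_ ?_ ?_ ?_ ?_ <;>
      simp only [weylPlus, hs] <;>
      simp [weyl, ricci, scalar, Fin.sum_univ_four, kdelta, hl, hr, hp] <;>
      linarith
    intro a b
    exact IsSkew.eq_zero (fun c d => weylPlus_skew_right hR a b c d) (key _ _ (by decide) _ _)
      (key _ _ (by decide) _ _) (key _ _ (by decide) _ _) (key _ _ (by decide) _ _)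
      (key _ _ (by decide) _ _) (key _ _ (by decide) _ _)

/-- The nine entries of the mixed block are linear combinations of the nine components of the
trace-free Ricci tensor, and conversely. -/
lemma einstein_iff (hR : IsCurvatureTensor (riemann e x)) :
    (∃ r : ℝ, ∀ a b, ricci e x a b = r * kdelta a b) ↔
      ∀ i j, blockMixed (riemann e x) i j = 0 := by
  have hl := hR.left_rules
  have hr := hR.right_rules
  have hp := hR.pair_rules
  constructor
  · rintro ⟨r, h⟩ i j
    have h00 := h 0 0
    have h11 := h 1 1
    have h22 := h 2 2
    have h33 := h 3 3
    have h01 := h 0 1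
    have h02 := h 0 2
    have h03 := h 0 3
    have h12 := h 1 2
    have h13 := h 1 3
    have h23 := h 2 3
    simp [ricci, Fin.sum_univ_four, kdelta, hl, hr]
      at h00 h11 h22 h33 h01 h02 h03 h12 h13 h23
    fin_cases i <;> fin_cases j <;> simp [blockMixed, sdPart, asdPart, hl, hr, hp] <;> linarith
  · intro h
    have h00 := h 0 0
    have h11 := h 1 1
    have h22 := h 2 2
    have h01 := h 0 1
    have h02 := h 0 2
    have h12 := h 1 2
    have h10 := h 1 0
    have h20 := h 2 0
    have h21 := h 2 1
    simp [blockMixed, sdPart, asdPart, hl, hr, hp]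
      at h00 h11 h22 h01 h02 h12 h10 h20 h21
    -- Once the diagonal entries of Ricci agree, any one of them is the factor.
    refine ⟨ricci e x 0 0, fun a b => ?_⟩
    fin_cases a <;> fin_cases b <;>
      simp [ricci, Fin.sum_univ_four, kdelta, hl, hr, hp] <;> linarith

end Weyl
end CurvatureTensor

/-! ### Matrices acting as derivations on the indices of a tensor. -/

section SlotAction

open Function

variable {ι : Type*} [Fintype ι] [DecidableEq ι]

/-- The derivation action of a matrix on all the indices of a tensor. -/
def slotAct (P : Matrix (Fin 2) (Fin 2) ℂ) (T : (ι → Fin 2) → ℂ) (A : ι → Fin 2) : ℂ :=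
  ∑ m, ∑ B, P (A m) B * T (update A m B)

variable (P Q : Matrix (Fin 2) (Fin 2) ℂ) (T : (ι → Fin 2) → ℂ) (A : ι → Fin 2)

lemma slotAct_add (T' : (ι → Fin 2) → ℂ) :
    slotAct P (fun A => T A + T' A) A = slotAct P T A + slotAct P T' A := by
  simp only [slotAct, mul_add, Finset.sum_add_distrib]

lemma slotAct_sum {κ : Type*} (s : Finset κ) (T : κ → (ι → Fin 2) → ℂ) :
    slotAct P (fun A => ∑ j ∈ s, T j A) A = ∑ j ∈ s, slotAct P (T j) A := by
  simp only [slotAct, Finset.mul_sum]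
  rw [Finset.sum_comm' (s := s) (t := fun _ => Finset.univ) (t' := Finset.univ)
    (s' := fun _ => s) (by simp)]
  refine Finset.sum_congr rfl fun m _ => Finset.sum_comm

lemma slotAct_const_mul (c : ℂ) : slotAct P (fun A => c * T A) A = c * slotAct P T A := by
  simp only [slotAct, Finset.mul_sum]
  exact Finset.sum_congr rfl fun _ _ => Finset.sum_congr rfl fun _ _ => by ring

lemma slotAct_matrix_sub : slotAct (P - Q) T A = slotAct P T A - slotAct Q T A := by
  simp only [slotAct, Matrix.sub_apply, sub_mul, Finset.sum_sub_distrib]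

lemma slotAct_matrix_add : slotAct (P + Q) T A = slotAct P T A + slotAct Q T A := by
  simp only [slotAct, Matrix.add_apply, add_mul, Finset.sum_add_distrib]

lemma slotAct_matrix_smul (c : ℂ) : slotAct (c • P) T A = c * slotAct P T A := by
  simp only [slotAct, Matrix.smul_apply, smul_eq_mul, mul_assoc, Finset.mul_sum]

lemma slotAct_matrix_sum {κ : Type*} (s : Finset κ) (P : κ → Matrix (Fin 2) (Fin 2) ℂ) :
    slotAct (∑ j ∈ s, P j) T A = ∑ j ∈ s, slotAct (P j) T A := by
  classical
  induction s using Finset.induction_on with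
  | empty => simp [slotAct]
  | insert a s ha h => rw [Finset.sum_insert ha, Finset.sum_insert ha, slotAct_matrix_add, h]

/-- Separates the case in which both matrices hit the same index, giving `P * Q`, from the case of
distinct indices. The latter is symmetric in `P` and `Q`, so it drops out of the commutator. -/
lemma slotAct_slotAct : slotAct P (slotAct Q T) A = slotAct (P * Q) T A +
    ∑ m, ∑ m', if m' = m then 0 else
      ∑ B, ∑ C, P (A m) B * Q (A m') C * T (update (update A m B) m' C) := by
  simp only [slotAct]
  rw [← Finset.sum_add_distrib]
  refine Finset.sum_congr rfl fun m _ => ?_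
  have h1 : ∀ m', (∑ B, P (A m) B * ∑ C, Q (update A m B m') C * T (update (update A m B) m' C)) =
      (if m' = m then ∑ B, (P * Q) (A m) B * T (update A m B) else 0) + if m' = m then 0 else
      ∑ B, ∑ C, P (A m) B * Q (A m') C * T (update (update A m B) m' C) := by
    intro m'
    by_cases h : m' = m
    · subst h
      simp only [update_self, update_idem, if_true, add_zero, Matrix.mul_apply, Finset.sum_mul,
        Finset.mul_sum]
      rw [Finset.sum_comm]
      exact Finset.sum_congr rfl fun _ _ => Finset.sum_congr rfl fun _ _ => by ring
    · simp only [h, if_false, zero_add, update_of_ne h, Finset.mul_sum, mul_assoc]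
  have h2 : ∑ B, P (A m) B * ∑ m', ∑ C, Q (update A m B m') C * T (update (update A m B) m' C)
      = ∑ m', ∑ B, P (A m) B * ∑ C, Q (update A m B m') C * T (update (update A m B) m' C) := by
    simp only [Finset.mul_sum (s := (Finset.univ : Finset ι))]
    rw [Finset.sum_comm]
  rw [h2, Finset.sum_congr rfl fun m' _ => h1 m', Finset.sum_add_distrib]
  simp

lemma slotAct_commutator : slotAct P (slotAct Q T) A - slotAct Q (slotAct P T) A =
    slotAct (P * Q - Q * P) T A := by
  have h : (∑ m, ∑ m', if m' = m then 0 else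
      ∑ B, ∑ C, P (A m) B * Q (A m') C * T (update (update A m B) m' C)) =
      ∑ m, ∑ m', if m' = m then 0 else
      ∑ B, ∑ C, Q (A m) B * P (A m') C * T (update (update A m B) m' C) := by
    rw [Finset.sum_comm]
    refine Finset.sum_congr rfl fun m _ => Finset.sum_congr rfl fun m' _ => ?_
    by_cases hm : m = m'
    · simp [hm]
    · rw [if_neg hm, if_neg (Ne.symm hm), Finset.sum_comm]
      refine Finset.sum_congr rfl fun B _ => Finset.sum_congr rfl fun C _ => ?_
      rw [update_comm (Ne.symm hm)]; ring
  rw [slotAct_slotAct, slotAct_slotAct, h, slotAct_matrix_sub]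
  ring

lemma slotAct_mixed {κ : Type*} [Fintype κ] [DecidableEq κ]
    (T : (ι → Fin 2) → (κ → Fin 2) → ℂ) (A' : κ → Fin 2) :
    slotAct P (fun A => slotAct Q (T A) A') A =
      slotAct Q (fun A' => slotAct P (fun A => T A A') A) A' := by
  simp only [slotAct, Finset.mul_sum]
  have hc : ∀ f : ι → Fin 2 → κ → Fin 2 → ℂ,
      ∑ m, ∑ B, ∑ m', ∑ C, f m B m' C = ∑ m', ∑ C, ∑ m, ∑ B, f m B m' C := by
    intro f
    calc _ = ∑ m, ∑ m', ∑ B, ∑ C, f m B m' C :=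
          Finset.sum_congr rfl fun _ _ => Finset.sum_comm
      _ = ∑ m', ∑ m, ∑ B, ∑ C, f m B m' C := Finset.sum_comm
      _ = ∑ m', ∑ m, ∑ C, ∑ B, f m B m' C :=
          Finset.sum_congr rfl fun _ _ => Finset.sum_congr rfl fun _ _ => Finset.sum_comm
      _ = _ := Finset.sum_congr rfl fun _ _ => Finset.sum_comm
  rw [hc]
  exact Finset.sum_congr rfl fun _ _ => Finset.sum_congr rfl fun _ _ =>
    Finset.sum_congr rfl fun _ _ => Finset.sum_congr rfl fun _ _ => by ring

variable {k : ℕ}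

/-- Leibniz rule for a tensor built by inserting a new index at every position: the action hits
either the inserted index or the remaining ones. -/
lemma slotAct_insert (G : Fin 2 → (Fin k → Fin 2) → ℂ) (A : Fin (k + 1) → Fin 2) :
    slotAct P (fun A => ∑ p : Fin (k + 1), G (A p) (fun m => A (p.succAbove m))) A =
      ∑ p : Fin (k + 1), (∑ X, P (A p) X * G X (fun m => A (p.succAbove m))
        + slotAct P (G (A p)) (fun m => A (p.succAbove m))) := by
  rw [slotAct_sum]
  refine Finset.sum_congr rfl fun p _ => ?_
  rw [slotAct, Fin.sum_univ_succAbove _ p]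
  congr 1
  · refine Finset.sum_congr rfl fun X _ => ?_
    simp
  · rw [slotAct]
    refine Finset.sum_congr rfl fun m _ => Finset.sum_congr rfl fun X _ => ?_
    rw [update_of_ne (Fin.succAbove_ne p m).symm]
    congr 2
    funext m'
    by_cases h : m' = m
    · subst h; simp
    · rw [update_of_ne h, update_of_ne fun h' => h (Fin.succAbove_right_injective h')]

lemma slotAct_snoc (G : (Fin (k + 1) → Fin 2) → ℂ) (A : Fin k → Fin 2) (C : Fin 2) :
    slotAct P (fun A => G (Fin.snoc A C)) A + ∑ X, P C X * G (Fin.snoc A X) =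
      slotAct P G (Fin.snoc A C) := by
  have hl : ∀ m X, Function.update (Fin.snoc (α := fun _ => Fin 2) A C) (Fin.castSucc m) X =
      Fin.snoc (α := fun _ => Fin 2) (Function.update A m X) C := fun m X =>
    (Fin.snoc_update (α := fun _ => Fin 2) ..).symm
  have hr : ∀ X, Function.update (Fin.snoc (α := fun _ => Fin 2) A C) (Fin.last k) X =
      Fin.snoc (α := fun _ => Fin 2) A X := fun X => Fin.update_snoc_last (α := fun _ => Fin 2) ..
  simp only [slotAct, Fin.sum_univ_castSucc (n := k), hl, hr, Fin.snoc_castSucc, Fin.snoc_last]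

/-- The derivation action of a pair of matrices on a spin tensor. -/
def act {k n : ℕ} (P Q : Matrix (Fin 2) (Fin 2) ℂ) (T : SpinTensor k n) : SpinTensor k n :=
  fun A A' => slotAct P (fun A => T A A') A + slotAct Q (T A) A'

lemma act_add {n : ℕ} (P Q : Matrix (Fin 2) (Fin 2) ℂ) (T T' : SpinTensor k n)
    (A : Fin k → Fin 2) (A' : Fin n → Fin 2) :
    act P Q (fun A A' => T A A' + T' A A') A A' = act P Q T A A' + act P Q T' A A' := by
  simp only [act]
  rw [slotAct_add P (fun A => T A A') A (fun A => T' A A'), slotAct_add Q (T A) A' (T' A)]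
  ring

lemma act_commutator {n : ℕ} (P Q P' Q' : Matrix (Fin 2) (Fin 2) ℂ) (T : SpinTensor k n)
    (A : Fin k → Fin 2) (A' : Fin n → Fin 2) :
    act P Q (act P' Q' T) A A' - act P' Q' (act P Q T) A A' =
      act (P * P' - P' * P) (Q * Q' - Q' * Q) T A A' := by
  have h : ∀ P Q P' Q', act P Q (act P' Q' T) A A' =
      slotAct P (slotAct P' fun A => T A A') A + slotAct P (fun A => slotAct Q' (T A) A') A
      + (slotAct Q (fun A' => slotAct P' (fun A => T A A') A) A'
      + slotAct Q (slotAct Q' (T A)) A') := by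
    intro P Q P' Q'
    rw [← slotAct_add, ← slotAct_add]
    rfl
  rw [h, h, act, ← slotAct_commutator, ← slotAct_commutator, slotAct_mixed P Q',
    slotAct_mixed P' Q]
  ring

end SlotAction

/-! ### Sums over ordered pairs of distinct indices. -/

section PairSums

variable {k : ℕ}

/-- The pair `(p, q)` encodes two distinct positions `p` and `p.succAbove q`. Exchanging them is an
involution that leaves the complementary list of indices unchanged. -/
lemma sum_removeNth_swap (g : Fin 2 → Fin 2 → (Fin k → Fin 2) → ℂ) (A : Fin (k + 2) → Fin 2) :
    ∑ p : Fin (k + 2), ∑ q : Fin (k + 1), g (A p) (A (p.succAbove q))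
        (fun m => A (p.succAbove (q.succAbove m))) =
      ∑ p : Fin (k + 2), ∑ q : Fin (k + 1), g (A (p.succAbove q)) (A p)
        (fun m => A (p.succAbove (q.succAbove m))) := by
  simp only [← Finset.sum_product', Finset.univ_product_univ]
  refine Finset.sum_bij' (fun pq _ => (pq.1.succAbove pq.2, pq.2.predAbove pq.1))
    (fun pq _ => (pq.1.succAbove pq.2, pq.2.predAbove pq.1)) (by simp) (by simp) ?_ ?_ ?_
  · rintro ⟨p, q⟩ -
    simp [Fin.succAbove_succAbove_predAbove, Fin.predAbove_predAbove_succAbove]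
  · rintro ⟨p, q⟩ -
    simp [Fin.succAbove_succAbove_predAbove, Fin.predAbove_predAbove_succAbove]
  · rintro ⟨p, q⟩ -
    simp [Fin.succAbove_succAbove_predAbove, Fin.succAbove_succAbove_succAbove_predAbove]

end PairSums

/-! ### Leibniz rule for derivations with variable matrices. -/

section SlotDerivative

variable {M : Type*} [TopologicalSpace M] [ChartedSpace E4 M]

lemma smoothC_slotAct {m : ℕ} {U : Set M} {P : M → Matrix (Fin 2) (Fin 2) ℂ}
    (hP : ∀ A B, SmoothC U (fun x => P x A B)) {T : M → (Fin m → Fin 2) → ℂ}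
    (hT : ∀ A, SmoothC U (fun x => T x A)) (A : Fin m → Fin 2) :
    SmoothC U (fun x => slotAct (P x) (T x) A) :=
  .sum fun _ _ => .sum fun _ _ => .mul (hP _ _) (hT _)

lemma frameDeriv_slotAct {m : ℕ} {U : Set M} (hU : IsOpen U) {x : M} (hx : x ∈ U)
    {e : Fin 4 → Π x : M, TangentSpace (𝓡 4) x} (a : Fin 4)
    {P : M → Matrix (Fin 2) (Fin 2) ℂ}
    (hP : ∀ A B, SmoothC U (fun x => P x A B)) {T : M → (Fin m → Fin 2) → ℂ}
    (hT : ∀ A, SmoothC U (fun x => T x A)) (A : Fin m → Fin 2) :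
    frameDeriv e a (fun x => slotAct (P x) (T x) A) x =
      slotAct (fun A B => frameDeriv e a (fun y => P y A B) x) (T x) A
        + slotAct (P x) (fun A => frameDeriv e a (fun y => T y A) x) A := by
  simp only [slotAct]
  rw [frameDeriv_sum hU hx a fun m _ => .sum fun B _ => .mul (hP _ _) (hT _),
    ← Finset.sum_add_distrib]
  refine Finset.sum_congr rfl fun m _ => ?_
  rw [frameDeriv_sum hU hx a fun B _ => .mul (hP _ _) (hT _), ← Finset.sum_add_distrib]
  exact Finset.sum_congr rfl fun B _ => frameDeriv_mul hU hx a (hP _ _) (hT _)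

end SlotDerivative

/-! ### The spin connection, its curvature and the Ricci identity. -/

section SpinConnection

open SpinStructure

variable {M : Type*} [TopologicalSpace M] [ChartedSpace E4 M] [IsManifold (𝓡 4) ∞ M]
  [Bundle.RiemannianBundle (fun x : M => TangentSpace (𝓡 4) x)]

lemma SpinStructure.isOrthonormalFrame (S : SpinStructure M) (i : S.ι) :
    IsOrthonormalFrame (S.U i) (S.e i) where
  isOpen := S.isOpen_U i
  smooth a _ hx := (S.smooth_e i a).contMDiffAt ((S.isOpen_U i).mem_nhds hx)
  orthonormal := S.orthonormal_e i

variable {S : SpinStructure M} {k n : ℕ}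

/-- Smoothness of all the components of a field of spin tensors. -/
def SmoothT (U : Set M) (φ : M → SpinTensor k n) : Prop :=
  ∀ A A', SmoothC U (fun x => φ x A A')

lemma connPlus_eq (i : S.ι) (c : Fin 4) (x : M) :
    S.connPlus i c x = spinPlus (fun a b => christoffel (S.e i) c a b x) := rfl

lemma connMinus_eq (i : S.ι) (c : Fin 4) (x : M) :
    S.connMinus i c x = spinMinus (fun a b => christoffel (S.e i) c a b x) := rfl

lemma covDeriv_eq (i : S.ι) (c : Fin 4) (φ : M → SpinTensor k n) (x : M) (A : Fin k → Fin 2)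
    (A' : Fin n → Fin 2) : covDeriv i c φ x A A' =
      frameDeriv (S.e i) c (fun y => φ y A A') x
        + act (S.connPlus i c x) (S.connMinus i c x) (φ x) A A' := by
  rw [covDeriv, add_assoc]; rfl

/-- The second covariant derivative `∇²_{c,b} φ`. -/
def hess (i : S.ι) (c b : Fin 4) (φ : M → SpinTensor k n) (x : M) : SpinTensor k n :=
  fun A A' => covDeriv i c (covDeriv i b φ) x A A'
    - ∑ a, (christoffel (S.e i) c a b x : ℂ) * covDeriv i a φ x A A'

/-- The spin curvature of `e_a, e_b` on spin tensors. -/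
def curvAct (i : S.ι) (a b : Fin 4) (x : M) (T : SpinTensor k n) : SpinTensor k n :=
  act (spinPlus fun p q => riemann (S.e i) x a b q p)
    (spinMinus fun p q => riemann (S.e i) x a b q p) T

variable [IsContMDiffRiemannianBundle (𝓡 4) ∞ E4 (fun x : M => TangentSpace (𝓡 4) x)]

lemma isSkew_christoffel (i : S.ι) {x : M} (hx : x ∈ S.U i) (c : Fin 4) :
    IsSkew (fun a b => christoffel (S.e i) c a b x) :=
  fun a b => (S.isOrthonormalFrame i).christoffel_skew hx c a b

lemma smoothC_connPlus (i : S.ι) (c : Fin 4) (A B : Fin 2) :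
    SmoothC (S.U i) (fun x => S.connPlus i c x A B) := by
  simp only [connPlus_eq, spinPlus_apply]
  exact .sum fun a _ => .sum fun b _ => .mul (.const _)
    ((S.isOrthonormalFrame i).smoothC_christoffel c a b)

lemma smoothC_connMinus (i : S.ι) (c : Fin 4) (A B : Fin 2) :
    SmoothC (S.U i) (fun x => S.connMinus i c x A B) := by
  simp only [connMinus_eq, spinMinus_apply]
  exact .sum fun a _ => .sum fun b _ => .mul (.const _)
    ((S.isOrthonormalFrame i).smoothC_christoffel c a b)

lemma smoothC_act (i : S.ι) (c : Fin 4) {φ : M → SpinTensor k n} (hφ : SmoothT (S.U i) φ) :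
    SmoothT (S.U i) (fun x => act (S.connPlus i c x) (S.connMinus i c x) (φ x)) := fun A A' =>
  .add (smoothC_slotAct (smoothC_connPlus i c) (fun A => hφ A A') A)
    (smoothC_slotAct (smoothC_connMinus i c) (fun A' => hφ A A') A')

lemma SmoothT.covDeriv {i : S.ι} {φ : M → SpinTensor k n} (hφ : SmoothT (S.U i) φ) (c : Fin 4) :
    SmoothT (S.U i) (covDeriv i c φ) := by
  intro A A'
  simp only [covDeriv_eq]
  exact ((hφ A A').frameDeriv (S.isOrthonormalFrame i) c).add (smoothC_act i c hφ A A')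

lemma SmoothT.nabla {i : S.ι} {φ : M → SpinTensor k n} (hφ : SmoothT (S.U i) φ) (B B' : Fin 2) :
    SmoothT (S.U i) (nabla i B B' φ) := fun A A' =>
  .sum fun c _ => .mul (.const _) (hφ.covDeriv c A A')

lemma frameDeriv_connPlus (i : S.ι) {x : M} (hx : x ∈ S.U i) (a b : Fin 4) (A B : Fin 2) :
    frameDeriv (S.e i) a (fun y => S.connPlus i b y A B) x =
      spinPlus (fun p q => mvfderiv (𝓡 4) (christoffel (S.e i) b p q) x (S.e i a x)) A B := by
  have he := S.isOrthonormalFrame i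
  simp only [connPlus_eq, spinPlus_apply]
  rw [frameDeriv_sum he.isOpen hx a fun p _ => .sum fun q _ => .mul (.const _)
    (he.smoothC_christoffel b p q)]
  refine Finset.sum_congr rfl fun p _ => ?_
  rw [frameDeriv_sum he.isOpen hx a fun q _ => .mul (.const _) (he.smoothC_christoffel b p q)]
  refine Finset.sum_congr rfl fun q _ => ?_
  rw [frameDeriv_const_mul he.isOpen hx a (he.smoothC_christoffel b p q),
    frameDeriv_ofReal he.isOpen hx a fun y hy =>
      (he.contMDiffAt_christoffel hy b p q).contMDiffWithinAt]

lemma frameDeriv_connMinus (i : S.ι) {x : M} (hx : x ∈ S.U i) (a b : Fin 4) (A B : Fin 2) :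
    frameDeriv (S.e i) a (fun y => S.connMinus i b y A B) x =
      spinMinus (fun p q => mvfderiv (𝓡 4) (christoffel (S.e i) b p q) x (S.e i a x)) A B := by
  have he := S.isOrthonormalFrame i
  simp only [connMinus_eq, spinMinus_apply]
  rw [frameDeriv_sum he.isOpen hx a fun p _ => .sum fun q _ => .mul (.const _)
    (he.smoothC_christoffel b p q)]
  refine Finset.sum_congr rfl fun p _ => ?_
  rw [frameDeriv_sum he.isOpen hx a fun q _ => .mul (.const _) (he.smoothC_christoffel b p q)]
  refine Finset.sum_congr rfl fun q _ => ?_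
  rw [frameDeriv_const_mul he.isOpen hx a (he.smoothC_christoffel b p q),
    frameDeriv_ofReal he.isOpen hx a fun y hy =>
      (he.contMDiffAt_christoffel hy b p q).contMDiffWithinAt]

/-- The curvature in terms of the connection coefficients. -/
lemma riemann_eq_connection (i : S.ι) {x : M} (hx : x ∈ S.U i) (a b : Fin 4) :
    (fun p q => riemann (S.e i) x a b q p) =
      (fun p q => mvfderiv (𝓡 4) (christoffel (S.e i) b p q) x (S.e i a x))
      - (fun p q => mvfderiv (𝓡 4) (christoffel (S.e i) a p q) x (S.e i b x))
      + lieMul (fun p q => christoffel (S.e i) a p q x) (fun p q => christoffel (S.e i) b p q x)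
      - ∑ c, (christoffel (S.e i) a c b x - christoffel (S.e i) b c a x) •
          (fun p q => christoffel (S.e i) c p q x) := by
  funext p q
  rw [(S.isOrthonormalFrame i).riemann_eq hx]
  simp only [Pi.sub_apply, Pi.add_apply, Finset.sum_apply, Pi.smul_apply, smul_eq_mul, lieMul,
    Finset.sum_sub_distrib]
  ring

/-- The lift of the connection has as curvature the lift of the Riemann tensor, since `spinPlus` is
linear and respects commutators. -/
lemma spinPlus_riemann (i : S.ι) {x : M} (hx : x ∈ S.U i) (a b : Fin 4) :
    spinPlus (fun p q => riemann (S.e i) x a b q p) =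
      spinPlus (fun p q => mvfderiv (𝓡 4) (christoffel (S.e i) b p q) x (S.e i a x))
      - spinPlus (fun p q => mvfderiv (𝓡 4) (christoffel (S.e i) a p q) x (S.e i b x))
      + (S.connPlus i a x * S.connPlus i b x - S.connPlus i b x * S.connPlus i a x)
      - ∑ c, ((christoffel (S.e i) a c b x : ℂ) - christoffel (S.e i) b c a x) •
          S.connPlus i c x := by
  have hl := spinPlus_linear
  simp only [connPlus_eq]
  rw [← spinPlus_lieMul (isSkew_christoffel i hx a) (isSkew_christoffel i hx b),
    riemann_eq_connection i hx, hl.map_sub, hl.map_add, hl.map_sub]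
  congr 1
  rw [← hl.mk'_apply, map_sum]
  refine Finset.sum_congr rfl fun c _ => ?_
  rw [map_smul, ← Complex.coe_smul, hl.mk'_apply]
  push_cast
  rfl

lemma spinMinus_riemann (i : S.ι) {x : M} (hx : x ∈ S.U i) (a b : Fin 4) :
    spinMinus (fun p q => riemann (S.e i) x a b q p) =
      spinMinus (fun p q => mvfderiv (𝓡 4) (christoffel (S.e i) b p q) x (S.e i a x))
      - spinMinus (fun p q => mvfderiv (𝓡 4) (christoffel (S.e i) a p q) x (S.e i b x))
      + (S.connMinus i a x * S.connMinus i b x - S.connMinus i b x * S.connMinus i a x)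
      - ∑ c, ((christoffel (S.e i) a c b x : ℂ) - christoffel (S.e i) b c a x) •
          S.connMinus i c x := by
  have hl := spinMinus_linear
  simp only [connMinus_eq]
  rw [← spinMinus_lieMul (isSkew_christoffel i hx a) (isSkew_christoffel i hx b),
    riemann_eq_connection i hx, hl.map_sub, hl.map_add, hl.map_sub]
  congr 1
  rw [← hl.mk'_apply, map_sum]
  refine Finset.sum_congr rfl fun c _ => ?_
  rw [map_smul, ← Complex.coe_smul, hl.mk'_apply]
  push_cast
  rfl

/-- Arranged so that the two terms with one derivative of `φ` are together symmetric in `a, b`; they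
disappear on antisymmetrising. -/
lemma covDeriv_covDeriv (i : S.ι) {x : M} (hx : x ∈ S.U i) {φ : M → SpinTensor k n}
    (hφ : SmoothT (S.U i) φ) (a b : Fin 4) (A : Fin k → Fin 2) (A' : Fin n → Fin 2) :
    covDeriv i a (covDeriv i b φ) x A A' =
      frameDeriv (S.e i) a (frameDeriv (S.e i) b fun y => φ y A A') x
      + act (spinPlus (fun p q => mvfderiv (𝓡 4) (christoffel (S.e i) b p q) x (S.e i a x)))
          (spinMinus (fun p q => mvfderiv (𝓡 4) (christoffel (S.e i) b p q) x (S.e i a x)))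
          (φ x) A A'
      + act (S.connPlus i b x) (S.connMinus i b x)
          (fun A A' => frameDeriv (S.e i) a (fun y => φ y A A') x) A A'
      + act (S.connPlus i a x) (S.connMinus i a x)
          (fun A A' => frameDeriv (S.e i) b (fun y => φ y A A') x) A A'
      + act (S.connPlus i a x) (S.connMinus i a x)
          (act (S.connPlus i b x) (S.connMinus i b x) (φ x)) A A' := by
  have he := S.isOrthonormalFrame i
  have h1 : frameDeriv (S.e i) a (fun y => covDeriv i b φ y A A') x =
      frameDeriv (S.e i) a (frameDeriv (S.e i) b fun y => φ y A A') x
      + (slotAct (spinPlus (fun p q => mvfderiv (𝓡 4) (christoffel (S.e i) b p q) x (S.e i a x)))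
          (fun A => φ x A A') A
        + slotAct (S.connPlus i b x) (fun A => frameDeriv (S.e i) a (fun y => φ y A A') x) A
        + (slotAct
          (spinMinus (fun p q => mvfderiv (𝓡 4) (christoffel (S.e i) b p q) x (S.e i a x)))
          (φ x A) A'
        + slotAct (S.connMinus i b x) (fun A' => frameDeriv (S.e i) a (fun y => φ y A A') x) A'))
      := by
    simp only [covDeriv_eq]
    rw [frameDeriv_add he.isOpen hx a ((hφ A A').frameDeriv he b) (smoothC_act i b hφ A A')]
    congr 1
    simp only [act]
    rw [frameDeriv_add he.isOpen hx a
      (smoothC_slotAct (smoothC_connPlus i b) (fun A => hφ A A') A)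
      (smoothC_slotAct (smoothC_connMinus i b) (fun A' => hφ A A') A'),
      frameDeriv_slotAct he.isOpen hx a (smoothC_connPlus i b) (fun A => hφ A A') A,
      frameDeriv_slotAct he.isOpen hx a (smoothC_connMinus i b) (fun A' => hφ A A') A']
    simp only [frameDeriv_connPlus i hx, frameDeriv_connMinus i hx]
  have h2 : act (S.connPlus i a x) (S.connMinus i a x) (covDeriv i b φ x) A A' =
      act (S.connPlus i a x) (S.connMinus i a x)
          (fun A A' => frameDeriv (S.e i) b (fun y => φ y A A') x) A A'
      + act (S.connPlus i a x) (S.connMinus i a x)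
          (act (S.connPlus i b x) (S.connMinus i b x) (φ x)) A A' := by
    have : covDeriv i b φ x = fun A A' => frameDeriv (S.e i) b (fun y => φ y A A') x
        + act (S.connPlus i b x) (S.connMinus i b x) (φ x) A A' := by
      funext A A'; exact covDeriv_eq ..
    rw [this, act_add]
  rw [covDeriv_eq, h1, h2]
  simp only [act]
  ring

/-- The Ricci identity for spin tensors. -/
lemma hess_sub_hess (i : S.ι) {x : M} (hx : x ∈ S.U i) {φ : M → SpinTensor k n}
    (hφ : SmoothT (S.U i) φ) (a b : Fin 4) (A : Fin k → Fin 2) (A' : Fin n → Fin 2) :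
    hess i a b φ x A A' - hess i b a φ x A A' = curvAct i a b x (φ x) A A' := by
  have hcomm := frameDeriv_comm (S.isOrthonormalFrame i) hx (hφ A A') a b
  have hact := act_commutator (S.connPlus i a x) (S.connMinus i a x) (S.connPlus i b x)
    (S.connMinus i b x) (φ x) A A'
  simp only [hess, covDeriv_covDeriv i hx hφ, curvAct]
  rw [spinPlus_riemann i hx, spinMinus_riemann i hx]
  have hexp : ∀ P₁ P₂ P₃ : Matrix (Fin 2) (Fin 2) ℂ, ∀ Q₁ Q₂ Q₃ : Matrix (Fin 2) (Fin 2) ℂ,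
      ∀ c : Fin 4 → ℂ, ∀ P Q : Fin 4 → Matrix (Fin 2) (Fin 2) ℂ,
      act (P₁ - P₂ + P₃ - ∑ f, c f • P f) (Q₁ - Q₂ + Q₃ - ∑ f, c f • Q f) (φ x) A A' =
      act P₁ Q₁ (φ x) A A' - act P₂ Q₂ (φ x) A A' + act P₃ Q₃ (φ x) A A'
        - ∑ f, c f * act (P f) (Q f) (φ x) A A' := by
    intro P₁ P₂ P₃ Q₁ Q₂ Q₃ c P Q
    simp only [act, slotAct_matrix_sub, slotAct_matrix_add, slotAct_matrix_sum,
      slotAct_matrix_smul, mul_add, Finset.sum_add_distrib]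
    ring
  rw [hexp, ← hact]
  -- The first-order terms from the bracket `[e_a, e_b]` match the connection corrections in `hess`,
  -- because the torsion is zero.
  have hsum : ∑ c, ((christoffel (S.e i) a c b x : ℂ) - christoffel (S.e i) b c a x) *
      covDeriv i c φ x A A' =
      ∑ c, ((christoffel (S.e i) a c b x : ℂ) - christoffel (S.e i) b c a x) *
        frameDeriv (S.e i) c (fun y => φ y A A') x
      + ∑ c, ((christoffel (S.e i) a c b x : ℂ) - christoffel (S.e i) b c a x) *
        act (S.connPlus i c x) (S.connMinus i c x) (φ x) A A' := by
    rw [← Finset.sum_add_distrib]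
    exact Finset.sum_congr rfl fun c _ => by rw [covDeriv_eq, mul_add]
  have hsub : ∑ c, ((christoffel (S.e i) a c b x : ℂ) - christoffel (S.e i) b c a x) *
      covDeriv i c φ x A A' =
      ∑ c, (christoffel (S.e i) a c b x : ℂ) * covDeriv i c φ x A A'
      - ∑ c, (christoffel (S.e i) b c a x : ℂ) * covDeriv i c φ x A A' := by
    rw [← Finset.sum_sub_distrib]
    exact Finset.sum_congr rfl fun c _ => sub_mul _ _ _
  linear_combination hcomm - hsum + hsub

end SpinConnection

/-! ### Identities for `ε` and rearrangements of contracted sums. -/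

section SpinAlgebra

/-- Infinitesimal `SL(2)`-invariance of `ε`: a trace-free matrix acting on both contracted indices
contributes nothing. -/
lemma sum_eps_invariant {Q : Matrix (Fin 2) (Fin 2) ℂ} (hQ : Q 0 0 + Q 1 1 = 0)
    (N : Fin 2 → Fin 2 → ℂ) :
    ∑ B, ∑ C, eps B C * ((∑ X, Q B X * N X C) + ∑ X, Q C X * N B X) = 0 := by
  simp only [Fin.sum_univ_two, eps, Matrix.of_apply, Matrix.cons_val_zero, Matrix.cons_val_one,
    Matrix.cons_val', Matrix.cons_val_fin_one]
  linear_combination (N 0 1 - N 1 0) * hQ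

lemma solderPair_swap (c b : Fin 4) (P Q : Fin 2) : solderPair c b Q P = -solderPair b c P Q := by
  simp only [solderPair, Fin.sum_univ_two, eps, Matrix.of_apply, Matrix.cons_val_zero,
    Matrix.cons_val_one, Matrix.cons_val', Matrix.cons_val_fin_one]
  ring

/-- The Schouten identity: antisymmetrising over three indices with two values gives zero. It trades
a derivative contracted with the field for the two derivatives contracted with each other. -/
lemma sum_eps_antisymm (K : Fin 2 → Fin 2 → Fin 2 → ℂ) (X : Fin 2) :
    ∑ B, ∑ C, eps B C * (K X B C - K B X C) = -∑ B, ∑ C, eps B C * K B C X := by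
  fin_cases X <;> simp [Fin.sum_univ_two, eps] <;> ring

lemma slotAct_comp_perm {ι : Type*} [Fintype ι] [DecidableEq ι] (P : Matrix (Fin 2) (Fin 2) ℂ)
    (T : (ι → Fin 2) → ℂ) (s : Equiv.Perm ι) (A : ι → Fin 2) :
    slotAct P T (A ∘ s) = slotAct P (fun A => T (A ∘ s)) A := by
  simp only [slotAct]
  refine Fintype.sum_equiv s _ _ fun m => ?_
  simp only [Function.comp_apply, Function.update_comp_equiv, Equiv.symm_apply_apply]

lemma exists_perm_snoc_succAbove {n : ℕ} (r : Fin (n + 1)) : ∃ t : Equiv.Perm (Fin (n + 1)),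
    ∀ A : Fin (n + 1) → Fin 2,
      (Fin.snoc (fun m => A (r.succAbove m)) (A r) : Fin (n + 1) → Fin 2) = A ∘ t := by
  refine ⟨(finSuccEquiv' (Fin.last n)).trans (finSuccEquiv' r).symm, fun A => ?_⟩
  funext m
  refine Fin.lastCases ?_ (fun m => ?_) m
  · simp
  · simp [finSuccEquiv'_last_apply_castSucc]

lemma snoc_succAbove_castSucc {n : ℕ} (A : Fin (n + 1) → Fin 2) (C : Fin 2) (r : Fin (n + 1)) :
    (fun m => (Fin.snoc A C : Fin (n + 2) → Fin 2) (r.castSucc.succAbove m)) =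
      (Fin.snoc (fun m => A (r.succAbove m)) C : Fin (n + 1) → Fin 2) := by
  funext m
  refine Fin.lastCases ?_ (fun m => ?_) m
  · rw [Fin.succAbove_castSucc_of_le _ _ (Fin.le_last r), Fin.succ_last, Fin.snoc_last,
      Fin.snoc_last]
  · rw [Fin.castSucc_succAbove_castSucc, Fin.snoc_castSucc, Fin.snoc_castSucc]

lemma sum_contract_left {k : ℕ} (e : Fin 2 → Fin 2 → ℂ) (s : Fin (k + 2) → Fin 4 → ℂ)
    (t : Fin (k + 2) → Fin (k + 1) → Fin 4 → Fin 2 → ℂ)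
    (H : Fin (k + 2) → Fin (k + 1) → Fin 4 → Fin 4 → Fin 2 → ℂ) :
    ∑ p, ∑ c, s p c * ∑ q, ∑ B, ∑ C, e B C * ∑ b, t p q b B * H p q c b C =
      ∑ B, ∑ C, e B C * ∑ p, ∑ q, ∑ c, ∑ b, s p c * t p q b B * H p q c b C := by
  have key : ∀ B C, e B C * ∑ p, ∑ q, ∑ c, ∑ b, s p c * t p q b B * H p q c b C =
      ∑ p, ∑ c, s p c * ∑ q, e B C * ∑ b, t p q b B * H p q c b C := by
    intro B C
    simp only [Finset.mul_sum]
    refine Finset.sum_congr rfl fun p _ => ?_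
    rw [Finset.sum_comm]
    refine Finset.sum_congr rfl fun c _ => Finset.sum_congr rfl fun q _ =>
      Finset.sum_congr rfl fun b _ => by ring
  simp only [key, Fin.sum_univ_two, mul_add, Finset.sum_add_distrib]

lemma sum_contract_right {k n : ℕ} (e : Fin 2 → Fin 2 → ℂ) (s : Fin (k + 2) → Fin 4 → Fin 2 → ℂ)
    (t : Fin (k + 2) → Fin (k + 1) → Fin (n + 1) → Fin 4 → Fin 2 → ℂ)
    (H : Fin (k + 2) → Fin (k + 1) → Fin (n + 1) → Fin 4 → Fin 4 → Fin 2 → ℂ) :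
    ∑ p, ∑ B, ∑ C, e B C * ∑ c, s p c B * ∑ q, ∑ r, ∑ b, t p q r b C * H p q r c b C =
      ∑ r, ∑ B, ∑ C, e B C * ∑ p, ∑ q, ∑ c, ∑ b, s p c B * t p q r b C * H p q r c b C := by
  have key : ∀ p B C, e B C * ∑ c, s p c B * ∑ q, ∑ r, ∑ b, t p q r b C * H p q r c b C =
      ∑ r, e B C * ∑ q, ∑ c, ∑ b, s p c B * t p q r b C * H p q r c b C := by
    intro p B C
    rw [← Finset.mul_sum]
    congr 1
    simp only [Finset.mul_sum]
    rw [Finset.sum_comm, Finset.sum_comm (s := Finset.univ (α := Fin (n + 1)))]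
    refine Finset.sum_congr rfl fun q _ => ?_
    rw [Finset.sum_comm]
    refine Finset.sum_congr rfl fun r _ => Finset.sum_congr rfl fun c _ =>
      Finset.sum_congr rfl fun b _ => by ring
  simp only [key]
  have : ∀ F : Fin (k + 2) → Fin 2 → Fin 2 → Fin (n + 1) → ℂ,
      ∑ p, ∑ B, ∑ C, ∑ r, F p B C r = ∑ r, ∑ B, ∑ C, ∑ p, F p B C r := by
    intro F
    simp only [Fin.sum_univ_two, Finset.sum_add_distrib]
    simp only [Finset.sum_comm (s := Finset.univ (α := Fin (k + 2)))
      (t := Finset.univ (α := Fin (n + 1)))]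
  rw [this]
  simp only [Finset.mul_sum]

end SpinAlgebra

/-! ### The commutator of `d` and `δ` as a curvature term. -/

section Commutator

open SpinStructure

variable {M : Type*} [TopologicalSpace M] [ChartedSpace E4 M] [IsManifold (𝓡 4) ∞ M]
  [Bundle.RiemannianBundle (fun x : M => TangentSpace (𝓡 4) x)]
  {S : SpinStructure M} {k n : ℕ}

/-- The part of `∇_{A}^{X} ∇_{B}^{Y} φ` symmetrised over the unprimed indices, unnormalised. -/
def hessPair (i : S.ι) (φ : M → SpinTensor k n) (x : M) (A : Fin (k + 2) → Fin 2) (X Y : Fin 2)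
    (A' : Fin n → Fin 2) : ℂ :=
  ∑ p : Fin (k + 2), ∑ q : Fin (k + 1), ∑ c, ∑ b,
    soldering c (A p) X * soldering b (A (p.succAbove q)) Y *
      hess i c b φ x (fun m => A (p.succAbove (q.succAbove m))) A'

/-- The spin curvature, projected to `S₊²` in its form indices, acting on a spin tensor and
symmetrised over the unprimed indices, unnormalised. -/
def curvPair (i : S.ι) (x : M) (T : SpinTensor k n) : SpinTensor (k + 2) n :=
  fun A A' => ∑ p : Fin (k + 2), ∑ q : Fin (k + 1), ∑ c, ∑ b,
    solderPair c b (A p) (A (p.succAbove q)) *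
      curvAct i c b x T (fun m => A (p.succAbove (q.succAbove m))) A'

lemma curvPair_comp_perm (i : S.ι) (x : M) {T : SpinTensor k n} (t : Equiv.Perm (Fin n))
    (hT : ∀ A A', T A (A' ∘ t) = T A A') (A : Fin (k + 2) → Fin 2) (A' : Fin n → Fin 2) :
    curvPair i x T A (A' ∘ t) = curvPair i x T A A' := by
  simp only [curvPair, curvAct, act, slotAct_comp_perm, hT]

lemma SpinorField.smoothT (ψ : SpinorField S k n) (i : S.ι) : SmoothT (S.U i) (ψ.comp i) :=
  fun A A' => ψ.smooth i A A'

variable [IsContMDiffRiemannianBundle (𝓡 4) ∞ E4 (fun x : M => TangentSpace (𝓡 4) x)]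

/-- The covariant derivative of `σ^b ∇_b φ` with all its spinor indices, including the two new ones,
passes through `σ` by `spin_soldering`. The coefficients thus produced are those subtracted in
`hess`. -/
lemma frameDeriv_nabla (i : S.ι) {x : M} (hx : x ∈ S.U i) {φ : M → SpinTensor k n}
    (hφ : SmoothT (S.U i) φ) (c : Fin 4) (B B' : Fin 2) (A : Fin k → Fin 2)
    (A' : Fin n → Fin 2) :
    frameDeriv (S.e i) c (fun y => nabla i B B' φ y A A') x
      + ∑ X, S.connPlus i c x B X * nabla i X B' φ x A A'
      + ∑ X, S.connMinus i c x B' X * nabla i B X φ x A A'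
      + act (S.connPlus i c x) (S.connMinus i c x) (nabla i B B' φ x) A A' =
    ∑ b, soldering b B B' * hess i c b φ x A A' := by
  have he := S.isOrthonormalFrame i
  have h1 : frameDeriv (S.e i) c (fun y => nabla i B B' φ y A A') x =
      ∑ b, soldering b B B' * frameDeriv (S.e i) c (fun y => covDeriv i b φ y A A') x := by
    simp only [nabla]
    rw [frameDeriv_sum he.isOpen hx c fun b _ => .mul (.const _) (hφ.covDeriv b A A')]
    exact Finset.sum_congr rfl fun b _ => frameDeriv_const_mul he.isOpen hx c (hφ.covDeriv b A A') _
  have h2 : act (S.connPlus i c x) (S.connMinus i c x) (nabla i B B' φ x) A A' =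
      ∑ b, soldering b B B' *
        act (S.connPlus i c x) (S.connMinus i c x) (covDeriv i b φ x) A A' := by
    simp only [act, mul_add, Finset.sum_add_distrib, ← slotAct_const_mul]
    rw [← slotAct_sum, ← slotAct_sum]
    rfl
  have h3 : ∑ X, S.connPlus i c x B X * nabla i X B' φ x A A'
      + ∑ X, S.connMinus i c x B' X * nabla i B X φ x A A' =
      ∑ b, ∑ a, (christoffel (S.e i) c a b x : ℂ) * soldering a B B' * covDeriv i b φ x A A' := by
    simp only [nabla, Finset.mul_sum]
    rw [Finset.sum_comm, add_comm, Finset.sum_comm, add_comm, ← Finset.sum_add_distrib]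
    refine Finset.sum_congr rfl fun b _ => ?_
    rw [← Finset.sum_mul, ← spin_soldering (isSkew_christoffel i hx c) b B B', add_mul,
      Finset.sum_mul, Finset.sum_mul]
    simp only [connPlus_eq, connMinus_eq, mul_assoc]
  have h4 : ∑ b, ∑ a, (christoffel (S.e i) c a b x : ℂ) * soldering a B B'
        * covDeriv i b φ x A A' =
      -∑ b, soldering b B B' * ∑ a, (christoffel (S.e i) c a b x : ℂ) * covDeriv i a φ x A A' := by
    rw [Finset.sum_comm, ← Finset.sum_neg_distrib]
    refine Finset.sum_congr rfl fun b _ => ?_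
    rw [Finset.mul_sum, ← Finset.sum_neg_distrib]
    refine Finset.sum_congr rfl fun a _ => ?_
    rw [he.christoffel_skew hx c b a]
    push_cast
    ring
  have h5 : ∑ b, soldering b B B' * covDeriv i c (covDeriv i b φ) x A A' =
      ∑ b, soldering b B B' * frameDeriv (S.e i) c (fun y => covDeriv i b φ y A A') x
      + ∑ b, soldering b B B' *
        act (S.connPlus i c x) (S.connMinus i c x) (covDeriv i b φ x) A A' := by
    rw [← Finset.sum_add_distrib]
    exact Finset.sum_congr rfl fun b _ => by rw [covDeriv_eq i c (covDeriv i b φ), mul_add]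
  simp only [hess, mul_sub, Finset.sum_sub_distrib]
  linear_combination h1 + h2 + h3 + h4 - h5

lemma covDeriv_dOp (i : S.ι) {x : M} (hx : x ∈ S.U i) {φ : M → SpinTensor k n}
    (hφ : SmoothT (S.U i) φ) (c : Fin 4) (A : Fin (k + 1) → Fin 2) (A' : Fin (n + 1) → Fin 2) :
    covDeriv i c (dOp i φ) x A A' = ∑ p : Fin (k + 1), ∑ r : Fin (n + 1), ∑ b,
      soldering b (A p) (A' r) * hess i c b φ x (fun m => A (p.succAbove m))
        (fun m => A' (r.succAbove m)) := by
  have he := S.isOrthonormalFrame i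
  have h1 : frameDeriv (S.e i) c (fun y => dOp i φ y A A') x =
      ∑ p : Fin (k + 1), ∑ r : Fin (n + 1), frameDeriv (S.e i) c (fun y =>
        nabla i (A p) (A' r) φ y (fun m => A (p.succAbove m)) (fun m => A' (r.succAbove m))) x := by
    simp only [dOp]
    rw [frameDeriv_sum he.isOpen hx c fun p _ => .sum fun r _ => hφ.nabla _ _ _ _]
    exact Finset.sum_congr rfl fun p _ => frameDeriv_sum he.isOpen hx c fun r _ => hφ.nabla _ _ _ _
  have h2 : slotAct (S.connPlus i c x) (fun A => dOp i φ x A A') A =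
      ∑ p : Fin (k + 1), ∑ r : Fin (n + 1), (∑ X, S.connPlus i c x (A p) X *
          nabla i X (A' r) φ x (fun m => A (p.succAbove m)) (fun m => A' (r.succAbove m))
        + slotAct (S.connPlus i c x) (fun a => nabla i (A p) (A' r) φ x a
          (fun m => A' (r.succAbove m))) (fun m => A (p.succAbove m))) := by
    have := slotAct_insert (S.connPlus i c x) (fun X a => ∑ r : Fin (n + 1),
      nabla i X (A' r) φ x a (fun m => A' (r.succAbove m))) A
    refine this.trans (Finset.sum_congr rfl fun p _ => ?_)
    rw [slotAct_sum, Finset.sum_add_distrib]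
    congr 1
    simp only [Finset.mul_sum]
    exact Finset.sum_comm
  have h3 : slotAct (S.connMinus i c x) (dOp i φ x A) A' =
      ∑ p : Fin (k + 1), ∑ r : Fin (n + 1), (∑ X, S.connMinus i c x (A' r) X *
          nabla i (A p) X φ x (fun m => A (p.succAbove m)) (fun m => A' (r.succAbove m))
        + slotAct (S.connMinus i c x) (nabla i (A p) (A' r) φ x (fun m => A (p.succAbove m)))
          (fun m => A' (r.succAbove m))) := by
    have : slotAct (S.connMinus i c x) (dOp i φ x A) A' = ∑ p : Fin (k + 1),
      slotAct (S.connMinus i c x) (fun A' => ∑ r : Fin (n + 1),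
        nabla i (A p) (A' r) φ x (fun m => A (p.succAbove m)) (fun m => A' (r.succAbove m))) A' :=
      slotAct_sum _ _ _ _
    rw [this]
    exact Finset.sum_congr rfl fun p _ => slotAct_insert (S.connMinus i c x)
      (fun X a' => nabla i (A p) X φ x (fun m => A (p.succAbove m)) a') A'
  rw [covDeriv_eq, act, h1, h2, h3, ← Finset.sum_add_distrib, ← Finset.sum_add_distrib]
  refine Finset.sum_congr rfl fun p _ => ?_
  rw [← Finset.sum_add_distrib, ← Finset.sum_add_distrib]
  refine Finset.sum_congr rfl fun r _ => ?_
  rw [← frameDeriv_nabla i hx hφ, act]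
  ring

lemma covDeriv_deltaOp (i : S.ι) {x : M} (hx : x ∈ S.U i) {φ : M → SpinTensor k (n + 1)}
    (hφ : SmoothT (S.U i) φ) (c : Fin 4) (A : Fin (k + 1) → Fin 2) (A' : Fin n → Fin 2) :
    covDeriv i c (deltaOp i φ) x A A' = ∑ p : Fin (k + 1), ∑ B', ∑ C', eps B' C' *
      ∑ b, soldering b (A p) B' * hess i c b φ x (fun m => A (p.succAbove m))
        (Fin.snoc A' C') := by
  have he := S.isOrthonormalFrame i
  have h1 : frameDeriv (S.e i) c (fun y => deltaOp i φ y A A') x =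
      ∑ p : Fin (k + 1), ∑ B', ∑ C', eps B' C' * frameDeriv (S.e i) c (fun y =>
        nabla i (A p) B' φ y (fun m => A (p.succAbove m)) (Fin.snoc A' C')) x := by
    refine (frameDeriv_sum he.isOpen hx c fun p _ => .sum fun B' _ => .sum fun C' _ =>
      .mul (.const _) (hφ.nabla _ _ _ _)).trans (Finset.sum_congr rfl fun p _ => ?_)
    refine (frameDeriv_sum he.isOpen hx c fun B' _ => .sum fun C' _ =>
      .mul (.const _) (hφ.nabla _ _ _ _)).trans (Finset.sum_congr rfl fun B' _ => ?_)
    refine (frameDeriv_sum he.isOpen hx c fun C' _ => .mul (.const _) (hφ.nabla _ _ _ _)).trans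
      (Finset.sum_congr rfl fun C' _ => ?_)
    exact frameDeriv_const_mul he.isOpen hx c (hφ.nabla _ _ _ _) _
  have h2 : slotAct (S.connPlus i c x) (fun A => deltaOp i φ x A A') A =
      ∑ p : Fin (k + 1), ∑ B', ∑ C', eps B' C' * (∑ X, S.connPlus i c x (A p) X *
          nabla i X B' φ x (fun m => A (p.succAbove m)) (Fin.snoc A' C')
        + slotAct (S.connPlus i c x) (fun a => nabla i (A p) B' φ x a (Fin.snoc A' C'))
          (fun m => A (p.succAbove m))) := by
    have := slotAct_insert (S.connPlus i c x) (fun X a => ∑ B', ∑ C', eps B' C' *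
      nabla i X B' φ x a (Fin.snoc A' C')) A
    refine this.trans (Finset.sum_congr rfl fun p _ => ?_)
    simp only [slotAct_sum, slotAct_const_mul, mul_add, Finset.sum_add_distrib]
    congr 1
    simp only [Fin.sum_univ_two]
    ring
  have h3 : slotAct (S.connMinus i c x) (deltaOp i φ x A) A' =
      ∑ p : Fin (k + 1), ∑ B', ∑ C', eps B' C' *
        (slotAct (S.connMinus i c x) (nabla i (A p) B' φ x (fun m => A (p.succAbove m)))
          (Fin.snoc A' C') + ∑ X, S.connMinus i c x B' X *
            nabla i (A p) X φ x (fun m => A (p.succAbove m)) (Fin.snoc A' C')) := by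
    have : slotAct (S.connMinus i c x) (deltaOp i φ x A) A' =
        ∑ p : Fin (k + 1), ∑ B', ∑ C', eps B' C' * slotAct (S.connMinus i c x) (fun A' =>
          nabla i (A p) B' φ x (fun m => A (p.succAbove m)) (Fin.snoc A' C')) A' := by
      simp only [← slotAct_const_mul, ← slotAct_sum]
      rfl
    rw [this]
    refine Finset.sum_congr rfl fun p _ => ?_
    have htr : S.connMinus i c x 0 0 + S.connMinus i c x 1 1 = 0 :=
      trace_spinMinus (isSkew_christoffel i hx c)
    -- The contracted pair is not a pair of free indices, so `covDeriv` has no connection terms for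
    -- it. By invariance of `ε` these sum to zero and may be added.
    have hinv := sum_eps_invariant htr fun B' C' =>
      nabla i (A p) B' φ x (fun m => A (p.succAbove m)) (Fin.snoc A' C')
    rw [← add_zero (∑ B', ∑ C', _), ← hinv, ← Finset.sum_add_distrib]
    refine Finset.sum_congr rfl fun B' _ => ?_
    rw [← Finset.sum_add_distrib]
    refine Finset.sum_congr rfl fun C' _ => ?_
    rw [← slotAct_snoc]
    ring
  rw [covDeriv_eq, act, h1, h2, h3, ← Finset.sum_add_distrib, ← Finset.sum_add_distrib]
  refine Finset.sum_congr rfl fun p _ => ?_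
  rw [← Finset.sum_add_distrib, ← Finset.sum_add_distrib]
  refine Finset.sum_congr rfl fun B' _ => ?_
  rw [← Finset.sum_add_distrib, ← Finset.sum_add_distrib]
  refine Finset.sum_congr rfl fun C' _ => ?_
  rw [← frameDeriv_nabla i hx hφ, act]
  ring

lemma dOp_deltaOp (i : S.ι) {x : M} (hx : x ∈ S.U i) {φ : M → SpinTensor k (n + 1)}
    (hφ : SmoothT (S.U i) φ) (A : Fin (k + 2) → Fin 2) (A' : Fin (n + 1) → Fin 2) :
    dOp i (deltaOp i φ) x A A' = ∑ r, ∑ B, ∑ C, eps B C *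
      hessPair i φ x A (A' r) B (Fin.snoc (fun m => A' (r.succAbove m)) C) := by
  simp only [dOp, nabla, covDeriv_deltaOp i hx hφ, hessPair]
  rw [Finset.sum_comm]
  exact Finset.sum_congr rfl fun r _ => sum_contract_left eps _ _ _

lemma deltaOp_dOp (i : S.ι) {x : M} (hx : x ∈ S.U i) {φ : M → SpinTensor k n}
    (hφ : SmoothT (S.U i) φ) (A : Fin (k + 2) → Fin 2) (A' : Fin n → Fin 2) :
    deltaOp i (dOp i φ) x A A' = ∑ r, ∑ B, ∑ C, eps B C *
      hessPair i φ x A B ((Fin.snoc A' C : Fin (n + 1) → Fin 2) r)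
        (fun m => (Fin.snoc A' C : Fin (n + 1) → Fin 2) (r.succAbove m)) := by
  simp only [deltaOp, nabla, covDeriv_dOp i hx hφ, hessPair]
  exact sum_contract_right eps (fun p c B => soldering c (A p) B)
    (fun p q r b C => soldering b (A (p.succAbove q)) ((Fin.snoc A' C : Fin (n + 1) → Fin 2) r))
    (fun p q r c b C => hess i c b φ x (fun m => A (p.succAbove (q.succAbove m)))
      (fun m => (Fin.snoc A' C : Fin (n + 1) → Fin 2) (r.succAbove m)))

/-- `solderPair` changes sign when its form indices and its spinor indices are exchanged together.
With the spinor indices symmetrised, it antisymmetrises the second derivatives, and the Ricci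
identity applies; the factor `1/2` comes from this antisymmetrisation. -/
lemma sum_eps_hessPair (i : S.ι) {x : M} (hx : x ∈ S.U i) {φ : M → SpinTensor k n}
    (hφ : SmoothT (S.U i) φ) (A : Fin (k + 2) → Fin 2) (A' : Fin n → Fin 2) :
    ∑ B, ∑ C, eps B C * hessPair i φ x A B C A' = (1 / 2) * curvPair i x (φ x) A A' := by
  have h1 : ∑ B, ∑ C, eps B C * hessPair i φ x A B C A' =
      ∑ p : Fin (k + 2), ∑ q : Fin (k + 1), ∑ c, ∑ b,
        solderPair c b (A p) (A (p.succAbove q)) *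
          hess i c b φ x (fun m => A (p.succAbove (q.succAbove m))) A' := by
    simp only [hessPair, solderPair, Fin.sum_univ_two, Finset.mul_sum, add_mul,
      Finset.sum_add_distrib, mul_assoc]
  have h2 := sum_removeNth_swap (fun P Q a => ∑ c, ∑ b, solderPair c b P Q *
    hess i c b φ x a A') A
  have h3 : ∑ p : Fin (k + 2), ∑ q : Fin (k + 1), ∑ c, ∑ b,
        solderPair c b (A (p.succAbove q)) (A p) *
          hess i c b φ x (fun m => A (p.succAbove (q.succAbove m))) A' =
      -∑ p : Fin (k + 2), ∑ q : Fin (k + 1), ∑ c, ∑ b,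
        solderPair c b (A p) (A (p.succAbove q)) *
          hess i b c φ x (fun m => A (p.succAbove (q.succAbove m))) A' := by
    simp only [← Finset.sum_neg_distrib]
    refine Finset.sum_congr rfl fun p _ => Finset.sum_congr rfl fun q _ => ?_
    rw [Finset.sum_comm]
    exact Finset.sum_congr rfl fun c _ => Finset.sum_congr rfl fun b _ => by
      rw [solderPair_swap]; ring
  have h4 : curvPair i x (φ x) A A' =
      ∑ p : Fin (k + 2), ∑ q : Fin (k + 1), ∑ c, ∑ b,
        solderPair c b (A p) (A (p.succAbove q)) *
          hess i c b φ x (fun m => A (p.succAbove (q.succAbove m))) A'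
      - ∑ p : Fin (k + 2), ∑ q : Fin (k + 1), ∑ c, ∑ b,
        solderPair c b (A p) (A (p.succAbove q)) *
          hess i b c φ x (fun m => A (p.succAbove (q.succAbove m))) A' := by
    simp only [curvPair, ← hess_sub_hess i hx hφ, mul_sub, Finset.sum_sub_distrib]
  linear_combination h1 + (1 / 2) * h2 + (1 / 2) * h3 - (1 / 2) * h4

lemma deltaOp_dOp_zero (i : S.ι) {x : M} (hx : x ∈ S.U i) {φ : M → SpinTensor k 0}
    (hφ : SmoothT (S.U i) φ) (A : Fin (k + 2) → Fin 2) (A' : Fin 0 → Fin 2) :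
    deltaOp i (dOp i φ) x A A' = (1 / 2) * curvPair i x (φ x) A A' := by
  rw [deltaOp_dOp i hx hφ, ← sum_eps_hessPair i hx hφ, Fin.sum_univ_one]
  refine Finset.sum_congr rfl fun B _ => Finset.sum_congr rfl fun C _ => ?_
  congr 2
  exact Subsingleton.elim _ _

/-- The commutator `dδ - δd` is a curvature term of order zero. -/
lemma dOp_deltaOp_sub_deltaOp_dOp (i : S.ι) {x : M} (hx : x ∈ S.U i)
    {φ : M → SpinTensor k (n + 1)} (hφ : SmoothT (S.U i) φ)
    (hsymm : ∀ (t : Equiv.Perm (Fin (n + 1))) A A', φ x A (A' ∘ t) = φ x A A')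
    (A : Fin (k + 2) → Fin 2) (A' : Fin (n + 1) → Fin 2) :
    dOp i (deltaOp i φ) x A A' - deltaOp i (dOp i φ) x A A' =
      -((n + 2) / 2) * curvPair i x (φ x) A A' := by
  rw [dOp_deltaOp i hx hφ, deltaOp_dOp i hx hφ, Fin.sum_univ_castSucc (n := n + 1)]
  simp only [Fin.snoc_last, Fin.snoc_castSucc, Fin.succAbove_last, snoc_succAbove_castSucc]
  -- In `δd`, the summand where the contracted index sits on the derivative of `d` is already a
  -- curvature term. The other `n + 1` summands pair off with those of `dδ`.
  rw [sum_eps_hessPair i hx hφ, ← sub_sub, ← Finset.sum_sub_distrib]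
  have h : ∀ r : Fin (n + 1), (∑ B, ∑ C, eps B C *
        hessPair i φ x A (A' r) B (Fin.snoc (fun m => A' (r.succAbove m)) C)) -
      (∑ B, ∑ C, eps B C *
        hessPair i φ x A B (A' r) (Fin.snoc (fun m => A' (r.succAbove m)) C)) =
      -((1 / 2) * curvPair i x (φ x) A A') := by
    intro r
    -- The three slots are the outer derivative, the inner derivative and the contracted index of
    -- `φ`. The identity moves `A' r` back onto `φ`, where symmetry restores the original order of
    -- indices.
    have := sum_eps_antisymm (fun X Y C => hessPair i φ x A X Y
      (Fin.snoc (fun m => A' (r.succAbove m)) C)) (A' r)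
    simp only [mul_sub, Finset.sum_sub_distrib] at this
    rw [this, sum_eps_hessPair i hx hφ]
    obtain ⟨t, ht⟩ := exists_perm_snoc_succAbove r
    rw [ht, curvPair_comp_perm i x t (hsymm t)]
  rw [Finset.sum_congr rfl fun r _ => h r, Finset.sum_const, Finset.card_univ, Fintype.card_fin,
    nsmul_eq_mul]
  push_cast
  ring

/-- The numerical factors, `1/2` without primed indices and `-(n + 2)/2` with `n + 1` of them, are
nonzero. -/
lemma commutesOn_iff (S : SpinStructure M) (k n : ℕ) : S.CommutesOn k n ↔
    ∀ ψ : SpinorField S k n, ∀ i, ∀ x ∈ S.U i, curvPair i x (ψ.comp i x) = 0 := by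
  cases n with
  | zero =>
    refine forall_congr' fun ψ => forall_congr' fun i => forall₂_congr fun x hx => ?_
    simp only [funext_iff, Pi.zero_apply, deltaOp_dOp_zero i hx (ψ.smoothT i)]
    simp
  | succ n =>
    refine forall_congr' fun ψ => forall_congr' fun i => forall₂_congr fun x hx => ?_
    have hn : ((n : ℂ) + 2) / 2 ≠ 0 := by
      have : (n : ℂ) + 2 ≠ 0 := by exact_mod_cast Nat.succ_ne_zero (n + 1)
      simpa using this
    simp only [funext_iff, Pi.zero_apply, Pi.sub_apply]
    refine forall₂_congr fun A A' => ?_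
    rw [dOp_deltaOp_sub_deltaOp_dOp i hx (ψ.smoothT i) fun t A A' => by
      simpa using ψ.symm i x hx 1 t A A']
    simp [hn, neg_eq_zero]

end Commutator

/-! ### The contracted spin curvature in terms of the curvature blocks. -/

section CurvatureContraction

variable {R : Fin 4 → Fin 4 → Fin 4 → Fin 4 → ℝ}

/-- The curvature of `S₊`, projected to `S₊²` in its form indices. -/
def spinCurvPlus (R : Fin 4 → Fin 4 → Fin 4 → Fin 4 → ℝ) (P Q : Fin 2) :
    Matrix (Fin 2) (Fin 2) ℂ :=
  ∑ c, ∑ b, solderPair c b P Q • spinPlus (fun p q => R c b q p)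

/-- The curvature of `S₋`, projected to `S₊²` in its form indices. -/
def spinCurvMinus (R : Fin 4 → Fin 4 → Fin 4 → Fin 4 → ℝ) (P Q : Fin 2) :
    Matrix (Fin 2) (Fin 2) ℂ :=
  ∑ c, ∑ b, solderPair c b P Q • spinMinus (fun p q => R c b q p)

lemma imQuat_eq_sum (u : Fin 3 → ℝ) : imQuat u = ∑ i, (u i : ℂ) • quat i.succ := by
  ext A B
  simp only [Fin.sum_univ_three, Matrix.add_apply, Matrix.smul_apply]
  fin_cases A <;> fin_cases B <;> simp [imQuat, quat]

lemma sdPart_transpose {Ω : Fin 4 → Fin 4 → ℝ} (h : IsSkew Ω) (j : Fin 3) :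
    sdPart (fun p q => Ω q p) j = -sdPart Ω j := by
  fin_cases j <;> simp [sdPart, h 0 1, h 0 2, h 0 3, h 2 3, h 3 1, h 1 2] <;> ring

lemma asdPart_transpose {Ω : Fin 4 → Fin 4 → ℝ} (h : IsSkew Ω) (j : Fin 3) :
    asdPart (fun p q => Ω q p) j = -asdPart Ω j := by
  fin_cases j <;> simp [asdPart, h 0 1, h 0 2, h 0 3, h 2 3, h 3 1, h 1 2] <;> ring

lemma IsSkew.transpose {Ω : Fin 4 → Fin 4 → ℝ} (h : IsSkew Ω) : IsSkew (fun p q => Ω q p) :=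
  fun a b => h b a

lemma sum_solderPair_eq {Ω : Fin 4 → Fin 4 → ℝ} (h : IsSkew Ω) (P Q : Fin 2) :
    ∑ c, ∑ b, solderPair c b P Q * (Ω c b : ℂ) =
      2 * ∑ i, (sdPart Ω i : ℂ) * soldering i.succ P Q := by
  rw [sum_solderPair h, imQuat_eq_sum]
  simp only [Finset.sum_mul, Matrix.sum_apply, Matrix.smul_mul, Matrix.smul_apply, smul_eq_mul,
    soldering]

/-- The matrix of the endomorphism `R(e_c, e_b)` has entries `R c b q p`; this transposition gives
the sign. The `1/2` in `spinPlus_eq` cancels the `2` in `sum_solderPair_eq`. -/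
lemma spinCurvPlus_apply (hR : IsCurvatureTensor R) (P Q A B : Fin 2) :
    spinCurvPlus R P Q A B =
      -∑ i, ∑ j, (blockPlus R i j : ℂ) * soldering i.succ P Q * quat (Fin.succ j) A B := by
  have hs : ∀ c b, IsSkew (R c b) := fun c b => hR.skew_right c b
  have hskew : ∀ j, IsSkew (fun c b => sdPart (R c b) j) := by
    intro j c b
    have : R c b = fun p q => -R b c p q := funext₂ fun p q => hR.skew_left c b p q
    fin_cases j <;> simp [sdPart, this] <;> ring
  have h1 : ∀ c b, spinPlus (fun p q => R c b q p) A B =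
      -(1 / 2) * ∑ j, (sdPart (R c b) j : ℂ) * quat (Fin.succ j) A B := by
    intro c b
    rw [spinPlus_eq (hs c b).transpose, imQuat_eq_sum]
    simp only [sdPart_transpose (hs c b), Matrix.smul_apply, Matrix.sum_apply, smul_eq_mul,
      Complex.ofReal_neg, neg_mul, Finset.sum_neg_distrib, mul_neg]
  simp only [spinCurvPlus, Matrix.sum_apply, Matrix.smul_apply, smul_eq_mul, h1]
  have h2 : ∑ c, ∑ b, solderPair c b P Q * (-(1 / 2) * ∑ j, (sdPart (R c b) j : ℂ) *
      quat (Fin.succ j) A B) = -(1 / 2) * ∑ j, (∑ c, ∑ b, solderPair c b P Q *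
        (sdPart (R c b) j : ℂ)) * quat (Fin.succ j) A B := by
    simp only [Fin.sum_univ_three, Finset.mul_sum, Finset.sum_mul, mul_add, Finset.sum_add_distrib]
    refine congr_arg₂ _ (congr_arg₂ _ ?_ ?_) ?_ <;>
    exact Finset.sum_congr rfl fun c _ => Finset.sum_congr rfl fun b _ => by ring
  rw [h2]
  simp only [sum_solderPair_eq (hskew _), blockPlus, Fin.sum_univ_three]
  ring

lemma spinCurvMinus_apply (hR : IsCurvatureTensor R) (P Q A B : Fin 2) :
    spinCurvMinus R P Q A B =
      -∑ i, ∑ j, (blockMixed R i j : ℂ) * soldering i.succ P Q * quat (Fin.succ j) A B := by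
  have hs : ∀ c b, IsSkew (R c b) := fun c b => hR.skew_right c b
  have hskew : ∀ j, IsSkew (fun c b => asdPart (R c b) j) := by
    intro j c b
    have : R c b = fun p q => -R b c p q := funext₂ fun p q => hR.skew_left c b p q
    fin_cases j <;> simp [asdPart, this] <;> ring
  have h1 : ∀ c b, spinMinus (fun p q => R c b q p) A B =
      -(1 / 2) * ∑ j, (asdPart (R c b) j : ℂ) * quat (Fin.succ j) A B := by
    intro c b
    rw [spinMinus_eq (hs c b).transpose, imQuat_eq_sum]
    simp only [asdPart_transpose (hs c b), Matrix.smul_apply, Matrix.sum_apply, smul_eq_mul,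
      Complex.ofReal_neg, neg_mul, Finset.sum_neg_distrib, mul_neg]
  simp only [spinCurvMinus, Matrix.sum_apply, Matrix.smul_apply, smul_eq_mul, h1]
  have h2 : ∑ c, ∑ b, solderPair c b P Q * (-(1 / 2) * ∑ j, (asdPart (R c b) j : ℂ) *
      quat (Fin.succ j) A B) = -(1 / 2) * ∑ j, (∑ c, ∑ b, solderPair c b P Q *
        (asdPart (R c b) j : ℂ)) * quat (Fin.succ j) A B := by
    simp only [Fin.sum_univ_three, Finset.mul_sum, Finset.sum_mul, mul_add, Finset.sum_add_distrib]
    refine congr_arg₂ _ (congr_arg₂ _ ?_ ?_) ?_ <;>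
    exact Finset.sum_congr rfl fun c _ => Finset.sum_congr rfl fun b _ => by ring
  rw [h2]
  simp only [sum_solderPair_eq (hskew _), blockMixed, Fin.sum_univ_three]
  ring

/-- The self-dual block of a curvature tensor is a multiple of the identity. -/
def IsScalarBlock (R : Fin 4 → Fin 4 → Fin 4 → Fin 4 → ℝ) : Prop :=
  blockPlus R 0 1 = 0 ∧ blockPlus R 0 2 = 0 ∧ blockPlus R 1 2 = 0 ∧
    blockPlus R 0 0 = blockPlus R 1 1 ∧ blockPlus R 1 1 = blockPlus R 2 2

/-- For a scalar block the sum reduces to the invariant `∑ σ_i ⊗ q_i`, which is built from `ε` and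
the identity alone. -/
lemma spinCurvPlus_of_isScalarBlock (hR : IsCurvatureTensor R) (h : IsScalarBlock R)
    (P Q A B : Fin 2) : spinCurvPlus R P Q A B = -(blockPlus R 0 0 : ℂ) *
      (eps P A * (1 : Matrix (Fin 2) (Fin 2) ℂ) Q B
        + eps Q A * (1 : Matrix (Fin 2) (Fin 2) ℂ) P B) := by
  obtain ⟨h01, h02, h12, h0, h1⟩ := h
  rw [spinCurvPlus_apply hR]
  simp only [Fin.sum_univ_three, blockPlus_symm hR 1 0, blockPlus_symm hR 2 0,
    blockPlus_symm hR 2 1, h01, h02, h12, h0, h1, soldering, Matrix.mul_apply, Fin.sum_univ_two]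
  fin_cases P <;> fin_cases Q <;> fin_cases A <;> fin_cases B <;>
    simp [quat, eps] <;> ring_nf <;> simp only [Complex.I_sq] <;> ring

lemma spinCurvMinus_eq_zero (hR : IsCurvatureTensor R) (h : ∀ i j, blockMixed R i j = 0)
    (P Q : Fin 2) : spinCurvMinus R P Q = 0 := by
  ext A B
  simp [spinCurvMinus_apply hR, h]

end CurvatureContraction

/-! ### The scalar curvature drops out on symmetric tensors. -/

section Vanishing

lemma exists_perm_cons_succAbove {n : ℕ} (r : Fin (n + 1)) : ∃ t : Equiv.Perm (Fin (n + 1)),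
    ∀ A : Fin (n + 1) → Fin 2,
      (Fin.cons (A r) (fun m => A (r.succAbove m)) : Fin (n + 1) → Fin 2) = A ∘ t := by
  refine ⟨(finSuccEquiv' 0).trans (finSuccEquiv' r).symm, fun A => ?_⟩
  funext m
  refine Fin.cases ?_ (fun m => ?_) m
  · simp
  · have := finSuccEquiv'_succAbove 0 m
    rw [Fin.zero_succAbove] at this
    simp [this]

lemma update_eq_cons_of_symm {n : ℕ} {T : (Fin (n + 1) → Fin 2) → ℂ}
    (hT : ∀ (t : Equiv.Perm (Fin (n + 1))) A, T (A ∘ t) = T A) (A : Fin (n + 1) → Fin 2)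
    (m : Fin (n + 1)) (B : Fin 2) :
    T (Function.update A m B) = T (Fin.cons B (fun j => A (m.succAbove j))) := by
  obtain ⟨t, ht⟩ := exists_perm_cons_succAbove m
  have := ht (Function.update A m B)
  rw [Function.update_self] at this
  rw [← hT t, ← this]
  congr 2
  funext j
  rw [Function.update_of_ne (Fin.succAbove_ne m j)]

/-- An antisymmetric factor summed over ordered pairs of positions cancels in pairs. -/
lemma sum_eps_pair {k : ℕ} (h : (Fin k → Fin 2) → ℂ) (A : Fin (k + 2) → Fin 2) :
    ∑ p : Fin (k + 2), ∑ q : Fin (k + 1), eps (A p) (A (p.succAbove q)) *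
      h (fun m => A (p.succAbove (q.succAbove m))) = 0 := by
  have heps : ∀ P Q, eps P Q = -eps Q P := by
    intro P Q; fin_cases P <;> fin_cases Q <;> simp [eps]
  have h1 := sum_removeNth_swap (fun P Q a => eps P Q * h a) A
  simp only [fun p : Fin (k + 2) => fun q : Fin (k + 1) => heps (A (p.succAbove q)) (A p),
    neg_mul, Finset.sum_neg_distrib] at h1
  linear_combination (1 / 2) * h1

/-- A symmetric tensor is annihilated by the scalar part of the self-dual curvature. -/
lemma sum_slotAct_eq_zero {k : ℕ} {X : Fin 2 → Fin 2 → Matrix (Fin 2) (Fin 2) ℂ} {c : ℂ}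
    (hX : ∀ P Q A B, X P Q A B = c * (eps P A * (1 : Matrix (Fin 2) (Fin 2) ℂ) Q B
        + eps Q A * (1 : Matrix (Fin 2) (Fin 2) ℂ) P B))
    {T : (Fin k → Fin 2) → ℂ} (hT : ∀ (t : Equiv.Perm (Fin k)) A, T (A ∘ t) = T A)
    (A : Fin (k + 2) → Fin 2) :
    ∑ p : Fin (k + 2), ∑ q : Fin (k + 1), slotAct (X (A p) (A (p.succAbove q))) T
      (fun m => A (p.succAbove (q.succAbove m))) = 0 := by
  cases k with
  | zero => simp [slotAct]
  | succ k =>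
    have h1 : ∀ P Q a, slotAct (X P Q) T a = c *
        (∑ m : Fin (k + 1), eps P (a m) * T (Fin.cons Q (fun j => a (m.succAbove j)))
        + ∑ m : Fin (k + 1), eps Q (a m) * T (Fin.cons P (fun j => a (m.succAbove j)))) := by
      intro P Q a
      simp only [slotAct, hX, update_eq_cons_of_symm hT]
      rw [← Finset.sum_add_distrib, Finset.mul_sum]
      refine Finset.sum_congr rfl fun m _ => ?_
      simp only [mul_assoc, ← Finset.mul_sum, add_mul, Finset.sum_add_distrib, Matrix.one_apply,
        ite_mul, one_mul, zero_mul, Finset.sum_ite_eq, Finset.mem_univ, if_true]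
    -- With the position `p` of the index carried into `T` fixed, the other two distinguished
    -- indices sit in `ε`, and summing over them gives zero.
    have h2 : ∑ p : Fin (k + 3), ∑ q : Fin (k + 2), ∑ m : Fin (k + 1),
        eps (A (p.succAbove q)) (A (p.succAbove (q.succAbove m))) * T (Fin.cons (A p)
          (fun j => A (p.succAbove (q.succAbove (m.succAbove j))))) = 0 :=
      Finset.sum_eq_zero fun p _ => sum_eps_pair (fun a => T (Fin.cons (A p) a))
        (fun j => A (p.succAbove j))
    have h3 := sum_removeNth_swap (fun P Q a => ∑ m : Fin (k + 1), eps Q (a m) *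
      T (Fin.cons P (fun j => a (m.succAbove j)))) A
    simp only [h1, mul_add, Finset.sum_add_distrib, ← Finset.mul_sum]
    rw [← h3, h2]
    simp

end Vanishing

/-! ### The curvature conditions imply commutation. -/

section Sufficiency

open SpinStructure

variable {M : Type*} [TopologicalSpace M] [ChartedSpace E4 M] [IsManifold (𝓡 4) ∞ M]
  [Bundle.RiemannianBundle (fun x : M => TangentSpace (𝓡 4) x)]
  {S : SpinStructure M} {k n : ℕ}

lemma curvPair_eq (i : S.ι) (x : M) (T : SpinTensor k n) (A : Fin (k + 2) → Fin 2)
    (A' : Fin n → Fin 2) : curvPair i x T A A' =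
      ∑ p : Fin (k + 2), ∑ q : Fin (k + 1),
        act (spinCurvPlus (riemann (S.e i) x) (A p) (A (p.succAbove q)))
          (spinCurvMinus (riemann (S.e i) x) (A p) (A (p.succAbove q))) T
          (fun m => A (p.succAbove (q.succAbove m))) A' := by
  simp only [curvPair, curvAct, act, spinCurvPlus, spinCurvMinus, slotAct_matrix_sum,
    slotAct_matrix_smul, mul_add, Finset.sum_add_distrib]

variable [IsContMDiffRiemannianBundle (𝓡 4) ∞ E4 (fun x : M => TangentSpace (𝓡 4) x)]

lemma isCurvatureTensor_riemann (i : S.ι) {x : M} (hx : x ∈ S.U i) :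
    IsCurvatureTensor (riemann (S.e i) x) where
  skew_left := (S.isOrthonormalFrame i).riemann_skew_left hx
  skew_right := (S.isOrthonormalFrame i).riemann_skew_right hx
  bianchi := (S.isOrthonormalFrame i).bianchi hx

lemma weylPlusVanishes_iff : S.WeylPlusVanishes ↔
    ∀ i, ∀ x ∈ S.U i, IsScalarBlock (riemann (S.e i) x) :=
  forall_congr' fun i => forall₂_congr fun _ hx =>
    weylPlus_eq_zero_iff (isCurvatureTensor_riemann i hx)

lemma isEinstein_iff : S.IsEinstein ↔
    ∀ i, ∀ x ∈ S.U i, ∀ j l, blockMixed (riemann (S.e i) x) j l = 0 :=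
  forall_congr' fun i => forall₂_congr fun _ hx =>
    einstein_iff (isCurvatureTensor_riemann i hx)

/-- The actions on unprimed and primed indices vanish separately. A factor with no indices
contributes an empty sum, which is why each condition is needed only for a nonzero exponent. -/
lemma commutesOn_of_curvature (hW : k ≠ 0 → S.WeylPlusVanishes) (hE : n ≠ 0 → S.IsEinstein) :
    S.CommutesOn k n := by
  rw [commutesOn_iff]
  intro ψ i x hx
  have hR := isCurvatureTensor_riemann i hx
  funext A A'
  rw [curvPair_eq]
  simp only [act, Finset.sum_add_distrib, Pi.zero_apply]
  have h1 : ∑ p : Fin (k + 2), ∑ q : Fin (k + 1),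
      slotAct (spinCurvPlus (riemann (S.e i) x) (A p) (A (p.succAbove q)))
        (fun a => ψ.comp i x a A') (fun m => A (p.succAbove (q.succAbove m))) = 0 := by
    rcases Nat.eq_zero_or_pos k with rfl | hk
    · simp [slotAct]
    · exact sum_slotAct_eq_zero (spinCurvPlus_of_isScalarBlock hR
        (weylPlusVanishes_iff.1 (hW hk.ne') i x hx))
        (fun t a => by simpa using ψ.symm i x hx t 1 a A') A
  have h2 : ∑ p : Fin (k + 2), ∑ q : Fin (k + 1),
      slotAct (spinCurvMinus (riemann (S.e i) x) (A p) (A (p.succAbove q)))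
        (ψ.comp i x (fun m => A (p.succAbove (q.succAbove m)))) A' = 0 := by
    rcases Nat.eq_zero_or_pos n with rfl | hn
    · simp [slotAct]
    · simp [spinCurvMinus_eq_zero hR (isEinstein_iff.1 (hE hn.ne') i x hx), slotAct]
  rw [h1, h2, add_zero]

end Sufficiency

/-! ### Contractions with powers of spinors. -/

section TestTensors

variable {k n : ℕ}

/-- The tensor `ξ^k η^n`. -/
def pureTensor (k n : ℕ) (ξ η : Fin 2 → ℂ) : SpinTensor k n :=
  fun A A' => (∏ m, ξ (A m)) * ∏ m, η (A' m)

lemma sum_prod_succAbove (κ : Fin 2 → ℂ) (F : Fin 2 → (Fin k → Fin 2) → ℂ) (p : Fin (k + 1)) :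
    ∑ A : Fin (k + 1) → Fin 2, (∏ m, κ (A m)) * F (A p) (fun m => A (p.succAbove m)) =
      ∑ P, κ P * ∑ a : Fin k → Fin 2, (∏ m, κ (a m)) * F P a := by
  rw [← (Fin.insertNthEquiv (fun _ => Fin 2) p).sum_comp, Fintype.sum_prod_type]
  refine Finset.sum_congr rfl fun P _ => ?_
  rw [Finset.mul_sum]
  refine Finset.sum_congr rfl fun a _ => ?_
  rw [Fin.prod_univ_succAbove _ p]
  simp [Fin.insertNthEquiv, mul_assoc]

lemma sum_prod_mul_prod (κ ξ : Fin 2 → ℂ) :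
    ∑ a : Fin k → Fin 2, (∏ m, κ (a m)) * ∏ m, ξ (a m) = (∑ P, κ P * ξ P) ^ k := by
  simp only [← Finset.prod_mul_distrib]
  exact (Fintype.sum_pow (fun P => κ P * ξ P) k).symm

/-- The bilinear form of a matrix. -/
def bilin (X : Matrix (Fin 2) (Fin 2) ℂ) (κ ξ : Fin 2 → ℂ) : ℂ := ∑ P, ∑ B, κ P * X P B * ξ B

/-- Each of the `k` slots contributes the same amount. For `k = 0` the truncated exponent `k - 1` is
harmless because of the factor `k`. -/
lemma sum_prod_slotAct (X : Matrix (Fin 2) (Fin 2) ℂ) (κ ξ : Fin 2 → ℂ) :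
    ∑ a : Fin k → Fin 2, (∏ m, κ (a m)) * slotAct X (fun a => ∏ m, ξ (a m)) a =
      k * bilin X κ ξ * (∑ P, κ P * ξ P) ^ (k - 1) := by
  cases k with
  | zero => simp [slotAct]
  | succ k =>
    have h : ∀ a : Fin (k + 1) → Fin 2, slotAct X (fun a => ∏ m, ξ (a m)) a =
        ∑ m : Fin (k + 1), (∑ B, X (a m) B * ξ B) * ∏ j, ξ (a (m.succAbove j)) := by
      intro a
      simp only [slotAct]
      refine Finset.sum_congr rfl fun m _ => ?_
      rw [Finset.sum_mul]
      refine Finset.sum_congr rfl fun B _ => ?_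
      rw [Fin.prod_univ_succAbove _ m, Function.update_self, mul_assoc]
      simp only [Function.update_of_ne (Fin.succAbove_ne m _)]
    simp only [h, Finset.mul_sum]
    rw [Finset.sum_comm]
    have h2 : ∀ m : Fin (k + 1), ∑ a : Fin (k + 1) → Fin 2, (∏ m, κ (a m)) *
        ((∑ B, X (a m) B * ξ B) * ∏ j, ξ (a (m.succAbove j))) =
        bilin X κ ξ * (∑ P, κ P * ξ P) ^ k := by
      intro m
      rw [sum_prod_succAbove κ (fun P a => (∑ B, X P B * ξ B) * ∏ j, ξ (a j)) m]
      simp only [mul_left_comm _ (∑ B, _), ← Finset.mul_sum, sum_prod_mul_prod, bilin]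
      rw [Finset.sum_mul]
      refine Finset.sum_congr rfl fun P _ => ?_
      simp only [Finset.sum_mul]
      exact Finset.sum_congr rfl fun B _ => by ring
    rw [Finset.sum_congr rfl fun m _ => h2 m]
    simp
    ring

lemma sum_prod_pair (κ : Fin 2 → ℂ) (F : Fin 2 → Fin 2 → (Fin k → Fin 2) → ℂ) :
    ∑ A : Fin (k + 2) → Fin 2, (∏ m, κ (A m)) * ∑ p : Fin (k + 2), ∑ q : Fin (k + 1),
        F (A p) (A (p.succAbove q)) (fun m => A (p.succAbove (q.succAbove m))) =
      (k + 2) * (k + 1) * ∑ P, κ P * ∑ Q, κ Q * ∑ a : Fin k → Fin 2, (∏ m, κ (a m)) * F P Q a := by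
  simp only [Finset.mul_sum]
  rw [Finset.sum_comm]
  simp only [Finset.sum_comm (s := Finset.univ (α := Fin (k + 2) → Fin 2))
    (t := Finset.univ (α := Fin (k + 1)))]
  have h : ∀ p : Fin (k + 2), ∀ q : Fin (k + 1), ∑ A : Fin (k + 2) → Fin 2, (∏ m, κ (A m)) *
      F (A p) (A (p.succAbove q)) (fun m => A (p.succAbove (q.succAbove m))) =
      ∑ P, κ P * ∑ Q, κ Q * ∑ a : Fin k → Fin 2, (∏ m, κ (a m)) * F P Q a := by
    intro p q
    rw [sum_prod_succAbove κ (fun P a => F P (a q) (fun m => a (q.succAbove m))) p]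
    exact Finset.sum_congr rfl fun P _ => by
      rw [sum_prod_succAbove κ (fun Q a => F P Q a) q]
  simp only [h, Finset.sum_const, Finset.card_univ, Fintype.card_fin, nsmul_eq_mul,
    Finset.mul_sum]
  push_cast
  simp only [mul_assoc]

/-- The contraction of `act X Y (ξ^k η^n)` with `κ^k κ'^n`. -/
lemma sum_act_pureTensor (X Y : Matrix (Fin 2) (Fin 2) ℂ) (κ ξ κ' η : Fin 2 → ℂ) :
    ∑ a : Fin k → Fin 2, (∏ m, κ (a m)) * ∑ a' : Fin n → Fin 2, (∏ m, κ' (a' m)) *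
      act X Y (pureTensor k n ξ η) a a' =
    k * bilin X κ ξ * (∑ P, κ P * ξ P) ^ (k - 1) * (∑ P, κ' P * η P) ^ n
      + n * bilin Y κ' η * (∑ P, κ P * ξ P) ^ k * (∑ P, κ' P * η P) ^ (n - 1) := by
  have h1 : ∀ a a', act X Y (pureTensor k n ξ η) a a' =
      slotAct X (fun a => ∏ m, ξ (a m)) a * (∏ m, η (a' m))
        + (∏ m, ξ (a m)) * slotAct Y (fun a' => ∏ m, η (a' m)) a' := by
    intro a a'
    have hX := slotAct_const_mul X (fun a : Fin k → Fin 2 => ∏ m, ξ (a m)) a (∏ m, η (a' m))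
    have hY := slotAct_const_mul Y (fun a : Fin n → Fin 2 => ∏ m, η (a m)) a' (∏ m, ξ (a m))
    rw [← hY, mul_comm, ← hX]
    simp only [act, pureTensor, mul_comm]
    rfl
  simp only [h1, mul_add, Finset.sum_add_distrib, mul_left_comm _ (slotAct X _ _),
    mul_left_comm _ (∏ m, ξ _), ← Finset.mul_sum, sum_prod_mul_prod, sum_prod_slotAct]
  simp only [← mul_assoc, ← Finset.sum_mul]
  simp only [mul_comm (slotAct X _ _), mul_comm (∏ m, ξ _), sum_prod_mul_prod, sum_prod_slotAct]
  ring

end TestTensors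

/-! ### Recovering the blocks from their values on null vectors. -/

section NullVectors

/-- The contraction of a matrix-valued bilinear form with `κ, κ, κ', η`. -/
def contractPair (X : Fin 2 → Fin 2 → Matrix (Fin 2) (Fin 2) ℂ) (κ κ' η : Fin 2 → ℂ) : ℂ :=
  ∑ P, κ P * ∑ Q, κ Q * bilin (X P Q) κ' η

/-- The isotropic vector of `ℂ³` which corresponds to the square of the spinor `(1, z)`. -/
def nullVec (z : ℂ) : Fin 3 → ℂ :=
  ![2 * Complex.I * z, -(1 + z ^ 2), Complex.I * (z ^ 2 - 1)]

/-- The last spinor is `(1, 0) + s (-z', 1)`: its pairing with `(1, z')` is `1` for every `s`, and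
the contraction is affine in `s`. Since `(-z', 1)` annihilates `(1, z')`, the coefficient of `s`
involves `nullVec z'`, the square of `(1, z')`. -/
lemma contractPair_apply {X : Fin 2 → Fin 2 → Matrix (Fin 2) (Fin 2) ℂ} {b : Fin 3 → Fin 3 → ℝ}
    (hX : ∀ P Q A B, X P Q A B =
      -∑ i, ∑ j, (b i j : ℂ) * soldering i.succ P Q * quat (Fin.succ j) A B) (z z' s : ℂ) :
    contractPair X ![1, z] ![1, z'] ![1 - s * z', s] =
      -∑ i, ∑ j, (b i j : ℂ) * nullVec z i *
        ((![Complex.I, -z', Complex.I * z'] : Fin 3 → ℂ) j - s * nullVec z' j) := by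
  simp only [contractPair, bilin, hX, Fin.sum_univ_two, Fin.sum_univ_three, soldering,
    Matrix.mul_apply]
  simp [quat, eps, nullVec]
  ring

lemma contractPair_sub {X : Fin 2 → Fin 2 → Matrix (Fin 2) (Fin 2) ℂ} {b : Fin 3 → Fin 3 → ℝ}
    (hX : ∀ P Q A B, X P Q A B =
      -∑ i, ∑ j, (b i j : ℂ) * soldering i.succ P Q * quat (Fin.succ j) A B) (z z' : ℂ) :
    contractPair X ![1, z] ![1, z'] ![1 - 1 * z', 1]
      - contractPair X ![1, z] ![1, z'] ![1 - (-1) * z', -1] =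
      2 * ∑ i, ∑ j, (b i j : ℂ) * nullVec z i * nullVec z' j := by
  rw [contractPair_apply hX, contractPair_apply hX]
  simp only [Fin.sum_univ_three]
  ring

/-- A quadratic form vanishing on the null cone is a multiple of the metric. As `b` is real, the
real and imaginary parts at `z = 0, 1, I` already give all the equations. -/
lemma eq_scalar_of_nullVec {b : Fin 3 → Fin 3 → ℝ} (hb : ∀ i j, b i j = b j i)
    (h : ∀ z, ∑ i, ∑ j, (b i j : ℂ) * nullVec z i * nullVec z j = 0) :
    b 0 1 = 0 ∧ b 0 2 = 0 ∧ b 1 2 = 0 ∧ b 0 0 = b 1 1 ∧ b 1 1 = b 2 2 := by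
  have h0 := h 0
  have h1 := h 1
  have h2 := h Complex.I
  simp only [Fin.sum_univ_three, nullVec, Complex.ext_iff, hb 1 0, hb 2 0, hb 2 1] at h0 h1 h2
  simp at h0 h1 h2
  refine ⟨?_, ?_, ?_, ?_, ?_⟩ <;> linarith [h0.1, h0.2, h1.1, h1.2, h2.1, h2.2]

/-- The null vectors at `z = 0, 1, -1` span `ℂ³`, so a bilinear form vanishing on pairs of null
vectors is zero. -/
lemma eq_zero_of_nullVec {b : Fin 3 → Fin 3 → ℝ}
    (h : ∀ z z', ∑ i, ∑ j, (b i j : ℂ) * nullVec z i * nullVec z' j = 0) (i j : Fin 3) :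
    b i j = 0 := by
  have hlin : ∀ c : Fin 3 → ℂ, (∀ z, ∑ i, c i * nullVec z i = 0) → ∀ i, c i = 0 := by
    intro c hc
    have h0 := hc 0
    have h1 := hc 1
    have h2 := hc (-1)
    simp only [Fin.sum_univ_three, nullVec] at h0 h1 h2
    simp at h0 h1 h2
    have c1 : c 1 = 0 := by linear_combination (-1 / 4) * (h1 + h2)
    have c0 : c 0 = 0 := by
      have : c 0 * Complex.I = 0 := by linear_combination (1 / 4) * (h1 - h2)
      simpa using this
    have c2 : c 2 = 0 := by
      have : c 2 * Complex.I = 0 := by linear_combination -h0 - c1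
      simpa using this
    intro i
    fin_cases i <;> assumption
  have h1 : ∀ z' i, ∑ j, (b i j : ℂ) * nullVec z' j = 0 := by
    intro z'
    refine hlin (fun i => ∑ j, (b i j : ℂ) * nullVec z' j) fun z => ?_
    rw [← h z z']
    simp only [Finset.sum_mul]
    exact Finset.sum_congr rfl fun i _ => Finset.sum_congr rfl fun j _ => by ring
  exact_mod_cast hlin (fun j => (b i j : ℂ)) (fun z => h1 z i) j

/-- The curvature conditions extracted from the vanishing of the contractions. -/
lemma blocks_of_contractPair {R : Fin 4 → Fin 4 → Fin 4 → Fin 4 → ℝ} (hR : IsCurvatureTensor R)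
    {k n : ℕ} (h : ∀ κ ξ κ' η : Fin 2 → ℂ,
      k * contractPair (spinCurvPlus R) κ κ ξ * (∑ P, κ P * ξ P) ^ (k - 1)
          * (∑ P, κ' P * η P) ^ n
        + n * contractPair (spinCurvMinus R) κ κ' η * (∑ P, κ P * ξ P) ^ k
          * (∑ P, κ' P * η P) ^ (n - 1) = 0) :
    (k ≠ 0 → IsScalarBlock R) ∧ (n ≠ 0 → ∀ i j, blockMixed R i j = 0) := by
  have hone : ∀ z s : ℂ, ∑ P, (![1, z] : Fin 2 → ℂ) P * (![1 - s * z, s] : Fin 2 → ℂ) P = 1 := by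
    intro z s
    simp [Fin.sum_univ_two]
    ring
  have h' : ∀ z s z' s' : ℂ,
      k * contractPair (spinCurvPlus R) ![1, z] ![1, z] ![1 - s * z, s]
        + n * contractPair (spinCurvMinus R) ![1, z] ![1, z'] ![1 - s' * z', s'] = 0 := by
    intro z s z' s'
    simpa only [hone, one_pow, mul_one] using
      h ![1, z] ![1 - s * z, s] ![1, z'] ![1 - s' * z', s']
  have hplus : k ≠ 0 → IsScalarBlock R := by
    intro hk
    refine eq_scalar_of_nullVec (blockPlus_symm hR) fun z => ?_
    have hk' : (k : ℂ) ≠ 0 := Nat.cast_ne_zero.2 hk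
    have hs := contractPair_sub (spinCurvPlus_apply hR) z z
    have : (k : ℂ) * (2 * ∑ i, ∑ j, (blockPlus R i j : ℂ) * nullVec z i * nullVec z j) = 0 := by
      rw [← hs]
      -- The `S₋` term is the same in both equations and cancels, leaving the coefficient of `s`.
      linear_combination h' z 1 0 0 - h' z (-1) 0 0
    simpa [hk'] using this
  refine ⟨hplus, fun hn => eq_zero_of_nullVec fun z z' => ?_⟩
  have hn' : (n : ℂ) ≠ 0 := Nat.cast_ne_zero.2 hn
  have hs := contractPair_sub (spinCurvMinus_apply hR) z z'
  have : (n : ℂ) * (2 * ∑ i, ∑ j, (blockMixed R i j : ℂ) * nullVec z i * nullVec z' j) = 0 := by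
    rw [← hs]
    -- Now the `S₊` term cancels, and `z'` is free of `z`, so the two null vectors are independent.
    linear_combination h' z 0 z' 1 - h' z 0 z' (-1)
  simpa [hn'] using this

end NullVectors

/-! ### Sections with prescribed value at a point, and the equivalence. -/

section TestSections

open SpinStructure

variable {M : Type*} [TopologicalSpace M] [ChartedSpace E4 M] [IsManifold (𝓡 4) ∞ M]
  [Bundle.RiemannianBundle (fun x : M => TangentSpace (𝓡 4) x)]
  {S : SpinStructure M}

/-- Contraction with a power of one spinor makes all `(k + 2) (k + 1)` pairs of positions contribute
equally, so nothing is lost through the symmetrisation. -/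
lemma contract_curvPair {k n : ℕ} (i : S.ι) (x : M) (κ ξ κ' η : Fin 2 → ℂ) :
    ∑ A : Fin (k + 2) → Fin 2, (∏ m, κ (A m)) * ∑ A' : Fin n → Fin 2, (∏ m, κ' (A' m)) *
      curvPair i x (pureTensor k n ξ η) A A' =
    (k + 2) * (k + 1) *
      (k * contractPair (spinCurvPlus (riemann (S.e i) x)) κ κ ξ * (∑ P, κ P * ξ P) ^ (k - 1)
          * (∑ P, κ' P * η P) ^ n
        + n * contractPair (spinCurvMinus (riemann (S.e i) x)) κ κ' η * (∑ P, κ P * ξ P) ^ k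
          * (∑ P, κ' P * η P) ^ (n - 1)) := by
  have h1 : ∀ A : Fin (k + 2) → Fin 2, ∑ A' : Fin n → Fin 2, (∏ m, κ' (A' m)) *
      curvPair i x (pureTensor k n ξ η) A A' =
      ∑ p : Fin (k + 2), ∑ q : Fin (k + 1), ∑ A' : Fin n → Fin 2, (∏ m, κ' (A' m)) *
        act (spinCurvPlus (riemann (S.e i) x) (A p) (A (p.succAbove q)))
          (spinCurvMinus (riemann (S.e i) x) (A p) (A (p.succAbove q))) (pureTensor k n ξ η)
          (fun m => A (p.succAbove (q.succAbove m))) A' := by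
    intro A
    simp only [curvPair_eq, Finset.mul_sum]
    rw [Finset.sum_comm]
    exact Finset.sum_congr rfl fun p _ => Finset.sum_comm
  simp only [h1]
  rw [sum_prod_pair κ (fun P Q a => ∑ A' : Fin n → Fin 2, (∏ m, κ' (A' m)) *
        act (spinCurvPlus (riemann (S.e i) x) P Q)
          (spinCurvMinus (riemann (S.e i) x) P Q) (pureTensor k n ξ η) a A')]
  simp only [sum_act_pureTensor, contractPair, Fin.sum_univ_two]
  ring

lemma tp_self (i : S.ι) {x : M} (hx : x ∈ S.U i) : S.tp i i x = 1 :=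
  mul_eq_left.1 (S.cocycle_tp i i i x ⟨⟨hx, hx⟩, hx⟩)

lemma tm_self (i : S.ι) {x : M} (hx : x ∈ S.U i) : S.tm i i x = 1 :=
  mul_eq_left.1 (S.cocycle_tm i i i x ⟨⟨hx, hx⟩, hx⟩)

lemma sum_prod_mul_prod_matrix {k : ℕ} (P : Matrix (Fin 2) (Fin 2) ℂ) (ξ : Fin 2 → ℂ)
    (A : Fin k → Fin 2) :
    ∑ B : Fin k → Fin 2, (∏ m, P (A m) (B m)) * ∏ m, ξ (B m) = ∏ m, (P.mulVec ξ) (A m) := by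
  simp only [← Finset.prod_mul_distrib, Matrix.mulVec, dotProduct]
  rw [Finset.prod_univ_sum, Fintype.piFinset_univ]

/-- The section of `S₊^k ⊗ S₋^n` with components `χ ξ^k η^n` in the trivialisation `i`, extended
by zero. -/
def testSection (i : S.ι) (k n : ℕ) (ξ η : Fin 2 → ℂ) (χ : M → ℝ)
    (hχ : ContMDiff (𝓡 4) 𝓘(ℝ, ℝ) ∞ χ) (hsupp : tsupport χ ⊆ S.U i) : SpinorField S k n where
  comp j y := fun A A' => (χ y : ℂ) * pureTensor k n
    ((S.tp j i y : Matrix (Fin 2) (Fin 2) ℂ).mulVec ξ)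
    ((S.tm j i y : Matrix (Fin 2) (Fin 2) ℂ).mulVec η) A A'
  smooth j A A' := by
    intro y hy
    by_cases hyi : y ∈ S.U i
    · have hs : SmoothC (S.U j ∩ S.U i) (fun y => (χ y : ℂ) * pureTensor k n
          ((S.tp j i y : Matrix (Fin 2) (Fin 2) ℂ).mulVec ξ)
          ((S.tm j i y : Matrix (Fin 2) (Fin 2) ℂ).mulVec η) A A') := by
        refine .mul (.ofReal hχ.contMDiffOn) (.mul (.prod fun m _ => ?_) (.prod fun m _ => ?_))
        · simp only [Matrix.mulVec, dotProduct]
          exact .sum fun B _ => .mul (S.smooth_tp j i _ _) (.const _)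
        · simp only [Matrix.mulVec, dotProduct]
          exact .sum fun B _ => .mul (S.smooth_tm j i _ _) (.const _)
      exact (hs.contMDiffAt (((S.isOpen_U j).inter (S.isOpen_U i)).mem_nhds
        ⟨hy, hyi⟩)).contMDiffWithinAt
    · have h0 : χ =ᶠ[nhds y] 0 := notMem_tsupport_iff_eventuallyEq.1 fun h => hyi (hsupp h)
      refine (ContMDiffAt.congr_of_eventuallyEq (contMDiffAt_const (c := (0 : ℂ)))
        ?_).contMDiffWithinAt
      filter_upwards [h0] with z hz
      simp [hz]
  symm j y hy s t A A' := by
    simp only [pureTensor, Function.comp_apply]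
    rw [Equiv.prod_comp s fun m => (S.tp j i y : Matrix (Fin 2) (Fin 2) ℂ).mulVec ξ (A m),
      Equiv.prod_comp t fun m => (S.tm j i y : Matrix (Fin 2) (Fin 2) ℂ).mulVec η (A' m)]
  transition j l y hy A A' := by
    by_cases hχy : χ y = 0
    · simp [hχy]
    -- Where `χ` is nonzero, the point lies in `U i`, so the cocycle condition through `i` is
    -- available.
    have hyi : y ∈ S.U i := hsupp (subset_tsupport χ hχy)
    have hp : (S.tp j i y : Matrix (Fin 2) (Fin 2) ℂ) = S.tp j l y * S.tp l i y := by
      rw [← S.cocycle_tp j l i y ⟨hy, hyi⟩]; rfl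
    have hm : (S.tm j i y : Matrix (Fin 2) (Fin 2) ℂ) = S.tm j l y * S.tm l i y := by
      rw [← S.cocycle_tm j l i y ⟨hy, hyi⟩]; rfl
    simp only [pureTensor, hp, hm, ← Matrix.mulVec_mulVec, ← sum_prod_mul_prod_matrix]
    rw [Finset.sum_mul_sum, Finset.mul_sum]
    refine Finset.sum_congr rfl fun B _ => ?_
    rw [Finset.mul_sum]
    exact Finset.sum_congr rfl fun B' _ => by
      rw [sum_prod_mul_prod_matrix, sum_prod_mul_prod_matrix]; ring

variable [T2Space M]

/-- A bump function supported in `U i` makes the constant tensor in that trivialisation a global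
section; at `x` the bump is `1` and the transition functions from `i` to itself are trivial. -/
lemma exists_spinorField_eq (i : S.ι) {x : M} (hx : x ∈ S.U i) (k n : ℕ) (ξ η : Fin 2 → ℂ) :
    ∃ ψ : SpinorField S k n, ψ.comp i x = pureTensor k n ξ η := by
  obtain ⟨χ, -, hχ⟩ := (SmoothBumpFunction.nhds_basis_tsupport (I := 𝓡 4) x).mem_iff.1
    ((S.isOpen_U i).mem_nhds hx)
  refine ⟨testSection i k n ξ η χ χ.contMDiff hχ, ?_⟩
  funext A A'
  simp only [testSection, tp_self i hx, tm_self i hx, OneMemClass.coe_one, Matrix.one_mulVec,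
    χ.eq_one, Complex.ofReal_one, one_mul]

variable [IsContMDiffRiemannianBundle (𝓡 4) ∞ E4 (fun x : M => TangentSpace (𝓡 4) x)]

lemma curvature_of_commutesOn {k n : ℕ} (h : S.CommutesOn k n) :
    (k ≠ 0 → S.WeylPlusVanishes) ∧ (n ≠ 0 → S.IsEinstein) := by
  rw [commutesOn_iff] at h
  have key : ∀ i, ∀ x ∈ S.U i, (k ≠ 0 → IsScalarBlock (riemann (S.e i) x)) ∧
      (n ≠ 0 → ∀ j l, blockMixed (riemann (S.e i) x) j l = 0) := by
    intro i x hx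
    refine blocks_of_contractPair (isCurvatureTensor_riemann i hx) fun κ ξ κ' η => ?_
    obtain ⟨ψ, hψ⟩ := exists_spinorField_eq i hx k n ξ η
    have h0 := h ψ i x hx
    rw [hψ] at h0
    have h1 := contract_curvPair (k := k) (n := n) i x κ ξ κ' η
    simp only [h0, Pi.zero_apply, mul_zero, Finset.sum_const_zero] at h1
    have hk : ((k : ℂ) + 2) * (k + 1) ≠ 0 := by
      refine mul_ne_zero ?_ (Nat.cast_add_one_ne_zero k)
      exact_mod_cast Nat.succ_ne_zero (k + 1)
    exact (mul_eq_zero.1 h1.symm).resolve_left hk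
  exact ⟨fun hk => weylPlusVanishes_iff.2 fun i x hx => (key i x hx).1 hk,
    fun hn => isEinstein_iff.2 fun i x hx => (key i x hx).2 hn⟩

/-- Valid for all `k, n` at once: each exponent switches on its own curvature condition. -/
lemma commutesOn_iff_curvature {k n : ℕ} : S.CommutesOn k n ↔
    (k ≠ 0 → S.WeylPlusVanishes) ∧ (n ≠ 0 → S.IsEinstein) :=
  ⟨curvature_of_commutesOn, fun h => commutesOn_of_curvature h.1 h.2⟩

end TestSections

end SpinFour

end

theorem proposition1 {M : Type*} [TopologicalSpace M] [T2Space M]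
    [ChartedSpace SpinFour.E4 M] [IsManifold (𝓡 4) ∞ M]
    [Bundle.RiemannianBundle (fun x : M => TangentSpace (𝓡 4) x)]
    [IsContMDiffRiemannianBundle (𝓡 4) ∞ SpinFour.E4 (fun x : M => TangentSpace (𝓡 4) x)]
    (S : SpinFour.SpinStructure M) :
    ((∀ k n : ℕ, S.CommutesOn k n) ↔ S.WeylPlusVanishes ∧ S.IsEinstein) ∧
    (∀ k n : ℕ, 1 ≤ k → 1 ≤ n →
      (S.CommutesOn k n ↔ S.WeylPlusVanishes ∧ S.IsEinstein)) ∧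
    (∀ k : ℕ, 1 ≤ k →
      ((∀ ψ : SpinFour.SpinorField S k 0, ∀ i, ∀ x ∈ S.U i,
          SpinFour.SpinStructure.deltaOp i (SpinFour.SpinStructure.dOp i (ψ.comp i)) x = 0)
        ↔ S.WeylPlusVanishes)) ∧
    (∀ n : ℕ, 1 ≤ n → (S.CommutesOn 0 n ↔ S.IsEinstein)) := by
  have key : ∀ k n : ℕ, S.CommutesOn k n ↔
      (k ≠ 0 → S.WeylPlusVanishes) ∧ (n ≠ 0 → S.IsEinstein) :=
    fun k n => SpinFour.commutesOn_iff_curvature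
  refine ⟨⟨fun h => ?_, fun h k n => (key k n).2 ⟨fun _ => h.1, fun _ => h.2⟩⟩, ?_, ?_, ?_⟩
  -- The pair `k = n = 1` alone forces both conditions.
  · have h' := (key 1 1).1 (h 1 1)
    exact ⟨h'.1 one_ne_zero, h'.2 one_ne_zero⟩
  · intro k n hk hn
    simp [key k n, Nat.one_le_iff_ne_zero.1 hk, Nat.one_le_iff_ne_zero.1 hn]
  · intro k hk
    -- `CommutesOn k 0` unfolds to the vanishing of `δd`.
    have := key k 0
    simp only [ne_eq, Nat.one_le_iff_ne_zero.1 hk, not_false_eq_true, true_imp_iff, not_true,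
      false_imp_iff, and_true] at this
    exact this
  · intro n hn
    simp [key 0 n, Nat.one_le_iff_ne_zero.1 hn]
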